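/- **Setting.** Let $\mu\in\mathbb R$, $T>0$, $x_0\in\mathbb R$, $0<\rho<1/\sqrt2$, and let $M$ be a standard one-dimensional Brownian motion on a probability space. For a mesh size $h>0$ with $x_0/h\in\mathbb Z$ and a time step $k=T/N$ with $N\in\mathbb N$, $N\ge1$, let $V^n=(V^n_j)_{j\in\mathbb Z}\in\ell_2(\mathbb Z)$, $n=0,\dots,N$, be the solution of the implicit Milstein finite difference scheme for $\mathrm dv=-\mu v_x\,\mathrm dt+\tfrac12 v_{xx}\,\mathrm dt-\sqrt\rho\,v_x\,\mathrm dM_t$, $v(0,\cdot)=\delta_{x_0}$, in which the spatial derivatives are discretised first: $$V^{n+1}=V^n-\frac{\mu k}{2h}D_1V^{n+1}+\frac{k}{2h^2}D_2V^{n+1}-\frac{\sqrt{\rho k}\,Z_n}{2h}D_1V^n+\frac{\rho k(Z_n^2-1)}{8h^2}D_1^2V^n,$$ with $V^0_j=h^{-1}$ if $j=x_0/h$ and $V^0_j=0$ otherwise, where $(D_1V)_j=V_{j+1}-V_{j-1}$, $(D_2V)_j=V_{j+1}-2V_j+V_{j-1}$, $(D_1^2V)_j=V_{j+2}-2V_j+V_{j-2}$,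 and $Z_n=(M_{(n+1)k}-M_{nk})/\sqrt k$. For $h_0>0$ with $x_0/h_0\in\mathbb Z$, and $k_0>0$ with $T/k_0\in\mathbb N$, define for $l_1,l_2\in\mathbb N_0$ $$L_{(l_1,l_2)}=1-h\sum_{j=1}^\infty V_j^N-\frac h2V_0^N,\qquad h=h_0\,2^{-l_1},\quad k=k_0\,2^{-2l_2},\quad N=T/k,$$ where all levels use the same Brownian motion $M$. For $l_1,l_2\ge1$ let $$\Delta L_{(l_1,l_2)}=L_{(l_1,l_2)}-L_{(l_1,l_2-1)}-L_{(l_1-1,l_2)}+L_{(l_1-1,l_2-1)}.$$ **Theorem.** For every $0<\rho<1/\sqrt2$ there is $\theta\in(0,1)$, depending only on $\rho$, such that for all $\mu\in\mathbb R$, $T>0$, $x_0\in\mathbb R$, $\beta>0$, $C_0>0$ there is a constant $C>0$, depending only on $\rho,\mu,T,x_0,\beta,C_0$, with the following property. For every $l_1^\ast\in\mathbb N_0$, every $h_0>0$ with $x_0/h_0\in\mathbb Z$, and every $k_0>0$ with $T/k_0\in\mathbb N$ such that $$k_0\,\bigl(C_0+(3+\beta)(l_1^\ast+\log_2h_0^{-1})\bigr)\le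 T\log_2(\theta^{-1})$$ (equivalently $\theta^{T/k_0}\le2^{-C_0}(h_02^{-l_1^\ast})^{3+\beta}$), and for all $1\le l_1\le l_1^\ast$ and $l_2\ge1$, the series defining the four losses converge, $\Delta L_{(l_1,l_2)}$ is square integrable, and $$\bigl|\mathbb E[\Delta L_{(l_1,l_2)}]\bigr|\le C\,h^2k,\qquad \mathbb E\bigl[|\Delta L_{(l_1,l_2)}|^2\bigr]\le C\,h^4k^2,$$ where $h=h_0\,2^{-l_1}$ and $k=k_0\,2^{-2l_2}$. -/

import Mathlib

open MeasureTheory ProbabilityTheory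
open scoped NNReal ENNReal

universe u

namespace ImplicitMilstein

/-- First central difference, `(D₁ V)_j = V_{j+1} - V_{j-1}`. -/
def D1 (V : ℤ → ℝ) (j : ℤ) : ℝ := V (j + 1) - V (j - 1)

/-- Second central difference, `(D₂ V)_j = V_{j+1} - 2 V_j + V_{j-1}`. -/
def D2 (V : ℤ → ℝ) (j : ℤ) : ℝ := V (j + 1) - 2 * V j + V (j - 1)

/-- Iterated first central difference, `(D₁² V)_j = V_{j+2} - 2 V_j + V_{j-2}`. -/
def D1sq (V : ℤ → ℝ) (j : ℤ) : ℝ := V (j + 2) - 2 * V j + V (j - 2)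

/-- The implicit side of one time step: `(I + μk/(2h) D₁ - k/(2h²) D₂) U`. -/
noncomputable def implicitPart (μ h k : ℝ) (U : ℤ → ℝ) (j : ℤ) : ℝ :=
  U j + μ * k / (2 * h) * D1 U j - k / (2 * h ^ 2) * D2 U j

/-- The explicit side of one time step driven by the normal variate `z`:
`(I - √(ρk) z/(2h) D₁ + ρk(z² - 1)/(8h²) D₁²) V`. -/
noncomputable def explicitPart (ρ h k z : ℝ) (V : ℤ → ℝ) (j : ℤ) : ℝ :=
  V j - √(ρ * k) * z / (2 * h) * D1 V j + ρ * k * (z ^ 2 - 1) / (8 * h ^ 2) * D1sq V j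

/-- `U` is a square-summable solution of the implicit equation with right-hand side `W`. -/
def IsImplicitSolution (μ h k : ℝ) (W U : ℤ → ℝ) : Prop :=
  Memℓp U 2 ∧ ∀ j, implicitPart μ h k U j = W j

/-- The square-summable solution of the implicit equation. It exists and is unique for square
summable `W` and positive `h`, `k`, see `existsUnique_isImplicitSolution`. -/
noncomputable def implicitSolve (μ h k : ℝ) (W : ℤ → ℝ) : ℤ → ℝ :=
  Classical.epsilon (IsImplicitSolution μ h k W)

/-- The grid approximation of the Dirac mass at `x₀`. -/
noncomputable def diracGrid (x₀ h : ℝ) (j : ℤ) : ℝ := if j = round (x₀ / h) then h⁻¹ else 0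

/-- The implicit Milstein finite difference scheme on `ℓ²(ℤ)`, mesh size `h`, time step `k`,
driven by the variates `z 0, z 1, …`. Its defining equation is `scheme_succ_eq`. -/
noncomputable def scheme (μ ρ x₀ h k : ℝ) (z : ℕ → ℝ) : ℕ → ℤ → ℝ
  | 0 => diracGrid x₀ h
  | n + 1 => implicitSolve μ h k (explicitPart ρ h k (z n) (scheme μ ρ x₀ h k z n))

/-- Trapezoidal approximation `1 - h ∑_{j ≥ 1} V_j - (h/2) V_0` of the loss
`1 - ∫₀^∞ v(T,x) dx` from grid values `V`. -/
noncomputable def trapezoidalLoss (h : ℝ) (V : ℤ → ℝ) : ℝ :=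
  1 - h * ∑' j : ℕ, V ((j : ℤ) + 1) - h / 2 * V 0

variable {Ω : Type u}

/-- The normalised increments `Z_n = (M_{(n+1)k} - M_{nk}) / √k` of the driving path. -/
noncomputable def normalIncrement (M : ℝ≥0 → Ω → ℝ) (k : ℝ) (ω : Ω) (n : ℕ) : ℝ :=
  (M (Real.toNNReal ((n + 1) * k)) ω - M (Real.toNNReal (n * k)) ω) / √k

/-- Mesh size on space level `l₁`. -/
noncomputable def meshSize (h₀ : ℝ) (l₁ : ℕ) : ℝ := h₀ * 2 ^ (-(l₁ : ℤ))

/-- Time step on time level `l₂`. -/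
noncomputable def timeStep (k₀ : ℝ) (l₂ : ℕ) : ℝ := k₀ * 2 ^ (-(2 * l₂ : ℤ))

/-- The finite difference solution at the final time on level `(l₁, l₂)`. With `T = N₀ k₀` the
number of steps of size `k₀ 2^{-2 l₂}` is `N₀ 2^{2 l₂}`. All levels use the same path `M`. -/
noncomputable def levelSolution (μ ρ x₀ h₀ k₀ : ℝ) (N₀ : ℕ) (M : ℝ≥0 → Ω → ℝ)
    (l₁ l₂ : ℕ) (ω : Ω) : ℤ → ℝ :=
  scheme μ ρ x₀ (meshSize h₀ l₁) (timeStep k₀ l₂) (normalIncrement M (timeStep k₀ l₂) ω)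
    (N₀ * 2 ^ (2 * l₂))

/-- The approximate loss `L_{(l₁,l₂)}`. -/
noncomputable def levelLoss (μ ρ x₀ h₀ k₀ : ℝ) (N₀ : ℕ) (M : ℝ≥0 → Ω → ℝ)
    (l₁ l₂ : ℕ) (ω : Ω) : ℝ :=
  trapezoidalLoss (meshSize h₀ l₁) (levelSolution μ ρ x₀ h₀ k₀ N₀ M l₁ l₂ ω)

/-- First order difference in the space level. -/
def spaceDiff (L : ℕ → ℕ → ℝ) (l₁ l₂ : ℕ) : ℝ :=
  if 0 < l₁ then L l₁ l₂ - L (l₁ - 1) l₂ else L l₁ l₂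

/-- First order difference in the time level. -/
def timeDiff (L : ℕ → ℕ → ℝ) (l₁ l₂ : ℕ) : ℝ :=
  if 0 < l₂ then L l₁ l₂ - L l₁ (l₂ - 1) else L l₁ l₂

/-- The mixed first order difference `Δ = Δ₁ ⊗ Δ₂`. -/
def mixedDiff (L : ℕ → ℕ → ℝ) : ℕ → ℕ → ℝ := spaceDiff (timeDiff L)

/-- The increment `ΔL_{(l₁,l₂)}` as a random variable. -/
noncomputable def lossIncrement (μ ρ x₀ h₀ k₀ : ℝ) (N₀ : ℕ) (M : ℝ≥0 → Ω → ℝ)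
    (l₁ l₂ : ℕ) (ω : Ω) : ℝ :=
  mixedDiff (fun a b => levelLoss μ ρ x₀ h₀ k₀ N₀ M a b ω) l₁ l₂

/-! ### Well-posedness of the scheme -/

theorem D1sq_eq (V : ℤ → ℝ) : D1sq V = D1 (D1 V) := by
  funext j
  simp only [D1sq, D1]
  rw [show j + 1 + 1 = j + 2 by ring, show j + 1 - 1 = j by ring, show j - 1 + 1 = j by ring,
    show j - 1 - 1 = j - 2 by ring]
  ring

theorem memlp_two_iff (f : ℤ → ℝ) : Memℓp f 2 ↔ Summable fun j => f j ^ 2 := by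
  rw [memℓp_gen_iff (by norm_num)]
  simp

theorem memlp_shift {f : ℤ → ℝ} (hf : Memℓp f 2) (m : ℤ) : Memℓp (fun j => f (j + m)) 2 := by
  rw [memlp_two_iff] at hf ⊢
  exact (Equiv.addRight m).summable_iff.mpr hf

/-- The shift by `m` on `ℓ²(ℤ)`. -/
noncomputable def shift (m : ℤ) :
    lp (fun _ : ℤ => ℝ) 2 →ₗᵢ[ℝ] lp (fun _ : ℤ => ℝ) 2 where
  toFun f := ⟨fun j => f (j + m), memlp_shift (lp.memℓp f) m⟩
  map_add' f g := by ext j; rfl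
  map_smul' c f := by ext j; rfl
  norm_map' f := by
    rw [lp.norm_eq_tsum_rpow (by norm_num), lp.norm_eq_tsum_rpow (by norm_num)]
    congr 1
    exact (Equiv.addRight m).tsum_eq (fun j => ‖f j‖ ^ (2 : ℝ≥0∞).toReal)

theorem shift_apply (m : ℤ) (f : lp (fun _ : ℤ => ℝ) 2) (j : ℤ) :
    shift m f j = f (j + m) := rfl

/-- The implicit operator on `ℓ²(ℤ)`. -/
noncomputable def implicitOp (μ h k : ℝ) :
    lp (fun _ : ℤ => ℝ) 2 →L[ℝ] lp (fun _ : ℤ => ℝ) 2 :=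
  ContinuousLinearMap.id ℝ _ +
    (μ * k / (2 * h)) • ((shift 1).toContinuousLinearMap - (shift (-1)).toContinuousLinearMap) -
    (k / (2 * h ^ 2)) • ((shift 1).toContinuousLinearMap - (2 : ℝ) • ContinuousLinearMap.id ℝ _ +
      (shift (-1)).toContinuousLinearMap)

theorem implicitOp_apply (μ h k : ℝ) (f : lp (fun _ : ℤ => ℝ) 2) (j : ℤ) :
    implicitOp μ h k f j = implicitPart μ h k f j := by
  have h : implicitOp μ h k f j = f j + μ * k / (2 * h) * (f (j + 1) - f (j + -1)) -
      k / (2 * h ^ 2) * (f (j + 1) - 2 * f j + f (j + -1)) := rfl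
  rw [h, implicitPart, D1, D2, ← sub_eq_add_neg]

theorem inner_shift (f : lp (fun _ : ℤ => ℝ) 2) :
    inner ℝ (shift (-1) f) f = inner ℝ (shift 1 f) f := by
  have h : shift 1 (shift (-1) f) = f := by
    ext j
    simp [shift_apply]
  rw [← (shift 1).inner_map_map, h, real_inner_comm]

theorem implicitOp_coercive (μ h : ℝ) {k : ℝ} (hk : 0 < k)
    (f : lp (fun _ : ℤ => ℝ) 2) : ‖f‖ * ‖f‖ ≤ inner ℝ (implicitOp μ h k f) f := by
  have h1 : inner ℝ (shift 1 f) f ≤ ‖f‖ * ‖f‖ := by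
    simpa using real_inner_le_norm (shift 1 f) f
  have h2 : inner ℝ (implicitOp μ h k f) f =
      ‖f‖ * ‖f‖ + k / h ^ 2 * (‖f‖ * ‖f‖ - inner ℝ (shift 1 f) f) := by
    simp only [implicitOp, _root_.sub_apply, _root_.add_apply,
      _root_.smul_apply, ContinuousLinearMap.id_apply, inner_sub_left,
      inner_add_left, real_inner_smul_left, LinearIsometry.coe_toContinuousLinearMap, inner_shift,
      real_inner_self_eq_norm_mul_norm]
    ring
  rw [h2]
  have : 0 ≤ k / h ^ 2 * (‖f‖ * ‖f‖ - inner ℝ (shift 1 f) f) :=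
    mul_nonneg (by positivity) (by linarith)
  linarith

theorem implicitOp_bijective (μ h : ℝ) {k : ℝ} (hk : 0 < k) :
    Function.Bijective (implicitOp μ h k) := by
  have hc : IsCoercive ((innerSL ℝ).comp (implicitOp μ h k)) :=
    ⟨1, one_pos, fun f => by simpa using implicitOp_coercive μ h hk f⟩
  have he : ∀ f, hc.continuousLinearEquivOfBilin f = implicitOp μ h k f := fun f => by
    refine (hc.unique_continuousLinearEquivOfBilin fun w => ?_).symm
    simp
  have : (hc.continuousLinearEquivOfBilin : _ → _) = implicitOp μ h k := funext he
  rw [← this]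
  exact hc.continuousLinearEquivOfBilin.bijective

theorem existsUnique_isImplicitSolution (μ h : ℝ) {k : ℝ} (hk : 0 < k) {W : ℤ → ℝ}
    (hW : Memℓp W 2) : ∃! U, IsImplicitSolution μ h k W U := by
  obtain ⟨hi, hs⟩ := implicitOp_bijective μ h hk
  obtain ⟨f, hf⟩ := hs ⟨W, hW⟩
  refine ⟨f, ⟨lp.memℓp f, fun j => ?_⟩, fun U hU => ?_⟩
  · rw [← implicitOp_apply, hf]
  · have : implicitOp μ h k ⟨U, hU.1⟩ = implicitOp μ h k f := by
      rw [hf]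
      ext j
      rw [implicitOp_apply]
      exact hU.2 j
    have h2 := hi this
    rw [← h2]

theorem implicitSolve_spec (μ h : ℝ) {k : ℝ} (hk : 0 < k) {W : ℤ → ℝ} (hW : Memℓp W 2) :
    IsImplicitSolution μ h k W (implicitSolve μ h k W) :=
  Classical.epsilon_spec (existsUnique_isImplicitSolution μ h hk hW).exists

theorem memlp_explicitPart (ρ h k z : ℝ) {V : ℤ → ℝ} (hV : Memℓp V 2) :
    Memℓp (explicitPart ρ h k z V) 2 := by
  have e1 : Memℓp (D1 V) 2 := (memlp_shift hV 1).sub (memlp_shift hV (-1))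
  have e2 : Memℓp (D1sq V) 2 :=
    ((memlp_shift hV 2).sub (hV.const_mul 2)).add (memlp_shift hV (-2))
  exact (hV.sub (e1.const_mul (√(ρ * k) * z / (2 * h)))).add
    (e2.const_mul (ρ * k * (z ^ 2 - 1) / (8 * h ^ 2)))

theorem memlp_diracGrid (x₀ h : ℝ) : Memℓp (diracGrid x₀ h) 2 := by
  rw [memlp_two_iff]
  refine summable_of_ne_finset_zero (s := {round (x₀ / h)}) fun j hj => ?_
  simp only [Finset.mem_singleton] at hj
  simp [diracGrid, hj]

/-- Every iterate is square summable. -/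
theorem memlp_scheme (μ ρ x₀ h : ℝ) {k : ℝ} (hk : 0 < k) (z : ℕ → ℝ) (n : ℕ) :
    Memℓp (scheme μ ρ x₀ h k z n) 2 := by
  induction n with
  | zero => exact memlp_diracGrid x₀ h
  | succ n ih => exact (implicitSolve_spec μ h hk (memlp_explicitPart ρ h k (z n) ih)).1

/-- The implicit Milstein finite difference equation satisfied by the iterates. -/
theorem scheme_succ_eq (μ ρ x₀ h : ℝ) {k : ℝ} (hk : 0 < k) (z : ℕ → ℝ) (n : ℕ) (j : ℤ) :
    scheme μ ρ x₀ h k z (n + 1) j =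
      scheme μ ρ x₀ h k z n j
        - μ * k / (2 * h) * D1 (scheme μ ρ x₀ h k z (n + 1)) j
        + k / (2 * h ^ 2) * D2 (scheme μ ρ x₀ h k z (n + 1)) j
        - √(ρ * k) * z n / (2 * h) * D1 (scheme μ ρ x₀ h k z n) j
        + ρ * k * (z n ^ 2 - 1) / (8 * h ^ 2) * D1sq (scheme μ ρ x₀ h k z n) j := by
  have := (implicitSolve_spec μ h hk
    (memlp_explicitPart ρ h k (z n) (memlp_scheme μ ρ x₀ h hk z n))).2 j
  change implicitPart μ h k (scheme μ ρ x₀ h k z (n + 1)) j = _ at this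
  simp only [implicitPart, explicitPart] at this
  linarith

end ImplicitMilstein

/-! On the Fourier side the scheme is diagonal: at frequency ξ a time step multiplies by a random
factor, a Milstein numerator `stepNum` over an implicit denominator `stepDen`, and the factors of
different steps are independent. The trapezoidal loss is a half-line sum of Fourier coefficients,
hence acts through the multiplier i h cot(hξ/2). This multiplier has a pole at ξ = 0, but every
symbol equals 1 there, so the difference of two losses on the same mesh is an absolutely convergent
frequency integral (`trapezoidalLoss_sub`). Thus ΔL is a constant times the real part of ∫ F(ξ) dξ
for a random density F. By a weighted Cauchy–Schwarz inequality in ξ (`integral_second_moment_le`)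
it suffices to show E|F(ξ)|² ≤ C h⁴k²/(1+ξ²)². The bound on the mean then follows, since it is the
square root of the bound on the second moment.

Low frequencies, kξ² ≤ 1. Four fine steps are compared with one coarse step. Their random numerators
agree to second order in the noise, so the block factors differ by O(k^{3/2}) pathwise and by O(k²)
in the mean. The symbols on the meshes h and 2h differ by O(h²). Both gains are obtained at once by
computing in the ring ℂ × ℂ of values at h and at 2h with the seminorm `pairSeminorm`
(`exists_block_bounds`). Local errors are accumulated by a second moment recursion
(`second_moment_step`, `blockProd_mixed_bound`): independence factors the cross terms, and since the
means of the local errors are smaller by √k, the T/k steps together lose nothing. The polynomial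
growth in ξ of these errors is absorbed by the Gaussian decay coming from mean square stability
(`integral_norm_factor_sq_le_exp`), which is where ρ² < 1/2 enters.

High frequencies, kξ² ≥ 1. Consistency is of no use, but the second moment of each block factor is
at most a constant below 1 depending only on ρ (`integral_norm_factor_sq_le_const`). The restriction
on k₀ turns the resulting geometric decay into powers of h and k (`exists_rate_bound`). -/

namespace ImplicitMilstein

/-! ### Trigonometric coefficients -/

/-- The coefficient `(2π)⁻¹ ∫ G(φ) e^{ijφ} dφ` over a period. -/
noncomputable def trigCoeff (G : ℝ → ℂ) (j : ℤ) : ℂ :=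
  (2 * Real.pi : ℂ)⁻¹ * ∫ φ in (-Real.pi)..Real.pi, G φ * Complex.exp (Complex.I * j * φ)

theorem trigCoeff_add {F G : ℝ → ℂ} (hF : Continuous F) (hG : Continuous G) (j : ℤ) :
    trigCoeff (fun φ => F φ + G φ) j = trigCoeff F j + trigCoeff G j := by
  simp only [trigCoeff, add_mul]
  rw [intervalIntegral.integral_add, mul_add]
  all_goals exact Continuous.intervalIntegrable (by fun_prop) _ _

theorem trigCoeff_const_mul (c : ℂ) (G : ℝ → ℂ) (j : ℤ) :
    trigCoeff (fun φ => c * G φ) j = c * trigCoeff G j := by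
  simp only [trigCoeff, mul_assoc, intervalIntegral.integral_const_mul]
  ring

theorem trigCoeff_sub {F G : ℝ → ℂ} (hF : Continuous F) (hG : Continuous G) (j : ℤ) :
    trigCoeff (fun φ => F φ - G φ) j = trigCoeff F j - trigCoeff G j := by
  rw [sub_eq_add_neg, ← neg_one_mul (trigCoeff G j), ← trigCoeff_const_mul,
    ← trigCoeff_add hF (by fun_prop)]
  congr 1
  funext φ
  ring

theorem trigCoeff_add_index (G : ℝ → ℂ) (j m : ℤ) :
    trigCoeff G (j + m) = trigCoeff (fun φ => Complex.exp (Complex.I * m * φ) * G φ) j := by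
  simp only [trigCoeff]
  congr 2
  funext φ
  rw [mul_comm (Complex.exp _) (G φ), mul_assoc (G φ), ← Complex.exp_add]
  congr 2
  push_cast
  ring

theorem norm_trigCoeff_le {G : ℝ → ℂ} {K : ℝ} (hK : ∀ φ, ‖G φ‖ ≤ K) (j : ℤ) :
    ‖trigCoeff G j‖ ≤ K := by
  have h1 : ‖∫ φ in (-Real.pi)..Real.pi, G φ * Complex.exp (Complex.I * j * φ)‖ ≤
      K * |Real.pi - -Real.pi| := by
    refine intervalIntegral.norm_integral_le_of_norm_le_const fun φ _ => ?_
    rw [norm_mul, show Complex.I * j * φ = ((j * φ : ℝ) : ℂ) * Complex.I by push_cast; ring,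
      Complex.norm_exp_ofReal_mul_I, mul_one]
    exact hK φ
  have h2 : |Real.pi - -Real.pi| = 2 * Real.pi := by
    rw [abs_of_pos] <;> linarith [Real.pi_pos]
  rw [h2] at h1
  rw [trigCoeff, norm_mul, norm_inv]
  have h3 : ‖(2 * Real.pi : ℂ)‖ = 2 * Real.pi := by
    rw [show (2 * Real.pi : ℂ) = ((2 * Real.pi : ℝ) : ℂ) by push_cast; ring, Complex.norm_real,
      Real.norm_of_nonneg Real.two_pi_pos.le]
  rw [h3, inv_mul_le_iff₀ Real.two_pi_pos]
  linarith

theorem exp_int_mul_pi (j : ℤ) : Complex.exp (Complex.I * j * (-Real.pi : ℝ)) =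
    Complex.exp (Complex.I * j * Real.pi) := by
  rw [Complex.exp_eq_exp_iff_exists_int]
  exact ⟨-j, by push_cast; ring⟩

theorem trigCoeff_deriv {G : ℝ → ℂ} (hG : ContDiff ℝ 1 G) (hp : G (-Real.pi) = G Real.pi)
    (j : ℤ) : trigCoeff (deriv G) j = -(Complex.I * j) * trigCoeff G j := by
  have hd : ∀ φ : ℝ, HasDerivAt (fun φ : ℝ => Complex.exp (Complex.I * j * φ))
      (Complex.exp (Complex.I * j * φ) * (Complex.I * j)) φ := fun φ => by
    have h := (((hasDerivAt_id φ).ofReal_comp).const_mul (Complex.I * j)).cexp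
    simpa using h
  have hc : Continuous (deriv G) := hG.continuous_deriv le_rfl
  have h := intervalIntegral.integral_deriv_mul_eq_sub (a := -Real.pi) (b := Real.pi)
    (u := G) (v := fun φ : ℝ => Complex.exp (Complex.I * j * φ))
    (fun φ _ => ((hG.differentiable one_ne_zero) φ).hasDerivAt) (fun φ _ => hd φ)
    (hc.intervalIntegrable _ _) (Continuous.intervalIntegrable (by fun_prop) _ _)
  rw [exp_int_mul_pi, hp, sub_self, intervalIntegral.integral_add
    (Continuous.intervalIntegrable (by fun_prop) _ _)
    (Continuous.intervalIntegrable (by have := hG.continuous; fun_prop) _ _)] at h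
  simp only [← mul_assoc, intervalIntegral.integral_mul_const] at h
  simp only [trigCoeff]
  linear_combination (2 * Real.pi : ℂ)⁻¹ * h

/-- Two integrations by parts over a period give decay of order j⁻². Summability serves twice: for
the convergence of the loss series, and for membership in ℓ², where the scheme has a unique
solution. -/
theorem summable_norm_trigCoeff {G : ℝ → ℂ} (hG : ContDiff ℝ 2 G)
    (hp : Function.Periodic G (2 * Real.pi)) : Summable fun j => ‖trigCoeff G j‖ := by
  have hper : ∀ {F : ℝ → ℂ}, Function.Periodic F (2 * Real.pi) → F (-Real.pi) = F Real.pi := by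
    intro F hF
    rw [← hF]
    congr 1
    ring
  have h1 : ContDiff ℝ 1 (deriv G) := by
    have : ContDiff ℝ (1 + 1) G := by simpa [one_add_one_eq_two] using hG
    exact (contDiff_succ_iff_deriv.mp this).2.2
  have hp1 : Function.Periodic (deriv G) (2 * Real.pi) := fun φ => by
    rw [← deriv_comp_add_const]
    congr 1
    funext x
    exact hp x
  have hp2 : Function.Periodic (deriv (deriv G)) (2 * Real.pi) := fun φ => by
    rw [← deriv_comp_add_const]
    congr 1
    funext x
    exact hp1 x
  have hc2 : Continuous (deriv (deriv G)) := h1.continuous_deriv le_rfl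
  obtain ⟨K, hK⟩ : ∃ K, ∀ φ, ‖deriv (deriv G) φ‖ ≤ K := by
    obtain ⟨K, hK⟩ := (isCompact_Icc (a := (0 : ℝ)) (b := 2 * Real.pi)).exists_bound_of_continuousOn
      hc2.continuousOn
    refine ⟨K, fun φ => ?_⟩
    obtain ⟨y, hy, hy2⟩ := hp2.exists_mem_Ico₀ Real.two_pi_pos φ
    rw [hy2]
    exact hK y ⟨hy.1, hy.2.le⟩
  have hb : ∀ j : ℤ, ‖trigCoeff G j‖ * (j : ℝ) ^ 2 ≤ K := fun j => by
    have h := norm_trigCoeff_le hK j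
    rw [trigCoeff_deriv h1 (hper hp1), trigCoeff_deriv (hG.of_le (by norm_num)) (hper hp)] at h
    simp only [norm_mul, norm_neg, Complex.norm_I, one_mul, Complex.norm_intCast] at h
    rw [← sq_abs (j : ℝ)]
    linarith
  have hs : Summable fun j : ℤ => K * (1 / (j : ℝ) ^ 2) :=
    (Real.summable_one_div_int_pow.mpr one_lt_two).mul_left K
  refine hs.of_norm_bounded_eventually ?_
  rw [Filter.eventually_cofinite]
  refine (Set.finite_singleton (0 : ℤ)).subset fun j hj => ?_
  by_contra h0
  have h1 : (0 : ℝ) < (j : ℝ) ^ 2 := by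
    have : (j : ℝ) ≠ 0 := by exact_mod_cast h0
    positivity
  refine hj ?_
  rw [norm_norm, mul_one_div, le_div_iff₀ h1]
  exact hb j

theorem trigCoeff_exp (m j : ℤ) :
    trigCoeff (fun φ => Complex.exp (Complex.I * m * φ)) j = if j = -m then 1 else 0 := by
  have h0 : (2 * Real.pi : ℂ) ≠ 0 := by simp [Real.pi_ne_zero]
  split_ifs with h
  · subst h
    have : ∀ φ : ℝ, Complex.exp (Complex.I * m * φ) * Complex.exp (Complex.I * ((-m : ℤ) : ℂ) * φ)
        = 1 := fun φ => by
      rw [← Complex.exp_add, ← Complex.exp_zero]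
      congr 1
      push_cast
      ring
    simp only [trigCoeff, this, intervalIntegral.integral_const]
    rw [inv_mul_eq_iff_eq_mul₀ h0, Complex.real_smul]
    push_cast
    ring
  · have h1 : ((m + j : ℤ) : ℂ) ≠ 0 := by
      have : m + j ≠ 0 := fun h2 => h (by omega)
      exact_mod_cast this
    have h2 : ∀ φ : ℝ, Complex.exp (Complex.I * m * φ) * Complex.exp (Complex.I * j * φ)
        = Complex.exp (Complex.I * ((m + j : ℤ) : ℂ) * φ) := fun φ => by
      rw [← Complex.exp_add]
      congr 1
      push_cast
      ring
    simp only [trigCoeff, h2]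
    rw [integral_exp_mul_complex (mul_ne_zero Complex.I_ne_zero h1), exp_int_mul_pi, sub_self,
      zero_div, mul_zero]

/-! ### Half-line sums of trigonometric coefficients -/

/-- The Riemann–Lebesgue lemma. No continuity is asked of `G`, because it is applied to a symbol
multiplied by a cotangent. -/
theorem tendsto_trigCoeff (G : ℝ → ℂ) :
    Filter.Tendsto (fun j : ℕ => trigCoeff G j) Filter.atTop (nhds 0) := by
  have h := Real.tendsto_integral_exp_smul_cocompact
    ((Set.Ioc (-Real.pi) Real.pi).indicator G)
  have h1 : Filter.Tendsto (fun j : ℕ => -((j : ℝ) / (2 * Real.pi))) Filter.atTop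
      (Filter.cocompact ℝ) := by
    refine Filter.Tendsto.mono_right ?_ atBot_le_cocompact
    exact Filter.tendsto_neg_atTop_atBot.comp
      (tendsto_natCast_atTop_atTop.atTop_div_const Real.two_pi_pos)
  have h2 := (h.comp h1).const_mul (2 * Real.pi : ℂ)⁻¹
  rw [mul_zero] at h2
  refine h2.congr fun j => ?_
  simp only [trigCoeff, Function.comp]
  rw [intervalIntegral.integral_of_le (by linarith [Real.pi_pos]),
    ← integral_indicator measurableSet_Ioc]
  congr 2
  funext φ
  by_cases hφ : φ ∈ Set.Ioc (-Real.pi) Real.pi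
  · rw [Set.indicator_of_mem hφ, Set.indicator_of_mem hφ, Circle.smul_def, Real.fourierChar_apply,
      smul_eq_mul, mul_comm]
    congr 2
    push_cast
    have : (Real.pi : ℂ) ≠ 0 := by exact_mod_cast Real.pi_ne_zero
    field_simp
  · rw [Set.indicator_of_notMem hφ, Set.indicator_of_notMem hφ, smul_zero]

/-- After extracting e^{i(j+1/2)φ} the sum is 2cos(φ/2) and the difference is -2i sin(φ/2). Averages
of neighbours thereby become telescoping differences. -/
theorem exp_add_exp_eq_cot (j φ : ℝ) (hφ : Real.sin (φ / 2) ≠ 0) :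
    Complex.exp (Complex.I * (j + 1 : ℝ) * φ) + Complex.exp (Complex.I * j * φ) =
      (Complex.I * Real.cot (φ / 2) : ℂ) *
        (Complex.exp (Complex.I * j * φ) - Complex.exp (Complex.I * (j + 1 : ℝ) * φ)) := by
  have e1 : Complex.exp (Complex.I * (j + 1 : ℝ) * φ) = Complex.exp (Complex.I * (j + 1 / 2) * φ) *
      (Real.cos (φ / 2) + Real.sin (φ / 2) * Complex.I) := by
    rw [Complex.ofReal_cos, Complex.ofReal_sin, ← Complex.exp_mul_I, ← Complex.exp_add]
    congr 1
    push_cast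
    ring
  have e2 : Complex.exp (Complex.I * j * φ) = Complex.exp (Complex.I * (j + 1 / 2) * φ) *
      (Real.cos (φ / 2) - Real.sin (φ / 2) * Complex.I) := by
    have : (Real.cos (φ / 2) - Real.sin (φ / 2) * Complex.I : ℂ) =
        Complex.cos ((-(φ / 2) : ℝ)) + Complex.sin ((-(φ / 2) : ℝ)) * Complex.I := by
      push_cast
      rw [Complex.cos_neg, Complex.sin_neg]
      ring
    rw [this, ← Complex.exp_mul_I, ← Complex.exp_add]
    congr 1
    push_cast
    ring
  have hs : (Real.sin (φ / 2) : ℂ) ≠ 0 := by exact_mod_cast hφ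
  rw [e1, e2, Real.cot_eq_cos_div_sin, Complex.ofReal_div]
  field_simp
  linear_combination (2 * Real.cos (φ / 2) * Real.sin (φ / 2) : ℂ) * Complex.I_sq

/-- Written as ∑ (c_{j+1} + c_j), the trapezoidal sum telescopes by the cotangent identity. The
boundary term at infinity vanishes by Riemann–Lebesgue. The integrability hypothesis is what a zero
of `G` at the pole of the cotangent will provide. -/
theorem two_mul_tsum_trigCoeff_add {G : ℝ → ℂ} (hG : Continuous G)
    (hs : Summable fun j => ‖trigCoeff G j‖)
    (hi : IntervalIntegrable (fun φ => G φ * (Complex.I * Real.cot (φ / 2))) volume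
      (-Real.pi) Real.pi) :
    2 * (∑' j : ℕ, trigCoeff G ((j : ℤ) + 1)) + trigCoeff G 0 =
      trigCoeff (fun φ => G φ * (Complex.I * Real.cot (φ / 2))) 0 := by
  set W : ℤ → ℂ := trigCoeff (fun φ => G φ * (Complex.I * Real.cot (φ / 2))) with hW
  have hstep : ∀ j : ℤ, trigCoeff G (j + 1) + trigCoeff G j = W j - W (j + 1) := fun j => by
    simp only [hW, trigCoeff]
    rw [← mul_add, ← mul_sub, ← intervalIntegral.integral_add, ← intervalIntegral.integral_sub]
    · congr 1
      refine intervalIntegral.integral_congr_ae ?_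
      have hne : ∀ᵐ φ : ℝ, φ ≠ 0 := by simp [ae_iff]
      filter_upwards [hne] with φ h0 hφ
      rw [Set.uIoc_of_le (by linarith [Real.pi_pos])] at hφ
      have hsin : Real.sin (φ / 2) ≠ 0 := by
        intro h1
        rw [Real.sin_eq_zero_iff_of_lt_of_lt (by linarith [hφ.1, Real.pi_pos])
          (by linarith [hφ.2, Real.pi_pos])] at h1
        exact h0 (by linarith)
      have := exp_add_exp_eq_cot j φ hsin
      push_cast at this ⊢
      linear_combination G φ * this
    · exact hi.mul_continuousOn (by fun_prop)
    · exact hi.mul_continuousOn (by fun_prop)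
    · exact Continuous.intervalIntegrable (by fun_prop) _ _
    · exact Continuous.intervalIntegrable (by fun_prop) _ _
  have hs1 : Summable fun j : ℕ => trigCoeff G j :=
    (hs.comp_injective (i := fun j : ℕ => (j : ℤ)) Nat.cast_injective).of_norm
  have hs2 : Summable fun j : ℕ => trigCoeff G ((j : ℤ) + 1) := by
    simpa using (summable_nat_add_iff 1).mpr hs1
  have h1 : HasSum (fun j : ℕ => trigCoeff G ((j : ℤ) + 1) + trigCoeff G j) (W 0) := by
    rw [(hs2.add hs1).hasSum_iff_tendsto_nat]
    have h2 : ∀ n : ℕ, ∑ j ∈ Finset.range n, (trigCoeff G ((j : ℤ) + 1) + trigCoeff G j) =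
        W 0 - W n := fun n => by
      induction n with
      | zero => simp
      | succ n ih =>
        rw [Finset.sum_range_succ, ih, hstep]
        push_cast
        ring
    simp only [h2]
    have h3 := (tendsto_trigCoeff (fun φ => G φ * (Complex.I * Real.cot (φ / 2)))).const_sub (W 0)
    rwa [sub_zero] at h3
  have h2 := h1.tsum_eq
  rw [hs2.tsum_add hs1, hs1.tsum_eq_zero_add] at h2
  push_cast at h2
  rw [← h2]
  ring

/-! ### Fourier representation of the scheme -/

/-- The explicit part of the amplification factor, with noise intensity `σ`. -/
noncomputable def stepNum (σ z : ℝ) : ℂ := 1 - Complex.I * σ * z - σ ^ 2 * (z ^ 2 - 1) / 2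

/-- The implicit part of the amplification factor. -/
noncomputable def stepDen (μ k s a : ℝ) : ℂ := 1 + k * (Complex.I * μ * s + a / 2)

/-- The product of the first `n` amplification factors. -/
noncomputable def ampProd (μ ρ k s a : ℝ) (z : ℕ → ℝ) (n : ℕ) : ℂ :=
  ∏ i ∈ Finset.range n, stepNum (√(ρ * k) * s) (z i) / stepDen μ k s a

/-- The symbol of the first central difference quotient. -/
noncomputable def symbolD1 (h ξ : ℝ) : ℝ := Real.sin (h * ξ) / h

/-- The symbol of the negative second central difference quotient. -/
noncomputable def symbolD2 (h ξ : ℝ) : ℝ := 4 * Real.sin (h * ξ / 2) ^ 2 / h ^ 2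

theorem symbolD2_nonneg (h ξ : ℝ) : 0 ≤ symbolD2 h ξ := by unfold symbolD2; positivity

/-- The symbol of the scheme at the frequency `ξ` after `n` steps. -/
noncomputable def schemeSymbol (μ ρ h k : ℝ) (z : ℕ → ℝ) (n : ℕ) (ξ : ℝ) : ℂ :=
  ampProd μ ρ k (symbolD1 h ξ) (symbolD2 h ξ) z n

theorem stepDen_re {μ k s a : ℝ} : (stepDen μ k s a).re = 1 + k * a / 2 := by
  simp [stepDen]
  ring

theorem one_le_norm_stepDen {μ k s a : ℝ} (hk : 0 ≤ k) (ha : 0 ≤ a) :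
    1 ≤ ‖stepDen μ k s a‖ := by
  refine le_trans ?_ (Complex.re_le_norm _)
  rw [stepDen_re]
  have : 0 ≤ k * a / 2 := by positivity
  linarith

theorem stepDen_ne_zero {μ k s a : ℝ} (hk : 0 ≤ k) (ha : 0 ≤ a) : stepDen μ k s a ≠ 0 := by
  rw [← norm_pos_iff]
  exact lt_of_lt_of_le one_pos (one_le_norm_stepDen hk ha)

theorem schemeSymbol_succ {μ ρ h k : ℝ} (hk : 0 ≤ k) (z : ℕ → ℝ) (n : ℕ) (ξ : ℝ) :
    stepDen μ k (symbolD1 h ξ) (symbolD2 h ξ) * schemeSymbol μ ρ h k z (n + 1) ξ =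
      stepNum (√(ρ * k) * symbolD1 h ξ) (z n) * schemeSymbol μ ρ h k z n ξ := by
  have := stepDen_ne_zero (μ := μ) (s := symbolD1 h ξ) hk (symbolD2_nonneg h ξ)
  rw [schemeSymbol, schemeSymbol, ampProd, Finset.prod_range_succ, ampProd]
  field_simp

/-- The generating function of the scheme on a grid whose initial index is `j₀`. -/
noncomputable def gridSymbol (μ ρ h k : ℝ) (j₀ : ℤ) (z : ℕ → ℝ) (n : ℕ) (φ : ℝ) : ℂ :=
  (h⁻¹ : ℝ) * (Complex.exp (Complex.I * ((-j₀ : ℤ) : ℂ) * φ) * schemeSymbol μ ρ h k z n (φ / h))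

theorem contDiff_schemeSymbol (μ ρ h : ℝ) {k : ℝ} (hk : 0 ≤ k) (z : ℕ → ℝ) (n : ℕ) {r : ℕ∞} :
    ContDiff ℝ r (schemeSymbol μ ρ h k z n) := by
  have h1 : ContDiff ℝ r (fun ξ => symbolD1 h ξ) := by
    simp only [symbolD1]
    fun_prop
  have h2 : ContDiff ℝ r (fun ξ => symbolD2 h ξ) := by
    simp only [symbolD2]
    fun_prop
  have h3 : ContDiff ℝ r (fun ξ => (symbolD1 h ξ : ℂ)) := Complex.ofRealCLM.contDiff.comp h1
  have h4 : ContDiff ℝ r (fun ξ => (symbolD2 h ξ : ℂ)) := Complex.ofRealCLM.contDiff.comp h2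
  unfold schemeSymbol ampProd
  refine contDiff_prod fun i _ => ?_
  simp only [div_eq_mul_inv]
  refine ContDiff.mul ?_ (ContDiff.inv ?_ fun ξ => stepDen_ne_zero hk (symbolD2_nonneg h ξ))
  · simp only [stepNum, div_eq_mul_inv]
    push_cast
    fun_prop
  · simp only [stepDen, div_eq_mul_inv]
    fun_prop

theorem contDiff_gridSymbol (μ ρ h : ℝ) {k : ℝ} (hk : 0 ≤ k) (j₀ : ℤ) (z : ℕ → ℝ) (n : ℕ)
    {r : ℕ∞} : ContDiff ℝ r (gridSymbol μ ρ h k j₀ z n) := by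
  have h1 : ContDiff ℝ r (fun φ : ℝ => schemeSymbol μ ρ h k z n (φ / h)) :=
    (contDiff_schemeSymbol μ ρ h hk z n).comp (by fun_prop)
  have h2 : ContDiff ℝ r (fun φ : ℝ => (φ : ℂ)) := Complex.ofRealCLM.contDiff
  unfold gridSymbol
  fun_prop

theorem schemeSymbol_periodic (μ ρ k : ℝ) {h : ℝ} (hh : h ≠ 0) (z : ℕ → ℝ) (n : ℕ) :
    Function.Periodic (fun φ => schemeSymbol μ ρ h k z n (φ / h)) (2 * Real.pi) := fun φ => by
  have e1 : symbolD1 h ((φ + 2 * Real.pi) / h) = symbolD1 h (φ / h) := by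
    rw [symbolD1, symbolD1, mul_div_cancel₀ _ hh, mul_div_cancel₀ _ hh, Real.sin_add_two_pi]
  have e2 : symbolD2 h ((φ + 2 * Real.pi) / h) = symbolD2 h (φ / h) := by
    rw [symbolD2, symbolD2, mul_div_cancel₀ _ hh, mul_div_cancel₀ _ hh,
      show (φ + 2 * Real.pi) / 2 = φ / 2 + Real.pi by ring, Real.sin_add_pi, neg_sq]
  simp only [schemeSymbol, e1, e2]

theorem gridSymbol_periodic (μ ρ k : ℝ) {h : ℝ} (hh : h ≠ 0) (j₀ : ℤ) (z : ℕ → ℝ) (n : ℕ) :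
    Function.Periodic (gridSymbol μ ρ h k j₀ z n) (2 * Real.pi) := fun φ => by
  have e : Complex.exp (Complex.I * ((-j₀ : ℤ) : ℂ) * ((φ + 2 * Real.pi : ℝ) : ℂ)) =
      Complex.exp (Complex.I * ((-j₀ : ℤ) : ℂ) * φ) := by
    rw [Complex.exp_eq_exp_iff_exists_int]
    exact ⟨-j₀, by push_cast; ring⟩
  have e2 := schemeSymbol_periodic μ ρ k hh z n φ
  simp only at e2
  simp only [gridSymbol, e, e2]

theorem summable_norm_gridCoeff (μ ρ : ℝ) {h k : ℝ} (hh : h ≠ 0) (hk : 0 ≤ k) (j₀ : ℤ)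
    (z : ℕ → ℝ) (n : ℕ) : Summable fun j => ‖trigCoeff (gridSymbol μ ρ h k j₀ z n) j‖ :=
  summable_norm_trigCoeff (contDiff_gridSymbol μ ρ h hk j₀ z n (r := 2))
    (gridSymbol_periodic μ ρ k hh j₀ z n)

theorem exp_I_mul_one (φ : ℝ) : Complex.exp (Complex.I * ((1 : ℤ) : ℂ) * φ) =
    Real.cos φ + Real.sin φ * Complex.I := by
  rw [Complex.ofReal_cos, Complex.ofReal_sin, ← Complex.exp_mul_I]
  congr 1
  push_cast
  ring

theorem exp_I_mul_neg_one (φ : ℝ) : Complex.exp (Complex.I * ((-1 : ℤ) : ℂ) * φ) =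
    Real.cos φ - Real.sin φ * Complex.I := by
  rw [show Complex.I * ((-1 : ℤ) : ℂ) * φ = Complex.I * ((1 : ℤ) : ℂ) * ((-φ : ℝ) : ℂ) by
    push_cast; ring, exp_I_mul_one, Real.cos_neg, Real.sin_neg]
  push_cast
  ring

theorem exp_I_mul_two_mul (m : ℤ) (φ : ℝ) : Complex.exp (Complex.I * ((2 * m : ℤ) : ℂ) * φ) =
    Complex.exp (Complex.I * (m : ℂ) * φ) ^ 2 := by
  rw [← Complex.exp_nat_mul]
  congr 1
  push_cast
  ring

/-- Index shifts are multiplications by e^{±iφ}. The symbols are taken at φ/h because φ = hξ is the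
phase per grid cell. -/
theorem implicitPart_trigCoeff (μ k : ℝ) {h : ℝ} (hh : h ≠ 0) {G : ℝ → ℂ} (hG : Continuous G)
    (j : ℤ) : implicitPart μ h k (fun j => (trigCoeff G j).re) j =
      (trigCoeff (fun φ => stepDen μ k (symbolD1 h (φ / h)) (symbolD2 h (φ / h)) * G φ) j).re := by
  have e : (fun φ => stepDen μ k (symbolD1 h (φ / h)) (symbolD2 h (φ / h)) * G φ) =
      fun φ : ℝ => (G φ + ((μ * k / (2 * h) : ℝ) : ℂ) *
        (Complex.exp (Complex.I * ((1 : ℤ) : ℂ) * φ) * G φ -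
          Complex.exp (Complex.I * ((-1 : ℤ) : ℂ) * φ) * G φ)) -
        ((k / (2 * h ^ 2) : ℝ) : ℂ) * ((Complex.exp (Complex.I * ((1 : ℤ) : ℂ) * φ) * G φ -
          ((2 : ℝ) : ℂ) * G φ) + Complex.exp (Complex.I * ((-1 : ℤ) : ℂ) * φ) * G φ) := by
    funext φ
    have e1 : (Real.sin (φ / 2) : ℂ) ^ 2 = (1 - Real.cos φ) / 2 := by
      have := Real.cos_sq (φ / 2)
      rw [Real.cos_sq', show 2 * (φ / 2) = φ by ring] at this
      have h2 : Real.sin (φ / 2) ^ 2 = (1 - Real.cos φ) / 2 := by linarith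
      exact_mod_cast h2
    have hc : (h : ℂ) ≠ 0 := by exact_mod_cast hh
    rw [exp_I_mul_one, exp_I_mul_neg_one, stepDen, symbolD1, symbolD2, mul_div_cancel₀ _ hh]
    push_cast at e1 ⊢
    rw [e1]
    field_simp
    ring
  rw [e, trigCoeff_sub, trigCoeff_add, trigCoeff_const_mul, trigCoeff_const_mul, trigCoeff_add,
    trigCoeff_sub, trigCoeff_sub, trigCoeff_const_mul, ← trigCoeff_add_index,
    ← trigCoeff_add_index, implicitPart, D1, D2, ← sub_eq_add_neg]
  · simp only [Complex.sub_re, Complex.add_re, Complex.re_ofReal_mul]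
  all_goals fun_prop

/-- Since the Milstein correction uses the iterated first difference, its symbol is the square of
the noise symbol, and the factor depends on the frequency only through σ. -/
theorem explicitPart_trigCoeff (k z : ℝ) {ρ h : ℝ} (hρ : 0 ≤ ρ * k) (hh : h ≠ 0) {G : ℝ → ℂ}
    (hG : Continuous G) (j : ℤ) : explicitPart ρ h k z (fun j => (trigCoeff G j).re) j =
      (trigCoeff (fun φ => stepNum (√(ρ * k) * symbolD1 h (φ / h)) z * G φ) j).re := by
  have e : (fun φ => stepNum (√(ρ * k) * symbolD1 h (φ / h)) z * G φ) =
      fun φ : ℝ => (G φ - ((√(ρ * k) * z / (2 * h) : ℝ) : ℂ) *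
        (Complex.exp (Complex.I * ((1 : ℤ) : ℂ) * φ) * G φ -
          Complex.exp (Complex.I * ((-1 : ℤ) : ℂ) * φ) * G φ)) +
        ((ρ * k * (z ^ 2 - 1) / (8 * h ^ 2) : ℝ) : ℂ) *
          ((Complex.exp (Complex.I * ((2 * 1 : ℤ) : ℂ) * φ) * G φ - ((2 : ℝ) : ℂ) * G φ) +
            Complex.exp (Complex.I * ((2 * -1 : ℤ) : ℂ) * φ) * G φ) := by
    funext φ
    have e1 : (Real.cos φ : ℂ) ^ 2 = 1 - Real.sin φ ^ 2 := by
      exact_mod_cast Real.cos_sq' φ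
    have e2 : ((√(ρ * k) : ℝ) : ℂ) ^ 2 = ρ * k := by
      exact_mod_cast Real.sq_sqrt hρ
    have hc : (h : ℂ) ≠ 0 := by exact_mod_cast hh
    rw [exp_I_mul_two_mul, exp_I_mul_two_mul, exp_I_mul_one, exp_I_mul_neg_one, stepNum, symbolD1,
      mul_div_cancel₀ _ hh]
    simp only [add_sq, sub_sq, mul_pow, e1, Complex.I_sq]
    push_cast
    simp only [mul_pow, div_pow, e2]
    field_simp
    ring
  rw [e, trigCoeff_add, trigCoeff_sub, trigCoeff_const_mul, trigCoeff_const_mul, trigCoeff_add,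
    trigCoeff_sub, trigCoeff_sub, trigCoeff_const_mul, ← trigCoeff_add_index,
    ← trigCoeff_add_index, ← trigCoeff_add_index, ← trigCoeff_add_index, explicitPart, D1, D1sq,
    ← sub_eq_add_neg, mul_one, show j + 2 * -1 = j - 2 by ring]
  · simp only [Complex.sub_re, Complex.add_re, Complex.re_ofReal_mul]
  all_goals fun_prop

theorem memlp_re_trigCoeff {G : ℝ → ℂ} (hs : Summable fun j => ‖trigCoeff G j‖) :
    Memℓp (fun j => (trigCoeff G j).re) 2 := by
  have h1 : Memℓp (fun j => (trigCoeff G j).re) 1 := by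
    rw [memℓp_gen_iff (by norm_num)]
    simp only [ENNReal.toReal_one, Real.rpow_one]
    exact Summable.of_nonneg_of_le (fun _ => norm_nonneg _)
      (fun j => Complex.abs_re_le_norm _) hs
  exact h1.of_exponent_ge (by norm_num)

theorem gridSymbol_zero_steps (μ ρ h k : ℝ) (j₀ : ℤ) (z : ℕ → ℝ) : gridSymbol μ ρ h k j₀ z 0 =
    fun φ : ℝ => ((h⁻¹ : ℝ) : ℂ) * Complex.exp (Complex.I * ((-j₀ : ℤ) : ℂ) * φ) := by
  funext φ
  simp [gridSymbol, schemeSymbol, ampProd]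

/-- Both sides solve the same implicit equation at each step. Uniqueness holds among square summable
sequences, which is why the coefficients must be shown to lie in ℓ². -/
theorem scheme_eq_re_trigCoeff (μ x₀ : ℝ) {ρ h k : ℝ} (hρ : 0 ≤ ρ) (hh : h ≠ 0) (hk : 0 < k)
    (z : ℕ → ℝ) (n : ℕ) : scheme μ ρ x₀ h k z n =
      fun j => (trigCoeff (gridSymbol μ ρ h k (round (x₀ / h)) z n) j).re := by
  induction n with
  | zero =>
    funext j
    simp only [scheme, diracGrid, gridSymbol_zero_steps, trigCoeff_const_mul, trigCoeff_exp,
      neg_neg]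
    split_ifs <;> simp
  | succ n ih =>
    rw [scheme]
    have hW := memlp_explicitPart ρ h k (z n) (memlp_scheme μ ρ x₀ h hk z n)
    refine (existsUnique_isImplicitSolution μ h hk hW).unique (implicitSolve_spec μ h hk hW)
      ⟨memlp_re_trigCoeff (summable_norm_gridCoeff μ ρ hh hk.le _ z _), fun j => ?_⟩
    have hc : ∀ n, Continuous (gridSymbol μ ρ h k (round (x₀ / h)) z n) := fun n =>
      (contDiff_gridSymbol μ ρ h hk.le _ z n (r := 0)).continuous
    rw [implicitPart_trigCoeff μ k hh (hc _), ih,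
      explicitPart_trigCoeff k (z n) (mul_nonneg hρ hk.le) hh (hc _)]
    congr 2
    funext φ
    simp only [gridSymbol]
    linear_combination ((h⁻¹ : ℝ) * Complex.exp (Complex.I * ((-round (x₀ / h) : ℤ) : ℂ) * φ)) *
      schemeSymbol_succ (μ := μ) (ρ := ρ) (h := h) hk.le z n (φ / h)

theorem summable_scheme (μ x₀ : ℝ) {ρ h k : ℝ} (hρ : 0 ≤ ρ) (hh : h ≠ 0) (hk : 0 < k)
    (z : ℕ → ℝ) (n : ℕ) : Summable fun j : ℕ => scheme μ ρ x₀ h k z n ((j : ℤ) + 1) := by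
  rw [scheme_eq_re_trigCoeff μ x₀ hρ hh hk]
  have h1 := (summable_norm_gridCoeff μ ρ hh hk.le (round (x₀ / h)) z n).comp_injective
    (i := fun j : ℕ => (j : ℤ) + 1) fun a b hab => by simpa using hab
  exact Summable.of_norm_bounded h1 fun j => Complex.abs_re_le_norm _

/-- Conservation of mass. Differences of symbols therefore vanish at zero frequency and cancel the
pole of the cotangent. -/
theorem schemeSymbol_zero (μ ρ h k : ℝ) (z : ℕ → ℝ) (n : ℕ) : schemeSymbol μ ρ h k z n 0 = 1 := by
  simp [schemeSymbol, ampProd, symbolD1, symbolD2, stepNum, stepDen]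

/-! ### Loss differences as frequency integrals -/

theorem abs_cot_le {x : ℝ} (h0 : x ≠ 0) (hx : |x| ≤ Real.pi / 2) :
    |Real.cot x| ≤ Real.pi / (2 * |x|) := by
  have h1 : 0 < |x| := abs_pos.mpr h0
  have h2 : 2 / Real.pi * |x| ≤ |Real.sin x| := Real.mul_abs_le_abs_sin hx
  have h3 : 0 < 2 / Real.pi * |x| := by positivity
  rw [Real.cot_eq_cos_div_sin, abs_div]
  calc |Real.cos x| / |Real.sin x| ≤ 1 / (2 / Real.pi * |x|) := by
        gcongr
        exact Real.abs_cos_le_one x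
    _ = Real.pi / (2 * |x|) := by field_simp

theorem measurable_cot : Measurable Real.cot := by
  have : Real.cot = fun x => Real.cos x / Real.sin x := funext Real.cot_eq_cos_div_sin
  rw [this]
  exact Real.measurable_cos.div Real.measurable_sin

/-- A C¹ function vanishing at 0 is O(|φ|) on the period, while cot(φ/2) is O(1/|φ|), so the product
is bounded. -/
theorem intervalIntegrable_mul_cot {G : ℝ → ℂ} (hG : ContDiff ℝ 1 G) (h0 : G 0 = 0) :
    IntervalIntegrable (fun φ => G φ * (Complex.I * Real.cot (φ / 2))) volume
      (-Real.pi) Real.pi := by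
  obtain ⟨K, hK⟩ := (isCompact_Icc (a := -Real.pi) (b := Real.pi)).exists_bound_of_continuousOn
    (hG.continuous_deriv le_rfl).continuousOn
  have hK0 : 0 ≤ K := (norm_nonneg _).trans (hK 0 ⟨by linarith [Real.pi_pos], Real.pi_pos.le⟩)
  have hb : ∀ φ ∈ Set.Icc (-Real.pi) Real.pi, ‖G φ‖ ≤ K * |φ| := fun φ hφ => by
    have := (convex_Icc (-Real.pi) Real.pi).norm_image_sub_le_of_norm_deriv_le
      (fun x _ => (hG.differentiable one_ne_zero) x) hK
      (⟨by linarith [Real.pi_pos], Real.pi_pos.le⟩ : (0 : ℝ) ∈ Set.Icc (-Real.pi) Real.pi) hφ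
    simpa [h0] using this
  have hm : Measurable (fun φ : ℝ => G φ * (Complex.I * Real.cot (φ / 2))) :=
    hG.continuous.measurable.mul (measurable_const.mul
      (Complex.measurable_ofReal.comp (measurable_cot.comp (measurable_id.div_const 2))))
  rw [intervalIntegrable_iff, Set.uIoc_of_le (by linarith [Real.pi_pos])]
  refine Measure.integrableOn_of_bounded (M := K * Real.pi) (by simp)
    hm.aestronglyMeasurable ?_
  rw [ae_restrict_iff' measurableSet_Ioc]
  refine Filter.Eventually.of_forall fun φ hφ => ?_
  have hφ1 : |φ| ≤ Real.pi := abs_le.mpr ⟨hφ.1.le, hφ.2⟩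
  rw [norm_mul, norm_mul, Complex.norm_I, one_mul, Complex.norm_real, Real.norm_eq_abs]
  rcases eq_or_ne φ 0 with rfl | hne
  · simp only [h0, norm_zero, zero_mul]
    positivity
  · have h1 : |φ / 2| = |φ| / 2 := by rw [abs_div, abs_two]
    have h2 := abs_cot_le (x := φ / 2) (by simpa using hne) (by rw [h1]; linarith)
    rw [h1, show 2 * (|φ| / 2) = |φ| by ring] at h2
    have h3 : 0 < |φ| := abs_pos.mpr hne
    calc ‖G φ‖ * |Real.cot (φ / 2)| ≤ (K * |φ|) * (Real.pi / |φ|) := by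
          gcongr
          exact hb φ ⟨hφ.1.le, hφ.2⟩
      _ = K * Real.pi := by field_simp

/-- A single loss has no such formula, because its symbol does not vanish at the pole. The
substitution φ = hξ passes to the physical frequency, in which different meshes can be compared. -/
theorem trapezoidalLoss_sub (μ x₀ : ℝ) {ρ h k k' : ℝ} (hρ : 0 ≤ ρ) (hh : 0 < h) (hk : 0 < k)
    (hk' : 0 < k') (z z' : ℕ → ℝ) (n n' : ℕ) :
    trapezoidalLoss h (scheme μ ρ x₀ h k z n) - trapezoidalLoss h (scheme μ ρ x₀ h k' z' n') =
      -(1 / (4 * Real.pi)) * (∫ ξ in (-(Real.pi / h))..(Real.pi / h),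
        (schemeSymbol μ ρ h k z n ξ - schemeSymbol μ ρ h k' z' n' ξ) *
          (Complex.exp (-(Complex.I * ((round (x₀ / h) * h * ξ : ℝ) : ℂ))) *
            (Complex.I * ((h * Real.cot (h * ξ / 2) : ℝ) : ℂ)))).re := by
  set j₀ := round (x₀ / h) with hj
  set F := gridSymbol μ ρ h k j₀ z n with hF
  set F' := gridSymbol μ ρ h k' j₀ z' n' with hF'
  have hh0 := hh.ne'
  have cF : ContDiff ℝ 2 F := contDiff_gridSymbol μ ρ h hk.le j₀ z n (r := 2)
  have cF' : ContDiff ℝ 2 F' := contDiff_gridSymbol μ ρ h hk'.le j₀ z' n' (r := 2)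
  set G : ℝ → ℂ := fun φ => F φ - F' φ with hG
  have cG : ContDiff ℝ 2 G := cF.sub cF'
  have pG : Function.Periodic G (2 * Real.pi) :=
    (gridSymbol_periodic μ ρ k hh0 j₀ z n).sub (gridSymbol_periodic μ ρ k' hh0 j₀ z' n')
  have sG := summable_norm_trigCoeff cG pG
  have G0 : G 0 = 0 := by
    simp only [hG, hF, hF', gridSymbol, zero_div, schemeSymbol_zero, sub_self]
  have key := two_mul_tsum_trigCoeff_add cG.continuous sG
    (intervalIntegrable_mul_cot (cG.of_le (by norm_num)) G0)
  have hs1 : Summable fun j : ℕ => trigCoeff G ((j : ℤ) + 1) :=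
    (sG.comp_injective (i := fun j : ℕ => (j : ℤ) + 1) fun a b hab => by simpa using hab).of_norm
  have hsub : ∀ j, (trigCoeff G j).re = (trigCoeff F j).re - (trigCoeff F' j).re := fun j => by
    rw [hG, trigCoeff_sub cF.continuous cF'.continuous, Complex.sub_re]
  have h1 : trapezoidalLoss h (scheme μ ρ x₀ h k z n) -
      trapezoidalLoss h (scheme μ ρ x₀ h k' z' n') =
      -(h / 2) * (trigCoeff (fun φ => G φ * (Complex.I * Real.cot (φ / 2))) 0).re := by
    rw [← key, Complex.add_re, Complex.mul_re, Complex.re_tsum hs1]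
    simp only [hsub]
    have e1 := summable_scheme μ x₀ hρ hh0 hk z n
    have e2 := summable_scheme μ x₀ hρ hh0 hk' z' n'
    rw [scheme_eq_re_trigCoeff μ x₀ hρ hh0 hk] at e1 ⊢
    rw [scheme_eq_re_trigCoeff μ x₀ hρ hh0 hk'] at e2 ⊢
    rw [e1.tsum_sub e2]
    simp only [trapezoidalLoss, Complex.re_ofNat, Complex.im_ofNat]
    ring
  rw [h1, trigCoeff]
  have h2 := intervalIntegral.integral_comp_mul_left (a := -(Real.pi / h)) (b := Real.pi / h)
    (fun φ : ℝ => G φ * (Complex.I * Real.cot (φ / 2)) *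
      Complex.exp (Complex.I * ((0 : ℤ) : ℂ) * φ)) hh0
  rw [mul_neg, mul_div_cancel₀ _ hh0] at h2
  have h3 : (∫ φ in (-Real.pi)..Real.pi, G φ * (Complex.I * Real.cot (φ / 2)) *
      Complex.exp (Complex.I * ((0 : ℤ) : ℂ) * φ)) = (h⁻¹ : ℝ) *
      ∫ ξ in (-(Real.pi / h))..(Real.pi / h),
        (schemeSymbol μ ρ h k z n ξ - schemeSymbol μ ρ h k' z' n' ξ) *
          (Complex.exp (-(Complex.I * ((j₀ * h * ξ : ℝ) : ℂ))) *
            (Complex.I * ((h * Real.cot (h * ξ / 2) : ℝ) : ℂ))) := by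
    rw [← intervalIntegral.integral_const_mul]
    have h4 : (h : ℂ) ≠ 0 := by exact_mod_cast hh0
    have h5 := congrArg (fun w : ℂ => (h : ℂ) * w) h2
    simp only [Complex.real_smul, Complex.ofReal_inv, mul_inv_cancel_left₀ h4] at h5
    rw [← h5, ← intervalIntegral.integral_const_mul]
    congr 1
    funext ξ
    simp only [hG, hF, hF', gridSymbol, mul_div_cancel_left₀ ξ hh0]
    have e1 : Complex.I * ((-j₀ : ℤ) : ℂ) * ((h * ξ : ℝ) : ℂ) =
      -(Complex.I * ((j₀ * h * ξ : ℝ) : ℂ)) := by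
      push_cast
      ring
    rw [e1]
    push_cast
    simp only [mul_zero, zero_mul, Complex.exp_zero]
    ring
  rw [h3, show (2 * Real.pi : ℂ)⁻¹ = (((2 * Real.pi)⁻¹ : ℝ) : ℂ) by push_cast; ring,
    Complex.re_ofReal_mul, Complex.re_ofReal_mul]
  have h4 : ∀ R : ℝ, -(h / 2) * ((2 * Real.pi)⁻¹ * (h⁻¹ * R)) = -(1 / (4 * Real.pi)) * R := by
    intro R
    field_simp
    ring
  exact h4 _

/-! ### Local expansions in a seminormed ring -/

section RingSeminorm

variable {R : Type*} [CommRing R] (N : RingSeminorm R)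

theorem ringSeminorm_mul_le {x y : R} {a b : ℝ} (hx : N x ≤ a) (hy : N y ≤ b) :
    N (x * y) ≤ a * b :=
  (map_mul_le_mul N x y).trans
    (mul_le_mul hx hy (apply_nonneg N y) ((apply_nonneg N x).trans hx))

theorem ringSeminorm_add_le {x y : R} {a b : ℝ} (hx : N x ≤ a) (hy : N y ≤ b) :
    N (x + y) ≤ a + b :=
  (map_add_le_add N x y).trans (add_le_add hx hy)

theorem ringSeminorm_natCast_mul_le (n : ℕ) {x : R} {a : ℝ} (hx : N x ≤ a) :
    N ((n : R) * x) ≤ n * a := by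
  induction n with
  | zero => simp
  | succ n ih =>
    rw [Nat.cast_succ, Nat.cast_succ, add_mul, add_mul, one_mul, one_mul]
    exact ringSeminorm_add_le N ih hx

/-- `x` agrees with `1 + a S + b S²` up to a cubic remainder, all coefficients being bounded
by `W`. -/
def HasSecondOrderExpansion (S x a b : R) (W : ℝ) : Prop :=
  N a ≤ W ∧ N b ≤ W ∧ ∃ r, x = 1 + a * S + b * S ^ 2 + S ^ 3 * r ∧ N r ≤ W

theorem hasSecondOrderExpansion_one (S : R) : HasSecondOrderExpansion N S 1 0 0 1 :=
  ⟨by simp, by simp, 0, by ring, by simp⟩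

variable {N}

/-- The factor 11 = 1 + 2 + 4 + 1 + 1 + 2 adds up the terms of the new remainder, each leftover
power of `S` costing a factor 2. -/
theorem HasSecondOrderExpansion.mul {S x a b α β : R} {W w : ℝ}
    (h : HasSecondOrderExpansion N S x a b W) (hS : N S ≤ 2) (hW : 1 ≤ W) (hw : 1 ≤ w)
    (hα : N α ≤ w) (hβ : N β ≤ w) :
    HasSecondOrderExpansion N S (x * (1 + α * S + β * S ^ 2)) (a + α) (b + β + a * α)
      (11 * (W * w)) := by
  obtain ⟨ha, hb, r, rfl, hr⟩ := h
  have h1 : W ≤ W * w := le_mul_of_one_le_right (by linarith) hw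
  have h2 : w ≤ W * w := le_mul_of_one_le_left (by linarith) hW
  have h3 : 0 ≤ W * w := by positivity
  refine ⟨?_, ?_, r + r * α * S + r * β * (S * S) + a * β + b * α + b * β * S, by ring, ?_⟩
  · exact (ringSeminorm_add_le N ha hα).trans (by linarith)
  · exact (ringSeminorm_add_le N (ringSeminorm_add_le N hb hβ) (ringSeminorm_mul_le N ha hα)).trans
      (by linarith)
  · have := ringSeminorm_add_le N (ringSeminorm_add_le N (ringSeminorm_add_le N
      (ringSeminorm_add_le N (ringSeminorm_add_le N hr
        (ringSeminorm_mul_le N (ringSeminorm_mul_le N hr hα) hS))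
        (ringSeminorm_mul_le N (ringSeminorm_mul_le N hr hβ) (ringSeminorm_mul_le N hS hS)))
      (ringSeminorm_mul_le N ha hβ)) (ringSeminorm_mul_le N hb hα))
      (ringSeminorm_mul_le N (ringSeminorm_mul_le N hb hβ) hS)
    exact this.trans (by linarith)

theorem HasSecondOrderExpansion.sub_le {S x a b : R} {W s : ℝ}
    (h : HasSecondOrderExpansion N S x a b W) (hS : N S ≤ s) :
    N (x - (1 + a * S + b * S ^ 2)) ≤ W * s ^ 3 := by
  obtain ⟨-, -, r, rfl, hr⟩ := h
  have := ringSeminorm_mul_le N hr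
    (ringSeminorm_mul_le N hS (ringSeminorm_mul_le N hS hS))
  rw [show 1 + a * S + b * S ^ 2 + S ^ 3 * r - (1 + a * S + b * S ^ 2) = r * (S * (S * S)) by ring]
  exact this.trans (le_of_eq (by ring))

theorem HasSecondOrderExpansion.quadratic_le {S x a b : R} {W s : ℝ}
    (h : HasSecondOrderExpansion N S x a b W) (hS : N S ≤ s) (hs2 : s ≤ 2) :
    N (a * S + b * S ^ 2) ≤ 3 * W * s := by
  obtain ⟨ha, hb, -⟩ := h
  have hs : 0 ≤ s := (apply_nonneg N S).trans hS
  have hW : 0 ≤ W := (apply_nonneg N a).trans ha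
  have := ringSeminorm_add_le N (ringSeminorm_mul_le N ha hS)
    (ringSeminorm_mul_le N (ringSeminorm_mul_le N hb hS) hS)
  rw [show a * S + b * S ^ 2 = a * S + b * S * S by ring]
  refine this.trans ?_
  nlinarith [mul_nonneg (mul_nonneg hW hs) (sub_nonneg.mpr hs2)]

theorem HasSecondOrderExpansion.sub_one_le {S x a b : R} {W s : ℝ}
    (h : HasSecondOrderExpansion N S x a b W) (hS : N S ≤ s) (hs2 : s ≤ 2) :
    N (x - 1) ≤ 7 * W * s := by
  have hs : 0 ≤ s := (apply_nonneg N S).trans hS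
  have hW : 0 ≤ W := (apply_nonneg N a).trans h.1
  have := ringSeminorm_add_le N (h.sub_le hS) (h.quadratic_le hS hs2)
  rw [show x - 1 = x - (1 + a * S + b * S ^ 2) + (a * S + b * S ^ 2) by ring]
  refine this.trans ?_
  have h4 : s ^ 2 ≤ 4 := by nlinarith
  nlinarith [mul_nonneg (mul_nonneg hW hs) (sub_nonneg.mpr h4)]

/-- Size of the deviations of one coarse step and four fine steps from the identity and from each
other, in terms of the size of `S` (noise) and of `G` (implicit part). -/
theorem blockFactor_estimates {c δ p W : ℝ} (hc : 1 ≤ c) (hδ : 0 ≤ δ) (hδc : δ ≤ c) (hp : 0 ≤ p)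
    {S G F E x a b : R} (hx : HasSecondOrderExpansion N S x a b W) (hW : 1 ≤ W)
    (hS2 : N S ≤ 2) (hS : N S ≤ c * (δ * p)) (hGc : N G ≤ c) (hG : N G ≤ c * (δ ^ 2 * p))
    (hF : N F ≤ c) (hE : N E ≤ c) (hF1 : F * (1 + G) = 1) (hE1 : E * (1 + 4 * G) = 1) :
    N (F ^ 4 - 1) ≤ 12 * c ^ 9 * (δ ^ 2 * (p * (1 + p) ^ 2)) ∧
    N (E - 1) ≤ 12 * c ^ 9 * (δ ^ 2 * (p * (1 + p) ^ 2)) ∧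
    N (F ^ 4 - E) ≤ 12 * c ^ 9 * (δ ^ 4 * (p * (1 + p) ^ 2)) ∧
    N (F ^ 4 * x - 1) ≤ 100 * c ^ 11 * (δ * (p * (1 + p) ^ 2)) * W ∧
    N (E * (1 + a * S + b * S ^ 2) - 1) ≤ 100 * c ^ 11 * (δ * (p * (1 + p) ^ 2)) * W ∧
    N (F ^ 4 * x - E * (1 + a * S + b * S ^ 2)) ≤
      100 * c ^ 11 * (δ ^ 3 * (p * (1 + p) ^ 2)) * W := by
  have hc0 : 0 ≤ c := by linarith
  have hq1 : p ≤ p * (1 + p) ^ 2 := le_mul_of_one_le_right hp (by nlinarith)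
  have hq2 : p ^ 2 ≤ p * (1 + p) ^ 2 := by nlinarith [pow_nonneg hp 3]
  have hq3 : p ^ 3 ≤ p * (1 + p) ^ 2 := by nlinarith [pow_nonneg hp 2]
  set q := p * (1 + p) ^ 2
  have hq : 0 ≤ q := hp.trans hq1
  have hcp : ∀ {i j : ℕ}, i ≤ j → c ^ i ≤ c ^ j := fun h => pow_le_pow_right₀ hc h
  have hF4 : N (F * F * F * F) ≤ c ^ 4 :=
    (ringSeminorm_mul_le N (ringSeminorm_mul_le N (ringSeminorm_mul_le N hF hF) hF) hF).trans
      (le_of_eq (by ring))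
  have eF1 : N (F ^ 4 - 1) ≤ 4 * c ^ 5 * (δ ^ 2 * p) := by
    have h1 := ringSeminorm_mul_le N hG hF
    have h2 := ringSeminorm_mul_le N h1 hF
    have h3 := ringSeminorm_mul_le N h2 hF
    have h4 := ringSeminorm_mul_le N h3 hF
    have h5 := ringSeminorm_add_le N (ringSeminorm_add_le N (ringSeminorm_add_le N h1 h2) h3) h4
    -- F - 1 = -GF, summed against 1 + F + F² + F³.
    have e : F ^ 4 - 1 = -(G * F + G * F * F + G * F * F * F + G * F * F * F * F) := by
      linear_combination (1 + F + F ^ 2 + F ^ 3) * hF1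
    rw [e, map_neg_eq_map]
    refine h5.trans ?_
    have : 0 ≤ δ ^ 2 * p := by positivity
    calc c * (δ ^ 2 * p) * c + c * (δ ^ 2 * p) * c * c + c * (δ ^ 2 * p) * c * c * c +
          c * (δ ^ 2 * p) * c * c * c * c
        = (c ^ 2 + c ^ 3 + c ^ 4 + c ^ 5) * (δ ^ 2 * p) := by ring
      _ ≤ (c ^ 5 + c ^ 5 + c ^ 5 + c ^ 5) * (δ ^ 2 * p) := by
          gcongr <;> first | exact hc | norm_num
      _ = 4 * c ^ 5 * (δ ^ 2 * p) := by ring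
  have eE1 : N (E - 1) ≤ 4 * c ^ 2 * (δ ^ 2 * p) := by
    have h1 := ringSeminorm_natCast_mul_le N 4 (ringSeminorm_mul_le N hG hE)
    have e : E - 1 = -(((4 : ℕ) : R) * (G * E)) := by
      push_cast
      linear_combination hE1
    rw [e, map_neg_eq_map]
    exact h1.trans (le_of_eq (by push_cast; ring))
  have eFE : N (F ^ 4 - E) ≤ 11 * c ^ 9 * (δ ^ 4 * p ^ 2) := by
    have h1 := ringSeminorm_mul_le N (ringSeminorm_mul_le N (ringSeminorm_mul_le N hG hG) hF4) hE
    set H := G * G * (F * F * F * F) * E with hH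
    have h2 := ringSeminorm_mul_le N h1 hGc
    have h3 := ringSeminorm_mul_le N h2 hGc
    have h4 := ringSeminorm_add_le N (ringSeminorm_add_le N (ringSeminorm_natCast_mul_le N 6 h1)
      (ringSeminorm_natCast_mul_le N 4 h2)) h3
    -- F⁴ - E = F⁴E((1 + 4G) - (1 + G)⁴): the terms linear in G cancel, which improves the order
    -- from δ² to δ⁴.
    have e : F ^ 4 - E = -(((6 : ℕ) : R) * H + ((4 : ℕ) : R) * (H * G) + H * G * G) := by
      have e4 : F ^ 4 * (1 + G) ^ 4 = 1 := by
        rw [← mul_pow, hF1, one_pow]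
      push_cast
      rw [hH]
      linear_combination (-F ^ 4) * hE1 + E * e4
    rw [e, map_neg_eq_map]
    refine h4.trans ?_
    have : 0 ≤ δ ^ 4 * p ^ 2 := by positivity
    calc _ = (6 * c ^ 7 + 4 * c ^ 8 + c ^ 9) * (δ ^ 4 * p ^ 2) := by push_cast; ring
      _ ≤ (6 * c ^ 9 + 4 * c ^ 9 + c ^ 9) * (δ ^ 4 * p ^ 2) := by
          gcongr <;> first | exact hc | norm_num
      _ = 11 * c ^ 9 * (δ ^ 4 * p ^ 2) := by ring
  have hW0 : 0 ≤ W := by linarith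
  have hu := hx.quadratic_le le_rfl hS2
  have hδp : 0 ≤ δ * p := by positivity
  refine ⟨?_, ?_, ?_, ?_, ?_, ?_⟩
  · refine eF1.trans ?_
    have := hcp (show 5 ≤ 9 by norm_num)
    gcongr
    norm_num
  · refine eE1.trans ?_
    have := hcp (show 2 ≤ 9 by norm_num)
    gcongr
    norm_num
  · refine eFE.trans ?_
    gcongr
    norm_num
  · have h1 := ringSeminorm_mul_le N hF4 (hx.sub_one_le le_rfl hS2)
    have h2 := ringSeminorm_add_le N h1 eF1
    rw [show F ^ 4 * x - 1 = F * F * F * F * (x - 1) + (F ^ 4 - 1) by ring]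
    refine h2.trans ?_
    calc c ^ 4 * (7 * W * N S) + 4 * c ^ 5 * (δ ^ 2 * p)
        ≤ c ^ 4 * (7 * W * (c * (δ * p))) + 4 * c ^ 5 * (δ ^ 2 * p) := by gcongr
      _ = (7 * c ^ 5 * W + 4 * c ^ 5 * δ * 1) * (δ * p) := by ring
      _ ≤ (7 * c ^ 6 * W + 4 * c ^ 5 * c * W) * (δ * q) := by
          gcongr
          · norm_num
      _ = 11 * c ^ 6 * (δ * q) * W := by ring
      _ ≤ 100 * c ^ 11 * (δ * q) * W := by
          gcongr
          · norm_num
          · norm_num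
  · have h1 := ringSeminorm_mul_le N hE hu
    have h2 := ringSeminorm_add_le N h1 eE1
    rw [show E * (1 + a * S + b * S ^ 2) - 1 = E * (a * S + b * S ^ 2) + (E - 1) by ring]
    refine h2.trans ?_
    calc c * (3 * W * N S) + 4 * c ^ 2 * (δ ^ 2 * p)
        ≤ c * (3 * W * (c * (δ * p))) + 4 * c ^ 2 * (δ ^ 2 * p) := by gcongr
      _ = (3 * c ^ 2 * W + 4 * c ^ 2 * δ * 1) * (δ * p) := by ring
      _ ≤ (3 * c ^ 3 * W + 4 * c ^ 2 * c * W) * (δ * q) := by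
          gcongr
          · norm_num
      _ = 7 * c ^ 3 * (δ * q) * W := by ring
      _ ≤ 100 * c ^ 11 * (δ * q) * W := by
          gcongr
          · norm_num
          · norm_num
  · have h1 := ringSeminorm_mul_le N hF4 (hx.sub_le hS)
    have h2 := ringSeminorm_mul_le N eFE hu
    have h3 := ringSeminorm_add_le N (ringSeminorm_add_le N h1 eFE) h2
    -- The cubic remainder of the noise has order δ³. The mismatch of the implicit parts, of order
    -- δ⁴, acts on 1 and on the noise terms.
    rw [show F ^ 4 * x - E * (1 + a * S + b * S ^ 2) = F * F * F * F * (x - (1 + a * S + b * S ^ 2))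
      + (F ^ 4 - E) + (F ^ 4 - E) * (a * S + b * S ^ 2) by ring]
    refine h3.trans ?_
    calc c ^ 4 * (W * (c * (δ * p)) ^ 3) + 11 * c ^ 9 * (δ ^ 4 * p ^ 2) +
          11 * c ^ 9 * (δ ^ 4 * p ^ 2) * (3 * W * N S)
        ≤ c ^ 4 * (W * (c * (δ * p)) ^ 3) + 11 * c ^ 9 * (δ ^ 4 * p ^ 2) +
          11 * c ^ 9 * (δ ^ 4 * p ^ 2) * (3 * W * 2) := by gcongr
      _ = δ ^ 3 * (c ^ 7 * W * p ^ 3 + 11 * c ^ 9 * δ * p ^ 2 * 1 +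
            66 * c ^ 9 * δ * p ^ 2 * W) := by ring
      _ ≤ δ ^ 3 * (c ^ 10 * W * q + 11 * c ^ 9 * c * q * W + 66 * c ^ 9 * c * q * W) := by
          gcongr
          · norm_num
      _ = 78 * c ^ 10 * (δ ^ 3 * q) * W := by ring
      _ ≤ 100 * c ^ 11 * (δ ^ 3 * q) * W := by
          gcongr
          · norm_num
          · norm_num

end RingSeminorm

/-! ### One block of four time steps at two neighbouring meshes -/

/-- The seminorm `max ‖x‖ ‖y‖ + ‖x - y‖ / η` on pairs of complex numbers. -/
noncomputable def pairSeminorm (η : ℝ) (hη : 0 < η) : RingSeminorm (ℂ × ℂ) where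
  toFun x := max ‖x.1‖ ‖x.2‖ + ‖x.1 - x.2‖ / η
  map_zero' := by simp
  add_le' x y := by
    have h1 := norm_add_le x.1 y.1
    have h2 := norm_add_le x.2 y.2
    have h3 : ‖(x + y).1 - (x + y).2‖ / η ≤ ‖x.1 - x.2‖ / η + ‖y.1 - y.2‖ / η := by
      rw [← add_div]
      gcongr
      rw [show (x + y).1 - (x + y).2 = (x.1 - x.2) + (y.1 - y.2) by
        rw [Prod.fst_add, Prod.snd_add]; ring]
      exact norm_add_le _ _
    have h4 : max ‖(x + y).1‖ ‖(x + y).2‖ ≤ max ‖x.1‖ ‖x.2‖ + max ‖y.1‖ ‖y.2‖ :=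
      max_le (h1.trans (add_le_add (le_max_left _ _) (le_max_left _ _)))
        (h2.trans (add_le_add (le_max_right _ _) (le_max_right _ _)))
    linarith
  neg' x := by
    rw [Prod.fst_neg, Prod.snd_neg, norm_neg, norm_neg, neg_sub_neg, norm_sub_rev]
  mul_le' x y := by
    set X := max ‖x.1‖ ‖x.2‖ with hX
    set Y := max ‖y.1‖ ‖y.2‖ with hY
    have hx1 : ‖x.1‖ ≤ X := le_max_left _ _
    have hx2 : ‖x.2‖ ≤ X := le_max_right _ _
    have hy1 : ‖y.1‖ ≤ Y := le_max_left _ _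
    have hy2 : ‖y.2‖ ≤ Y := le_max_right _ _
    have hX0 : 0 ≤ X := (norm_nonneg _).trans hx1
    have hY0 : 0 ≤ Y := (norm_nonneg _).trans hy1
    have h1 : max ‖(x * y).1‖ ‖(x * y).2‖ ≤ X * Y := by
      refine max_le ?_ ?_
      · rw [Prod.fst_mul, norm_mul]
        gcongr
      · rw [Prod.snd_mul, norm_mul]
        gcongr
    have h2 : ‖(x * y).1 - (x * y).2‖ / η ≤ (X * ‖y.1 - y.2‖ + ‖x.1 - x.2‖ * Y) / η := by
      gcongr
      rw [show (x * y).1 - (x * y).2 = x.1 * (y.1 - y.2) + (x.1 - x.2) * y.2 by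
        rw [Prod.fst_mul, Prod.snd_mul]; ring]
      refine (norm_add_le _ _).trans ?_
      rw [norm_mul, norm_mul]
      gcongr
    have h3 : 0 ≤ ‖x.1 - x.2‖ / η * (‖y.1 - y.2‖ / η) := by positivity
    calc _ ≤ X * Y + (X * ‖y.1 - y.2‖ + ‖x.1 - x.2‖ * Y) / η := add_le_add h1 h2
      _ = (X + ‖x.1 - x.2‖ / η) * (Y + ‖y.1 - y.2‖ / η) -
          ‖x.1 - x.2‖ / η * (‖y.1 - y.2‖ / η) := by ring
      _ ≤ _ := by linarith

theorem pairSeminorm_apply {η : ℝ} (hη : 0 < η) (x : ℂ × ℂ) :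
    pairSeminorm η hη x = max ‖x.1‖ ‖x.2‖ + ‖x.1 - x.2‖ / η := rfl

theorem pairSeminorm_diag {η : ℝ} (hη : 0 < η) (c : ℂ) : pairSeminorm η hη (c, c) = ‖c‖ := by
  simp [pairSeminorm_apply]

theorem norm_fst_le_pairSeminorm {η : ℝ} (hη : 0 < η) (x : ℂ × ℂ) :
    ‖x.1‖ ≤ pairSeminorm η hη x := by
  rw [pairSeminorm_apply]
  have : 0 ≤ ‖x.1 - x.2‖ / η := by positivity
  linarith [le_max_left ‖x.1‖ ‖x.2‖]

theorem norm_snd_le_pairSeminorm {η : ℝ} (hη : 0 < η) (x : ℂ × ℂ) :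
    ‖x.2‖ ≤ pairSeminorm η hη x := by
  rw [pairSeminorm_apply]
  have : 0 ≤ ‖x.1 - x.2‖ / η := by positivity
  linarith [le_max_right ‖x.1‖ ‖x.2‖]

theorem norm_sub_le_pairSeminorm {η : ℝ} (hη : 0 < η) (x : ℂ × ℂ) :
    ‖x.1 - x.2‖ ≤ η * pairSeminorm η hη x := by
  rw [pairSeminorm_apply, mul_add, mul_div_cancel₀ _ hη.ne']
  have : 0 ≤ η * max ‖x.1‖ ‖x.2‖ := mul_nonneg hη.le ((norm_nonneg _).trans (le_max_left _ _))
  linarith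

/-- The mean of the amplification factor of four steps of size `k`. -/
noncomputable def fineMean (μ h k ξ : ℝ) : ℂ :=
  (stepDen μ k (symbolD1 h ξ) (symbolD2 h ξ))⁻¹ ^ 4

/-- The mean of the amplification factor of one step of size `4k`. -/
noncomputable def coarseMean (μ h k ξ : ℝ) : ℂ :=
  (stepDen μ (4 * k) (symbolD1 h ξ) (symbolD2 h ξ))⁻¹

/-- The amplification factor of four steps of size `k`. -/
noncomputable def fineFactor (μ ρ h k ξ : ℝ) (b : Fin 4 → ℝ) : ℂ :=
  fineMean μ h k ξ * ∏ j, stepNum (√(ρ * k) * symbolD1 h ξ) (b j)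

/-- The amplification factor of one step of size `4k` driven by the sum of the increments. -/
noncomputable def coarseFactor (μ ρ h k ξ : ℝ) (b : Fin 4 → ℝ) : ℂ :=
  coarseMean μ h k ξ * stepNum (2 * (√(ρ * k) * symbolD1 h ξ)) ((∑ j, b j) / 2)

/-- The weight bounding the random coefficients in a block. -/
noncomputable def blockWeight (b : Fin 4 → ℝ) : ℝ := 11 ^ 4 * ∏ j, (1 + b j ^ 2)

/-- The coefficients up to second order of four Milstein factors are exactly those of one coarse
Milstein factor, because ∑(b_j² - 1) + 2∑_{i<j} b_i b_j = (∑ b_j)² - 4. Hence four fine steps and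
one coarse step differ only from third order on. The two entries of each pair belong to two meshes.
-/
theorem block_hasSecondOrderExpansion {η : ℝ} (hη : 0 < η) (σ σ' : ℝ)
    (hS : pairSeminorm η hη ((σ : ℂ), (σ' : ℂ)) ≤ 2) (b : Fin 4 → ℝ) :
    ∃ u v : ℂ × ℂ, HasSecondOrderExpansion (pairSeminorm η hη) ((σ : ℂ), (σ' : ℂ))
      (∏ j, stepNum σ (b j), ∏ j, stepNum σ' (b j)) u v (blockWeight b) ∧
      1 + u * ((σ : ℂ), (σ' : ℂ)) + v * ((σ : ℂ), (σ' : ℂ)) ^ 2 =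
        (stepNum (2 * σ) ((∑ j, b j) / 2), stepNum (2 * σ') ((∑ j, b j) / 2)) := by
  set N := pairSeminorm η hη
  set S : ℂ × ℂ := ((σ : ℂ), (σ' : ℂ)) with hSdef
  set α : Fin 4 → ℂ × ℂ := fun j => (-(Complex.I * b j), -(Complex.I * b j)) with hα
  set β : Fin 4 → ℂ × ℂ := fun j => (-((b j : ℂ) ^ 2 - 1) / 2, -((b j : ℂ) ^ 2 - 1) / 2) with hβ
  set w : Fin 4 → ℝ := fun j => 1 + b j ^ 2 with hw
  have hw1 : ∀ j, 1 ≤ w j := fun j => by simp only [hw]; nlinarith [sq_nonneg (b j)]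
  have hNα : ∀ j, N (α j) ≤ w j := fun j => by
    simp only [N, hα, hw, pairSeminorm_diag, norm_neg, norm_mul, Complex.norm_I, one_mul,
      Complex.norm_real, Real.norm_eq_abs]
    nlinarith [sq_nonneg (|b j| - 1), sq_abs (b j)]
  have hNβ : ∀ j, N (β j) ≤ w j := fun j => by
    simp only [N, hβ, hw, pairSeminorm_diag]
    rw [show (-((b j : ℂ) ^ 2 - 1) / 2 : ℂ) = (((1 - b j ^ 2) / 2 : ℝ) : ℂ) by push_cast; ring,
      Complex.norm_real, Real.norm_eq_abs, abs_le]
    constructor <;> nlinarith [sq_nonneg (b j)]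
  have hm : ∀ {W : ℝ} (j), 1 ≤ W → 1 ≤ 11 * (W * w j) := fun j hW => by
    have := hw1 j
    nlinarith [mul_le_mul hW (hw1 j) zero_le_one (by linarith)]
  have h0 := hasSecondOrderExpansion_one N S
  have h1 := h0.mul hS le_rfl (hw1 0) (hNα 0) (hNβ 0)
  have h2 := h1.mul hS (hm 0 le_rfl) (hw1 1) (hNα 1) (hNβ 1)
  have h3 := h2.mul hS (hm 1 (hm 0 le_rfl)) (hw1 2) (hNα 2) (hNβ 2)
  have h4 := h3.mul hS (hm 2 (hm 1 (hm 0 le_rfl))) (hw1 3) (hNα 3) (hNβ 3)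
  have e : 1 * (1 + α 0 * S + β 0 * S ^ 2) * (1 + α 1 * S + β 1 * S ^ 2) *
      (1 + α 2 * S + β 2 * S ^ 2) * (1 + α 3 * S + β 3 * S ^ 2) =
      (∏ j, stepNum σ (b j), ∏ j, stepNum σ' (b j)) := by
    ext
    · simp only [Fin.prod_univ_four, stepNum, hα, hβ, hSdef, Prod.fst_mul, Prod.fst_add,
        Prod.fst_one, Prod.pow_fst]
      ring
    · simp only [Fin.prod_univ_four, stepNum, hα, hβ, hSdef, Prod.snd_mul, Prod.snd_add,
        Prod.snd_one, Prod.pow_snd]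
      ring
  have e' : 11 * (11 * (11 * (11 * (1 * w 0) * w 1) * w 2) * w 3) = blockWeight b := by
    simp only [blockWeight, Fin.prod_univ_four, hw]
    ring
  rw [e, e'] at h4
  refine ⟨_, _, h4, ?_⟩
  ext
  · simp only [Fin.sum_univ_four, stepNum, hα, hβ, hSdef, Prod.fst_mul, Prod.fst_add,
      Prod.fst_one, Prod.pow_fst, Prod.fst_zero]
    push_cast
    ring_nf
    simp only [Complex.I_sq]
    ring
  · simp only [Fin.sum_univ_four, stepNum, hα, hβ, hSdef, Prod.snd_mul, Prod.snd_add,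
      Prod.snd_one, Prod.pow_snd, Prod.snd_zero]
    push_cast
    ring_nf
    simp only [Complex.I_sq]
    ring

theorem one_le_blockWeight (b : Fin 4 → ℝ) : 1 ≤ blockWeight b := by
  have h : ∀ x : ℝ, 1 ≤ 1 + x ^ 2 := fun x => by nlinarith [sq_nonneg x]
  have : 1 ≤ ∏ j, (1 + b j ^ 2) := Finset.one_le_prod fun j _ => h _
  unfold blockWeight
  linarith

/-! ### Bounds for the symbols -/

theorem abs_symbolD1_le {h : ℝ} (hh : 0 < h) (ξ : ℝ) : |symbolD1 h ξ| ≤ |ξ| := by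
  rw [symbolD1, abs_div, abs_of_pos hh, div_le_iff₀ hh]
  exact Real.abs_sin_le_abs.trans (by rw [abs_mul, abs_of_pos hh, mul_comm])

theorem symbolD2_le {h : ℝ} (hh : 0 < h) (ξ : ℝ) : symbolD2 h ξ ≤ ξ ^ 2 := by
  rw [symbolD2, div_le_iff₀ (by positivity)]
  have h1 : |Real.sin (h * ξ / 2)| ≤ |h * ξ / 2| := Real.abs_sin_le_abs
  have h2 := sq_le_sq.mpr h1
  nlinarith

/-- sin²(2y) ≤ 4 sin² y. This lets the diffusion dominate the noise in the stability estimate. -/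
theorem symbolD1_sq_le {h : ℝ} (hh : 0 < h) (ξ : ℝ) : symbolD1 h ξ ^ 2 ≤ symbolD2 h ξ := by
  rw [symbolD1, symbolD2, div_pow]
  gcongr
  have e : Real.sin (h * ξ) = 2 * Real.sin (h * ξ / 2) * Real.cos (h * ξ / 2) := by
    rw [← Real.sin_two_mul]
    congr 1
    ring
  rw [e]
  have h1 := Real.sin_sq_add_cos_sq (h * ξ / 2)
  nlinarith [mul_nonneg (sq_nonneg (Real.sin (h * ξ / 2))) (sq_nonneg (Real.sin (h * ξ / 2)))]

theorem le_symbolD2 {h ξ : ℝ} (hh : 0 < h) (hξ : |h * ξ| ≤ Real.pi) :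
    4 / Real.pi ^ 2 * ξ ^ 2 ≤ symbolD2 h ξ := by
  have h0 : |h * ξ / 2| ≤ Real.pi / 2 := by
    rw [abs_div, abs_two]
    linarith
  have h1 := Real.mul_abs_le_abs_sin h0
  have h2 : (2 / Real.pi * |h * ξ / 2|) ^ 2 ≤ |Real.sin (h * ξ / 2)| ^ 2 := by gcongr
  rw [sq_abs, mul_pow, sq_abs] at h2
  rw [symbolD2, le_div_iff₀ (by positivity)]
  calc 4 / Real.pi ^ 2 * ξ ^ 2 * h ^ 2 = 4 * ((2 / Real.pi) ^ 2 * (h * ξ / 2) ^ 2) := by ring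
    _ ≤ _ := by linarith

/-- By the double angle formula, doubling the mesh multiplies this symbol by cos(hξ). -/
theorem abs_symbolD1_sub_le {h : ℝ} (hh : 0 < h) (ξ : ℝ) :
    |symbolD1 h ξ - symbolD1 (2 * h) ξ| ≤ h ^ 2 * |ξ| ^ 3 / 2 := by
  have e : symbolD1 h ξ - symbolD1 (2 * h) ξ = symbolD1 h ξ * (1 - Real.cos (h * ξ)) := by
    rw [symbolD1, symbolD1, mul_assoc, Real.sin_two_mul]
    field_simp
  have h1 : 1 - (h * ξ) ^ 2 / 2 ≤ Real.cos (h * ξ) := Real.one_sub_sq_div_two_le_cos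
  have h2 := Real.cos_le_one (h * ξ)
  rw [e, abs_mul, abs_of_nonneg (sub_nonneg.mpr h2)]
  calc |symbolD1 h ξ| * (1 - Real.cos (h * ξ)) ≤ |ξ| * ((h * ξ) ^ 2 / 2) := by
        have := abs_symbolD1_le hh ξ
        exact mul_le_mul this (by linarith) (by linarith) (abs_nonneg _)
    _ = h ^ 2 * |ξ| ^ 3 / 2 := by
        rw [mul_pow, ← sq_abs ξ]
        ring

/-- From sin²(2y) = 4 sin² y (1 - sin² y), the difference equals h²/4 times the square of the symbol
at mesh h. -/
theorem abs_symbolD2_sub_le {h : ℝ} (hh : 0 < h) (ξ : ℝ) :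
    |symbolD2 h ξ - symbolD2 (2 * h) ξ| ≤ h ^ 2 * ξ ^ 4 / 4 := by
  have e : symbolD2 h ξ - symbolD2 (2 * h) ξ = h ^ 2 * symbolD2 h ξ ^ 2 / 4 := by
    have e1 : Real.sin (2 * h * ξ / 2) = 2 * Real.sin (h * ξ / 2) * Real.cos (h * ξ / 2) := by
      rw [← Real.sin_two_mul]
      congr 1
      ring
    rw [symbolD2, symbolD2, e1, mul_pow, mul_pow, Real.cos_sq']
    field_simp
    ring
  have h1 := symbolD2_le hh ξ
  have h2 := symbolD2_nonneg h ξ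
  rw [e, abs_of_nonneg (by positivity)]
  calc h ^ 2 * symbolD2 h ξ ^ 2 / 4 ≤ h ^ 2 * (ξ ^ 2) ^ 2 / 4 := by gcongr
    _ = h ^ 2 * ξ ^ 4 / 4 := by ring

/-- A polynomial majorant in the frequency, vanishing to first order at zero. -/
noncomputable def freqWeight (ξ : ℝ) : ℝ :=
  |ξ| * (1 + |ξ|) * (1 + |ξ| * (1 + |ξ|)) ^ 2

theorem freqWeight_nonneg (ξ : ℝ) : 0 ≤ freqWeight ξ := by unfold freqWeight; positivity

/-- The scale η = h²(1 + ξ²) is chosen so that the mesh difference of each symbol, divided by η,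
obeys the same bound, |ξ| or ξ², as the symbol itself. -/
theorem pairSeminorm_symbolD1_le {h : ℝ} (hh : 0 < h) (ξ : ℝ) (hη : 0 < h ^ 2 * (1 + ξ ^ 2)) :
    pairSeminorm _ hη ((symbolD1 h ξ : ℂ), (symbolD1 (2 * h) ξ : ℂ)) ≤ 2 * |ξ| := by
  rw [pairSeminorm_apply, two_mul |ξ|]
  simp only [← Complex.ofReal_sub, Complex.norm_real, Real.norm_eq_abs]
  have h2h : 0 < 2 * h := by linarith
  refine add_le_add (max_le (abs_symbolD1_le hh ξ) (abs_symbolD1_le h2h ξ))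
    ((div_le_iff₀ hη).mpr ((abs_symbolD1_sub_le hh ξ).trans ?_))
  rw [← sq_abs ξ, show |ξ| * (h ^ 2 * (1 + |ξ| ^ 2)) = h ^ 2 * |ξ| + h ^ 2 * |ξ| ^ 3 by ring]
  have h1 : 0 ≤ h ^ 2 * |ξ| := by positivity
  have h2 : 0 ≤ h ^ 2 * |ξ| ^ 3 := by positivity
  linarith

theorem pairSeminorm_symbolD2_le {h : ℝ} (hh : 0 < h) (ξ : ℝ) (hη : 0 < h ^ 2 * (1 + ξ ^ 2)) :
    pairSeminorm _ hη ((symbolD2 h ξ : ℂ), (symbolD2 (2 * h) ξ : ℂ)) ≤ 2 * ξ ^ 2 := by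
  rw [pairSeminorm_apply, two_mul (ξ ^ 2)]
  simp only [← Complex.ofReal_sub, Complex.norm_real, Real.norm_eq_abs,
    abs_of_nonneg (symbolD2_nonneg _ _)]
  have h2h : 0 < 2 * h := by linarith
  refine add_le_add (max_le (symbolD2_le hh ξ) (symbolD2_le h2h ξ))
    ((div_le_iff₀ hη).mpr ((abs_symbolD2_sub_le hh ξ).trans ?_))
  rw [show ξ ^ 2 * (h ^ 2 * (1 + ξ ^ 2)) = h ^ 2 * ξ ^ 2 + h ^ 2 * ξ ^ 4 by ring]
  have h1 : 0 ≤ h ^ 2 * ξ ^ 2 := by positivity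
  have h2 : 0 ≤ h ^ 2 * ξ ^ 4 := by positivity
  linarith

/-- Inversion does not increase distances between points of modulus at least 1. -/
theorem pairSeminorm_inv_le {η : ℝ} (hη : 0 < η) {x y : ℂ} (hx : 1 ≤ ‖x‖) (hy : 1 ≤ ‖y‖) :
    pairSeminorm η hη (x⁻¹, y⁻¹) ≤ 1 + pairSeminorm η hη (x - 1, y - 1) := by
  have hx0 : x ≠ 0 := norm_pos_iff.mp (by linarith)
  have hy0 : y ≠ 0 := norm_pos_iff.mp (by linarith)
  rw [pairSeminorm_apply, pairSeminorm_apply]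
  have h1 : max ‖x⁻¹‖ ‖y⁻¹‖ ≤ 1 := by
    rw [norm_inv, norm_inv]
    exact max_le (inv_le_one_of_one_le₀ hx) (inv_le_one_of_one_le₀ hy)
  have h2 : ‖x⁻¹ - y⁻¹‖ ≤ ‖x - 1 - (y - 1)‖ := by
    rw [inv_sub_inv hx0 hy0, norm_div, norm_mul, norm_sub_rev, sub_sub_sub_cancel_right]
    exact div_le_self (norm_nonneg _) (by nlinarith)
  have h3 : 0 ≤ max ‖x - 1‖ ‖y - 1‖ := (norm_nonneg _).trans (le_max_left _ _)
  have h4 : ‖x⁻¹ - y⁻¹‖ / η ≤ ‖x - 1 - (y - 1)‖ / η := by gcongr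
  simp only at h4 ⊢
  linarith

-- All consistency bounds at once: a bound in the pair seminorm controls the value on either mesh
-- and, multiplied by η, the difference between the meshes. Random deviations have orders √k and
-- k^{3/2}, their means k and k². The condition kξ² ≤ 1 keeps the seminorm of the noise below 2 and
-- that of the implicit part bounded.
set_option maxHeartbeats 1000000 in
theorem exists_block_bounds (μ T : ℝ) : ∃ K : ℝ, 1 ≤ K ∧
    ∀ (ρ h k ξ : ℝ), 0 < ρ → ρ ≤ 1 → 0 < h → 0 < k → k ≤ T → k * ξ ^ 2 ≤ 1 →
      ∀ hη : 0 < h ^ 2 * (1 + ξ ^ 2),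
        pairSeminorm _ hη (fineMean μ h k ξ - 1, fineMean μ (2 * h) k ξ - 1) ≤
          K * (√k ^ 2 * freqWeight ξ) ∧
        pairSeminorm _ hη (coarseMean μ h k ξ - 1, coarseMean μ (2 * h) k ξ - 1) ≤
          K * (√k ^ 2 * freqWeight ξ) ∧
        pairSeminorm _ hη (fineMean μ h k ξ - coarseMean μ h k ξ,
          fineMean μ (2 * h) k ξ - coarseMean μ (2 * h) k ξ) ≤ K * (√k ^ 4 * freqWeight ξ) ∧
        ∀ b : Fin 4 → ℝ,
          pairSeminorm _ hη (fineFactor μ ρ h k ξ b - 1, fineFactor μ ρ (2 * h) k ξ b - 1) ≤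
            K * (√k * freqWeight ξ) * blockWeight b ∧
          pairSeminorm _ hη (coarseFactor μ ρ h k ξ b - 1, coarseFactor μ ρ (2 * h) k ξ b - 1) ≤
            K * (√k * freqWeight ξ) * blockWeight b ∧
          pairSeminorm _ hη (fineFactor μ ρ h k ξ b - coarseFactor μ ρ h k ξ b,
            fineFactor μ ρ (2 * h) k ξ b - coarseFactor μ ρ (2 * h) k ξ b) ≤
            K * (√k ^ 3 * freqWeight ξ) * blockWeight b := by
  -- Large enough for all later demands: 1 + 4(2|μ|√T + 1) for the coarse inverse, √T for δ, and
  -- 2|μ| + 1 for the implicit part.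
  set c : ℝ := 4 * (2 * |μ| * √T + 1) + 3 + √T + 2 * |μ| with hc
  have hμ := abs_nonneg μ
  have hT := Real.sqrt_nonneg T
  have hμT : 0 ≤ |μ| * √T := by positivity
  have hc1 : 1 ≤ c := by rw [hc]; linarith
  refine ⟨100 * c ^ 11, by linarith [one_le_pow₀ hc1 (n := 11)], ?_⟩
  intro ρ h k ξ hρ0 hρ1 hh hk hkT hkξ hη
  set N := pairSeminorm _ hη with hN
  set δ := √k with hδ
  have hδ0 : 0 ≤ δ := Real.sqrt_nonneg k
  have hδk : δ ^ 2 = k := Real.sq_sqrt hk.le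
  have hδT : δ ≤ √T := Real.sqrt_le_sqrt hkT
  have hδξ : δ * |ξ| ≤ 1 := by
    have : (δ * |ξ|) ^ 2 ≤ 1 := by rwa [mul_pow, hδk, sq_abs]
    exact (sq_le_one_iff₀ (by positivity)).mp this
  have hξ0 := abs_nonneg ξ
  set p := |ξ| * (1 + |ξ|) with hp
  have hp0 : 0 ≤ p := by positivity
  have hξp : |ξ| ≤ p := le_mul_of_one_le_right hξ0 (by linarith)
  have hξp2 : ξ ^ 2 ≤ p := by
    rw [← sq_abs, hp, mul_add, ← sq]
    linarith
  set σ := √(ρ * k) * symbolD1 h ξ with hσ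
  set σ' := √(ρ * k) * symbolD1 (2 * h) ξ with hσ'
  have hρk : √(ρ * k) ≤ δ := Real.sqrt_le_sqrt (mul_le_of_le_one_left hk.le hρ1)
  have hS1 : N ((σ : ℂ), (σ' : ℂ)) ≤ δ * (2 * |ξ|) := by
    have e : ((σ : ℂ), (σ' : ℂ)) = (((√(ρ * k) : ℝ) : ℂ), ((√(ρ * k) : ℝ) : ℂ)) *
        ((symbolD1 h ξ : ℂ), (symbolD1 (2 * h) ξ : ℂ)) := by
      ext <;> simp [hσ, hσ']
    rw [e]
    refine ringSeminorm_mul_le N ?_ (pairSeminorm_symbolD1_le hh ξ hη)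
    rw [hN, pairSeminorm_diag, Complex.norm_real, Real.norm_of_nonneg (Real.sqrt_nonneg _)]
    exact hρk
  have hS2 : N ((σ : ℂ), (σ' : ℂ)) ≤ 2 := hS1.trans (by linarith)
  have hS : N ((σ : ℂ), (σ' : ℂ)) ≤ c * (δ * p) := by
    refine hS1.trans ?_
    have h1 : δ * |ξ| ≤ δ * p := by gcongr
    have h2 : 0 ≤ δ * p := by positivity
    have h3 : 2 ≤ c := by rw [hc]; linarith
    linarith [mul_le_mul_of_nonneg_right h3 h2]
  set g : ℝ → ℂ := fun h => k * (Complex.I * μ * symbolD1 h ξ + symbolD2 h ξ / 2) with hg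
  set G : ℂ × ℂ := (g h, g (2 * h)) with hGdef
  have hG1 : N G ≤ k * (|μ| * (2 * |ξ|) + 1 / 2 * (2 * ξ ^ 2)) := by
    have e : G = ((k : ℂ), (k : ℂ)) * ((Complex.I * μ, Complex.I * μ) *
        ((symbolD1 h ξ : ℂ), (symbolD1 (2 * h) ξ : ℂ)) + (1 / 2, 1 / 2) *
        ((symbolD2 h ξ : ℂ), (symbolD2 (2 * h) ξ : ℂ))) := by
      ext <;> simp only [hGdef, hg, Prod.fst_mul, Prod.fst_add, Prod.snd_mul, Prod.snd_add] <;> ring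
    rw [e]
    refine ringSeminorm_mul_le N ?_ (ringSeminorm_add_le N
      (ringSeminorm_mul_le N ?_ (pairSeminorm_symbolD1_le hh ξ hη))
      (ringSeminorm_mul_le N ?_ (pairSeminorm_symbolD2_le hh ξ hη)))
    · rw [hN, pairSeminorm_diag, Complex.norm_real, Real.norm_of_nonneg hk.le]
    · rw [hN, pairSeminorm_diag, norm_mul, Complex.norm_I, Complex.norm_real, one_mul,
        Real.norm_eq_abs]
    · rw [hN, pairSeminorm_diag]
      norm_num
  have hG2 : N G ≤ 2 * |μ| * √T + 1 := by
    refine hG1.trans ?_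
    have h1 : k * |ξ| ≤ √T := by
      rw [← hδk, sq, mul_assoc]
      exact (mul_le_of_le_one_right hδ0 hδξ).trans hδT
    have h2 := mul_le_mul_of_nonneg_left h1 hμ
    linarith
  have hG : N G ≤ c * (δ ^ 2 * p) := by
    refine hG1.trans ?_
    rw [hδk]
    have h1 : |μ| * (2 * |ξ|) + 1 / 2 * (2 * ξ ^ 2) ≤ c * p := by
      have h2 : (2 * |μ| + 1) * p ≤ c * p := by
        gcongr
        rw [hc]
        linarith
      have h3 := mul_le_mul_of_nonneg_left hξp hμ
      linarith
    exact (mul_le_mul_of_nonneg_left h1 hk.le).trans (le_of_eq (by ring))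
  have hd : ∀ h : ℝ, stepDen μ k (symbolD1 h ξ) (symbolD2 h ξ) = 1 + g h := fun h => rfl
  have hd4 : ∀ h : ℝ, stepDen μ (4 * k) (symbolD1 h ξ) (symbolD2 h ξ) = 1 + 4 * g h := fun h => by
    simp only [stepDen, hg]
    push_cast
    ring
  set F : ℂ × ℂ := ((1 + g h)⁻¹, (1 + g (2 * h))⁻¹) with hFdef
  set E : ℂ × ℂ := ((1 + 4 * g h)⁻¹, (1 + 4 * g (2 * h))⁻¹) with hEdef
  have hn : ∀ h : ℝ, 1 ≤ ‖1 + g h‖ := fun h => by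
    rw [← hd]
    exact one_le_norm_stepDen hk.le (symbolD2_nonneg _ _)
  have hn4 : ∀ h : ℝ, 1 ≤ ‖1 + 4 * g h‖ := fun h => by
    rw [← hd4]
    exact one_le_norm_stepDen (by linarith) (symbolD2_nonneg _ _)
  have hF : N F ≤ c := by
    refine (pairSeminorm_inv_le hη (hn _) (hn _)).trans ?_
    rw [add_sub_cancel_left, add_sub_cancel_left]
    have : pairSeminorm _ hη (g h, g (2 * h)) ≤ 2 * |μ| * √T + 1 := hG2
    rw [hc]
    linarith
  have hE : N E ≤ c := by
    refine (pairSeminorm_inv_le hη (hn4 _) (hn4 _)).trans ?_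
    rw [add_sub_cancel_left, add_sub_cancel_left]
    have h1 : pairSeminorm _ hη (4 * g h, 4 * g (2 * h)) ≤ (4 : ℕ) * (2 * |μ| * √T + 1) :=
      ringSeminorm_natCast_mul_le N 4 hG2
    push_cast at h1
    rw [hc]
    linarith
  have hne : ∀ {x : ℂ}, 1 ≤ ‖x‖ → x⁻¹ * x = 1 := fun {x} hx =>
    inv_mul_cancel₀ (norm_pos_iff.mp (by linarith))
  have hF1 : F * (1 + G) = 1 := by
    ext
    · simp only [hFdef, hGdef, Prod.fst_mul, Prod.fst_add, Prod.fst_one]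
      exact hne (hn _)
    · simp only [hFdef, hGdef, Prod.snd_mul, Prod.snd_add, Prod.snd_one]
      exact hne (hn _)
  have hE1 : E * (1 + 4 * G) = 1 := by
    ext
    · simp only [hEdef, hGdef, Prod.fst_mul, Prod.fst_add, Prod.fst_one, Prod.fst_ofNat]
      exact hne (hn4 _)
    · simp only [hEdef, hGdef, Prod.snd_mul, Prod.snd_add, Prod.snd_one, Prod.snd_ofNat]
      exact hne (hn4 _)
  have hfm : ∀ h, fineMean μ h k ξ = (1 + g h)⁻¹ ^ 4 := fun h => by rw [fineMean, hd]
  have hcm : ∀ h, coarseMean μ h k ξ = (1 + 4 * g h)⁻¹ := fun h => by rw [coarseMean, hd4]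
  have hδc : δ ≤ c := hδT.trans (by rw [hc]; linarith)
  have hGc : N G ≤ c := hG2.trans (by rw [hc]; linarith)
  choose u v h1 h2 using fun b => block_hasSecondOrderExpansion hη σ σ' hS2 b
  have key := fun b => blockFactor_estimates hc1 hδ0 hδc hp0 (h1 b) (one_le_blockWeight b) hS2 hS
    hGc hG hF hE hF1 hE1
  simp only [h2] at key
  have hfw : p * (1 + p) ^ 2 = freqWeight ξ := rfl
  rw [hfw] at key
  have hK : 12 * c ^ 9 ≤ 100 * c ^ 11 := by
    have := pow_le_pow_right₀ hc1 (show 9 ≤ 11 by norm_num)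
    linarith [one_le_pow₀ hc1 (n := 11)]
  have hw := freqWeight_nonneg ξ
  -- The first three estimates do not involve the increments, so any block will do.
  obtain ⟨k1, k2, k3, -⟩ := key 0
  refine ⟨?_, ?_, ?_, fun b => ?_⟩
  · rw [hfm, hfm]
    exact LE.le.trans k1 (by gcongr)
  · rw [hcm, hcm]
    exact LE.le.trans k2 (by gcongr)
  · rw [hfm, hfm, hcm, hcm]
    exact LE.le.trans k3 (by gcongr)
  · obtain ⟨-, -, -, k4, k5, k6⟩ := key b
    simp only [fineFactor, coarseFactor, hfm, hcm]
    exact ⟨k4, k5, k6⟩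

/-! ### Gaussian moments -/

theorem integrable_pow_gaussianReal (n : ℕ) :
    Integrable (fun x : ℝ => x ^ n) (gaussianReal 0 1) := by
  have h := (memLp_id_gaussianReal (μ := 0) (v := 1) n).integrable_norm_pow' 
  refine (integrable_norm_iff (by fun_prop)).mp ?_
  simpa using h

theorem deriv_mul_exp_sq_half {p p' : ℝ → ℝ} (hp : ∀ t, HasDerivAt p (p' t) t) :
    deriv (fun t => p t * Real.exp (t ^ 2 / 2)) =
      fun t => (p' t + t * p t) * Real.exp (t ^ 2 / 2) := by
  funext t
  have h1 : HasDerivAt (fun t : ℝ => t ^ 2 / 2) t t := by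
    have := (hasDerivAt_pow 2 t).div_const 2
    simpa using this
  rw [((hp t).fun_mul h1.exp).deriv]
  ring

theorem integral_sq_gaussianReal : ∫ x, x ^ 2 ∂gaussianReal 0 1 = 1 := by
  have h := variance_eq_integral (μ := gaussianReal 0 1) (X := fun x : ℝ => x) (by fun_prop)
  simp only [variance_fun_id_gaussianReal, integral_id_gaussianReal, sub_zero] at h
  simpa using h.symm

theorem integral_pow_four_gaussianReal : ∫ x, x ^ 4 ∂gaussianReal 0 1 = 3 := by
  have h : iteratedDeriv 4 (mgf (fun x => x) (gaussianReal 0 1)) 0 =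
      ∫ x, x ^ 4 ∂gaussianReal 0 1 := by
    rw [iteratedDeriv_mgf_zero] <;> simp
  rw [← h, mgf_fun_id_gaussianReal]
  have e0 : (fun t : ℝ => Real.exp (0 * t + ((1 : ℝ≥0) : ℝ) * t ^ 2 / 2)) =
      fun t : ℝ => 1 * Real.exp (t ^ 2 / 2) := by
    funext t
    simp
  have e1 := deriv_mul_exp_sq_half (p := fun _ => 1) (p' := fun _ => 0)
    fun t => hasDerivAt_const t 1
  have e2 := deriv_mul_exp_sq_half (p := fun t => 0 + t * 1) (p' := fun _ => 1)
    fun t => by simpa using hasDerivAt_id' t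
  have e3 := deriv_mul_exp_sq_half (p := fun t => 1 + t * (0 + t * 1)) (p' := fun t => 2 * t)
    fun t => by
      have := (hasDerivAt_pow 2 t).const_add 1
      simpa [sq] using this
  have e4 := deriv_mul_exp_sq_half (p := fun t => 2 * t + t * (1 + t * (0 + t * 1)))
    (p' := fun t => 3 + 3 * t ^ 2) fun t => by
      have e : (fun t : ℝ => 2 * t + t * (1 + t * (0 + t * 1))) = fun t => 3 * t + t ^ 3 := by
        funext t
        ring
      rw [e]
      simpa using ((hasDerivAt_id' t).const_mul 3).fun_add (hasDerivAt_pow 3 t)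
  simp only [iteratedDeriv_succ, iteratedDeriv_zero, e0, e1, e2, e3, e4]
  norm_num

/-- Both noise terms are centred, so averaging leaves only the implicit part of a factor. -/
theorem integral_stepNum (σ : ℝ) : ∫ z, stepNum σ z ∂gaussianReal 0 1 = 1 := by
  have e : ∀ z : ℝ, stepNum σ z = ((1 - σ ^ 2 / 2 * (z ^ 2 - 1) : ℝ) : ℂ) -
      Complex.I * σ * (z : ℂ) := fun z => by
    simp only [stepNum]
    push_cast
    ring
  have i1 := integrable_pow_gaussianReal 1
  have i2 := integrable_pow_gaussianReal 2
  simp only [pow_one] at i1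
  have i4 : Integrable (fun z : ℝ => z ^ 2 - 1) (gaussianReal 0 1) := i2.sub (integrable_const _)
  have i3 : Integrable (fun z : ℝ => 1 - σ ^ 2 / 2 * (z ^ 2 - 1)) (gaussianReal 0 1) :=
    (integrable_const _).sub (i4.const_mul _)
  simp only [e]
  rw [integral_sub i3.ofReal (i1.ofReal.const_mul _), integral_const_mul]
  rw [integral_complex_ofReal, integral_complex_ofReal, integral_id_gaussianReal, integral_sub
    (integrable_const _)
    (i4.const_mul _), integral_const_mul,
    integral_sub i2 (integrable_const _), integral_sq_gaussianReal]
  simp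

theorem norm_stepNum_sq (σ z : ℝ) : ‖stepNum σ z‖ ^ 2 =
    (1 + σ ^ 2 + σ ^ 4 / 4) + (-σ ^ 4 / 2) * z ^ 2 + σ ^ 4 / 4 * z ^ 4 := by
  have e : stepNum σ z = ((1 - σ ^ 2 / 2 * (z ^ 2 - 1) : ℝ) : ℂ) +
      ((-(σ * z) : ℝ) : ℂ) * Complex.I := by
    simp only [stepNum]
    push_cast
    ring
  rw [e, ← Complex.normSq_eq_norm_sq, Complex.normSq_add_mul_I]
  ring

theorem measurable_stepNum (σ : ℝ) : Measurable (stepNum σ) := by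
  unfold stepNum
  fun_prop

theorem memLp_stepNum (σ : ℝ) : MemLp (stepNum σ) 2 (gaussianReal 0 1) := by
  rw [memLp_two_iff_integrable_sq_norm (measurable_stepNum σ).aestronglyMeasurable]
  simp only [norm_stepNum_sq]
  exact ((integrable_const _).add ((integrable_pow_gaussianReal 2).const_mul _)).add
    ((integrable_pow_gaussianReal 4).const_mul _)

theorem integral_norm_stepNum_sq (σ : ℝ) :
    ∫ z, ‖stepNum σ z‖ ^ 2 ∂gaussianReal 0 1 = 1 + σ ^ 2 + σ ^ 4 / 2 := by
  have h1 : Integrable (fun z : ℝ => (1 + σ ^ 2 + σ ^ 4 / 4) + (-σ ^ 4 / 2) * z ^ 2)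
      (gaussianReal 0 1) :=
    (integrable_const _).add ((integrable_pow_gaussianReal 2).const_mul _)
  simp only [norm_stepNum_sq]
  rw [integral_add h1 ((integrable_pow_gaussianReal 4).const_mul _), integral_add
    (integrable_const _)
    ((integrable_pow_gaussianReal 2).const_mul _), integral_const_mul, integral_const_mul,
    integral_sq_gaussianReal, integral_pow_four_gaussianReal]
  simp
  ring

/-! ### The law of a block of increments -/

/-- The law of four independent standard normal variables. -/
noncomputable def blockLaw : Measure (Fin 4 → ℝ) := Measure.pi fun _ => gaussianReal 0 1

instance : IsProbabilityMeasure blockLaw := by unfold blockLaw; infer_instance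

theorem map_sum_gaussianReal {Ω ι : Type*} [MeasurableSpace Ω] [DecidableEq ι] {P : Measure Ω}
    {X : ι → Ω → ℝ} (hX : ∀ i, Measurable (X i)) (hi : iIndepFun X P)
    (hl : ∀ i, P.map (X i) = gaussianReal 0 1) (s : Finset ι) (hP : IsProbabilityMeasure P) :
    P.map (∑ i ∈ s, X i) = gaussianReal 0 s.card := by
  induction s using Finset.induction_on with
  | empty =>
    simp only [Finset.sum_empty, Finset.card_empty, Nat.cast_zero, gaussianReal_zero_var]
    have : (0 : Ω → ℝ) = fun _ => 0 := rfl
    rw [this, Measure.map_const]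
    simp
  | insert i s hs ih =>
    rw [Finset.sum_insert hs, add_comm, Finset.card_insert_of_notMem hs]
    have := gaussianReal_add_gaussianReal_of_indepFun
      (hi.indepFun_finsetSum_of_notMem hX hs) ih (hl i)
    rw [this]
    simp

theorem map_half_sum_blockLaw :
    blockLaw.map (fun b => (∑ j, b j) / 2) = gaussianReal 0 1 := by
  have h := map_sum_gaussianReal (P := blockLaw) (X := fun (j : Fin 4) (b : Fin 4 → ℝ) => b j)
    (fun j => measurable_pi_apply j)
    (iIndepFun_pi (μ := fun _ : Fin 4 => gaussianReal 0 1) (X := fun _ x => x)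
      fun _ => aemeasurable_id)
    (fun j => (measurePreserving_eval (fun _ : Fin 4 => gaussianReal 0 1) j).map_eq)
    Finset.univ inferInstance
  have e : (fun b : Fin 4 → ℝ => (∑ j, b j) / 2) = (fun x : ℝ => x / 2) ∘
      (∑ j : Fin 4, fun b : Fin 4 → ℝ => b j) := by
    funext b
    simp
  rw [e, ← Measure.map_map (by fun_prop) (by fun_prop), h, gaussianReal_map_div_const]
  congr 1
  · simp
  · ext
    simp
    norm_num

theorem integral_fineFactor (μ ρ h k ξ : ℝ) :
    ∫ b, fineFactor μ ρ h k ξ b ∂blockLaw = fineMean μ h k ξ := by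
  simp only [fineFactor]
  rw [integral_const_mul, blockLaw, integral_fintype_prod_eq_pow, integral_stepNum]
  simp

theorem integral_coarseFactor (μ ρ h k ξ : ℝ) :
    ∫ b, coarseFactor μ ρ h k ξ b ∂blockLaw = coarseMean μ h k ξ := by
  simp only [coarseFactor]
  rw [integral_const_mul, ← integral_map (φ := fun b : Fin 4 → ℝ => (∑ j, b j) / 2)
    (f := stepNum (2 * (√(ρ * k) * symbolD1 h ξ))) (by fun_prop)
    (measurable_stepNum _).aestronglyMeasurable, map_half_sum_blockLaw, integral_stepNum, mul_one]

theorem measurable_fineFactor (μ ρ h k ξ : ℝ) : Measurable (fineFactor μ ρ h k ξ) := by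
  unfold fineFactor stepNum
  fun_prop

theorem measurable_coarseFactor (μ ρ h k ξ : ℝ) : Measurable (coarseFactor μ ρ h k ξ) := by
  unfold coarseFactor stepNum
  fun_prop

theorem integral_norm_fineFactor_sq (μ ρ h k ξ : ℝ) :
    ∫ b, ‖fineFactor μ ρ h k ξ b‖ ^ 2 ∂blockLaw = ‖fineMean μ h k ξ‖ ^ 2 *
      (1 + (√(ρ * k) * symbolD1 h ξ) ^ 2 + (√(ρ * k) * symbolD1 h ξ) ^ 4 / 2) ^ 4 := by
  simp only [fineFactor, norm_mul, mul_pow, norm_prod, ← Finset.prod_pow]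
  rw [integral_const_mul, blockLaw,
    integral_fintype_prod_eq_pow (fun z => ‖stepNum (√(ρ * k) * symbolD1 h ξ) z‖ ^ 2),
    integral_norm_stepNum_sq]
  simp [mul_pow]

theorem integral_norm_coarseFactor_sq (μ ρ h k ξ : ℝ) :
    ∫ b, ‖coarseFactor μ ρ h k ξ b‖ ^ 2 ∂blockLaw = ‖coarseMean μ h k ξ‖ ^ 2 *
      (1 + (2 * (√(ρ * k) * symbolD1 h ξ)) ^ 2 + (2 * (√(ρ * k) * symbolD1 h ξ)) ^ 4 / 2) := by
  simp only [coarseFactor, norm_mul _ (stepNum _ _), mul_pow _ ‖stepNum _ _‖]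
  rw [integral_const_mul, ← integral_map (φ := fun b : Fin 4 → ℝ => (∑ j, b j) / 2)
    (f := fun z => ‖stepNum (2 * (√(ρ * k) * symbolD1 h ξ)) z‖ ^ 2) (by fun_prop)
    ((measurable_stepNum _).norm.pow_const 2).aestronglyMeasurable, map_half_sum_blockLaw,
    integral_norm_stepNum_sq]

theorem memLp_fineFactor (μ ρ h k ξ : ℝ) : MemLp (fineFactor μ ρ h k ξ) 2 blockLaw := by
  rw [memLp_two_iff_integrable_sq_norm (measurable_fineFactor ..).aestronglyMeasurable]
  simp only [fineFactor, norm_mul, mul_pow, norm_prod, ← Finset.prod_pow]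
  refine Integrable.const_mul ?_ _
  exact Integrable.fintype_prod fun j =>
    (memLp_two_iff_integrable_sq_norm (measurable_stepNum _).aestronglyMeasurable).mp
      (memLp_stepNum _)

theorem memLp_coarseFactor (μ ρ h k ξ : ℝ) : MemLp (coarseFactor μ ρ h k ξ) 2 blockLaw := by
  have h1 := memLp_stepNum (2 * (√(ρ * k) * symbolD1 h ξ))
  rw [← map_half_sum_blockLaw, memLp_map_measure_iff (measurable_stepNum _).aestronglyMeasurable
    (by fun_prop)] at h1
  exact h1.const_mul (coarseMean μ h k ξ)

theorem memLp_blockWeight : MemLp blockWeight 2 blockLaw := by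
  have hm : Measurable blockWeight := by
    unfold blockWeight
    fun_prop
  rw [memLp_two_iff_integrable_sq_norm hm.aestronglyMeasurable]
  simp only [blockWeight, norm_mul, mul_pow, norm_prod, ← Finset.prod_pow]
  refine Integrable.const_mul ?_ _
  refine Integrable.fintype_prod (f := fun _ (z : ℝ) => ‖1 + z ^ 2‖ ^ 2) fun j => ?_
  have e : ∀ z : ℝ, ‖1 + z ^ 2‖ ^ 2 = 1 + 2 * z ^ 2 + z ^ 4 := fun z => by
    rw [Real.norm_eq_abs, sq_abs]
    ring
  simp only [e]
  exact ((integrable_const _).add ((integrable_pow_gaussianReal 2).const_mul _)).add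
    (integrable_pow_gaussianReal 4)

/-! ### Mean square stability of one block -/

/-- The comparison is of 1 + ρx + ρ²x²/2 with (1 + x/2)² = 1 + x + x²/4. The gap is 1 - ρ in the
linear and 1/4 - ρ²/2 in the quadratic term, and positivity of the latter is the condition ρ < 1/√2.
In use, x is k times the diffusion symbol and y the noise variance of a step. -/
theorem ratio_le {ρ x y d : ℝ} (hρ : 0 < ρ) (hρ2 : ρ ^ 2 < 1 / 2) (hx : 0 ≤ x) (hy0 : 0 ≤ y)
    (hy : y ≤ ρ * x) (hd : 1 + x / 2 ≤ d) :
    (1 + y + y ^ 2 / 2) / d ^ 2 ≤ 1 - min (1 - ρ) (1 / 4 - ρ ^ 2 / 2) * (x / (1 + x)) := by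
  set c := min (1 - ρ) (1 / 4 - ρ ^ 2 / 2) with hc
  have h1 : c ≤ 1 - ρ := min_le_left _ _
  have h2 : c ≤ 1 / 4 - ρ ^ 2 / 2 := min_le_right _ _
  have hc0 : 0 ≤ c := le_min (by nlinarith) (by linarith)
  have hn : 1 + y + y ^ 2 / 2 ≤ 1 + ρ * x + ρ ^ 2 * x ^ 2 / 2 := by
    have : y ^ 2 ≤ (ρ * x) ^ 2 := by gcongr
    nlinarith
  have hd2 : (1 + x / 2) ^ 2 ≤ d ^ 2 := by gcongr
  have hpos : 0 < (1 + x / 2) ^ 2 := by positivity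
  calc (1 + y + y ^ 2 / 2) / d ^ 2
      ≤ (1 + ρ * x + ρ ^ 2 * x ^ 2 / 2) / (1 + x / 2) ^ 2 := by gcongr
    _ ≤ 1 - c * (x / (1 + x)) := by
        rw [div_le_iff₀ hpos]
        have h3 : c * (x / (1 + x)) * (1 + x / 2) ^ 2 ≤ c * (x + x ^ 2) := by
          have : x / (1 + x) * (1 + x / 2) ^ 2 ≤ x + x ^ 2 := by
            rw [div_mul_eq_mul_div, div_le_iff₀ (by linarith)]
            have : (1 + x / 2) ^ 2 ≤ (1 + x) ^ 2 := by gcongr; linarith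
            nlinarith
          nlinarith
        nlinarith [mul_nonneg hx (sub_nonneg.mpr h1), mul_nonneg (sq_nonneg x) (sub_nonneg.mpr h2)]

/-- The rate of mean square contraction. -/
noncomputable def contractionRate (ρ : ℝ) : ℝ := min (1 - ρ) (1 / 4 - ρ ^ 2 / 2)

theorem contractionRate_pos {ρ : ℝ} (hρ : 0 < ρ) (hρ2 : ρ ^ 2 < 1 / 2) :
    0 < contractionRate ρ := lt_min (by nlinarith) (by linarith)

theorem contractionRate_le (ρ : ℝ) : contractionRate ρ ≤ 1 / 4 :=
  (min_le_right _ _).trans (by nlinarith [sq_nonneg ρ])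

theorem le_norm_stepDen (μ k s a : ℝ) : 1 + k * a / 2 ≤ ‖stepDen μ k s a‖ := by
  rw [← stepDen_re (μ := μ) (s := s)]
  exact Complex.re_le_norm _

theorem noise_sq_le {ρ h k : ℝ} (hρ : 0 < ρ) (hh : 0 < h) (hk : 0 < k) (ξ : ℝ) :
    (√(ρ * k) * symbolD1 h ξ) ^ 2 ≤ ρ * (k * symbolD2 h ξ) := by
  rw [mul_pow, Real.sq_sqrt (by positivity), mul_assoc]
  have := symbolD1_sq_le hh ξ
  gcongr

theorem integral_norm_fineFactor_sq_le (μ : ℝ) {ρ h k : ℝ} (hρ : 0 < ρ) (hρ2 : ρ ^ 2 < 1 / 2)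
    (hh : 0 < h) (hk : 0 < k) (ξ : ℝ) : ∫ b, ‖fineFactor μ ρ h k ξ b‖ ^ 2 ∂blockLaw ≤
      (1 - contractionRate ρ * (k * symbolD2 h ξ / (1 + k * symbolD2 h ξ))) ^ 4 := by
  have ha := symbolD2_nonneg h ξ
  have h1 := ratio_le hρ hρ2 (mul_nonneg hk.le ha) (sq_nonneg _) (noise_sq_le hρ hh hk ξ)
    (le_norm_stepDen μ k (symbolD1 h ξ) (symbolD2 h ξ))
  rw [integral_norm_fineFactor_sq, fineMean]
  refine le_trans (le_of_eq ?_) (pow_le_pow_left₀ (by positivity) h1 4)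
  rw [norm_pow, norm_inv]
  ring

theorem integral_norm_coarseFactor_sq_le (μ : ℝ) {ρ h k : ℝ} (hρ : 0 < ρ) (hρ2 : ρ ^ 2 < 1 / 2)
    (hh : 0 < h) (hk : 0 < k) (ξ : ℝ) : ∫ b, ‖coarseFactor μ ρ h k ξ b‖ ^ 2 ∂blockLaw ≤
      1 - contractionRate ρ * (4 * k * symbolD2 h ξ / (1 + 4 * k * symbolD2 h ξ)) := by
  have ha := symbolD2_nonneg h ξ
  have h0 : (2 * (√(ρ * k) * symbolD1 h ξ)) ^ 2 ≤ ρ * (4 * k * symbolD2 h ξ) := by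
    have := noise_sq_le hρ hh hk ξ
    rw [mul_pow]
    linarith
  have h1 := ratio_le hρ hρ2 (mul_nonneg (by linarith) ha) (sq_nonneg _) h0
    (le_norm_stepDen μ (4 * k) (symbolD1 h ξ) (symbolD2 h ξ))
  rw [integral_norm_coarseFactor_sq, coarseMean]
  refine le_trans (le_of_eq ?_) h1
  rw [norm_inv]
  ring

theorem one_sub_contraction_nonneg (ρ : ℝ) {x : ℝ} (hx : 0 ≤ x) :
    0 ≤ 1 - contractionRate ρ * (x / (1 + x)) := by
  have h1 : x / (1 + x) ≤ 1 := (div_le_one (by linarith)).mpr (by linarith)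
  have h2 : 0 ≤ x / (1 + x) := by positivity
  nlinarith [contractionRate_le ρ]

/-- With a the diffusion symbol, kξ² ≤ 1 gives 1 + 4ka ≤ 5, and on the resolved band a ≥ 4ξ²/π².
This yields the rate 4·(4/π²)/5. The fine estimate is weakened to the same rate so that both factors
share one bound. -/
theorem integral_norm_factor_sq_le_exp (μ : ℝ) {ρ h k ξ : ℝ} (hρ : 0 < ρ) (hρ2 : ρ ^ 2 < 1 / 2)
    (hh : 0 < h) (hk : 0 < k) (hξ : |h * ξ| ≤ Real.pi) (hkξ : k * ξ ^ 2 ≤ 1) :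
    ∫ b, ‖fineFactor μ ρ h k ξ b‖ ^ 2 ∂blockLaw ≤
      Real.exp (-(contractionRate ρ * (16 / (5 * Real.pi ^ 2)) * (k * ξ ^ 2))) ∧
    ∫ b, ‖coarseFactor μ ρ h k ξ b‖ ^ 2 ∂blockLaw ≤
      Real.exp (-(contractionRate ρ * (16 / (5 * Real.pi ^ 2)) * (k * ξ ^ 2))) := by
  have hc := contractionRate_pos hρ hρ2
  have ha := symbolD2_nonneg h ξ
  have ha1 : k * symbolD2 h ξ ≤ 1 :=
    (mul_le_mul_of_nonneg_left (symbolD2_le hh ξ) hk.le).trans hkξ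
  have ha2 : k * (4 / Real.pi ^ 2 * ξ ^ 2) ≤ k * symbolD2 h ξ :=
    mul_le_mul_of_nonneg_left (le_symbolD2 hh hξ) hk.le
  have hx0 : 0 ≤ k * symbolD2 h ξ := by positivity
  have hexp : contractionRate ρ * (16 / (5 * Real.pi ^ 2)) * (k * ξ ^ 2) ≤
      contractionRate ρ * (4 * (k * symbolD2 h ξ) / 5) := by
    rw [mul_assoc]
    gcongr
    calc 16 / (5 * Real.pi ^ 2) * (k * ξ ^ 2) = 4 * (k * (4 / Real.pi ^ 2 * ξ ^ 2)) / 5 := by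
          field_simp
          ring
      _ ≤ _ := by gcongr
  constructor
  · refine (integral_norm_fineFactor_sq_le μ hρ hρ2 hh hk ξ).trans ?_
    have h1 : 1 - contractionRate ρ * (k * symbolD2 h ξ / (1 + k * symbolD2 h ξ)) ≤
        Real.exp (-(contractionRate ρ * (k * symbolD2 h ξ / 5))) := by
      have : k * symbolD2 h ξ / 5 ≤ k * symbolD2 h ξ / (1 + k * symbolD2 h ξ) :=
        div_le_div_of_nonneg_left hx0 (by linarith) (by linarith)
      have h3 := mul_le_mul_of_nonneg_left this hc.le
      have h4 := Real.add_one_le_exp (-(contractionRate ρ * (k * symbolD2 h ξ / 5)))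
      linarith
    refine (pow_le_pow_left₀ (one_sub_contraction_nonneg ρ hx0) h1 4).trans ?_
    rw [← Real.exp_nat_mul, Real.exp_le_exp]
    push_cast
    linarith
  · refine (integral_norm_coarseFactor_sq_le μ hρ hρ2 hh hk ξ).trans ?_
    have : 4 * k * symbolD2 h ξ / 5 ≤ 4 * k * symbolD2 h ξ / (1 + 4 * k * symbolD2 h ξ) :=
      div_le_div_of_nonneg_left (by positivity) (by linarith) (by linarith)
    have h3 := mul_le_mul_of_nonneg_left this hc.le
    have h4 := Real.add_one_le_exp (-(contractionRate ρ * (16 / (5 * Real.pi ^ 2)) * (k * ξ ^ 2)))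
    linarith

/-- Here ka ≥ 4/π² ≥ 1/4, and x/(1 + x) ≥ 1/5 for x ≥ 1/4. The contraction is uniform in h, k and ξ.
-/
theorem integral_norm_factor_sq_le_const (μ : ℝ) {ρ h k ξ : ℝ} (hρ : 0 < ρ) (hρ2 : ρ ^ 2 < 1 / 2)
    (hh : 0 < h) (hk : 0 < k) (hξ : |h * ξ| ≤ Real.pi) (hkξ : 1 ≤ k * ξ ^ 2) :
    ∫ b, ‖fineFactor μ ρ h k ξ b‖ ^ 2 ∂blockLaw ≤ 1 - contractionRate ρ * (1 / 5) ∧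
    ∫ b, ‖coarseFactor μ ρ h k ξ b‖ ^ 2 ∂blockLaw ≤ 1 - contractionRate ρ * (1 / 5) := by
  have hc := contractionRate_pos hρ hρ2
  have ha := symbolD2_nonneg h ξ
  have ha2 : k * (4 / Real.pi ^ 2 * ξ ^ 2) ≤ k * symbolD2 h ξ :=
    mul_le_mul_of_nonneg_left (le_symbolD2 hh hξ) hk.le
  have hx : 1 / 4 ≤ k * symbolD2 h ξ := by
    have h1 : 4 / Real.pi ^ 2 ≤ k * (4 / Real.pi ^ 2 * ξ ^ 2) := by
      rw [show k * (4 / Real.pi ^ 2 * ξ ^ 2) = 4 / Real.pi ^ 2 * (k * ξ ^ 2) by ring]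
      exact le_mul_of_one_le_right (by positivity) hkξ
    have h2 : 1 / 4 ≤ 4 / Real.pi ^ 2 := by
      rw [div_le_div_iff₀ (by norm_num) (by positivity)]
      nlinarith [Real.pi_lt_four, Real.pi_pos]
    linarith
  have hfrac : ∀ x : ℝ, 1 / 4 ≤ x → 1 / 5 ≤ x / (1 + x) := fun x hx => by
    rw [div_le_div_iff₀ (by norm_num) (by linarith)]
    linarith
  constructor
  · refine (integral_norm_fineFactor_sq_le μ hρ hρ2 hh hk ξ).trans ?_
    have h0 := one_sub_contraction_nonneg ρ (x := k * symbolD2 h ξ) (by linarith)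
    have h1 := mul_le_mul_of_nonneg_left (hfrac _ hx) hc.le
    refine (pow_le_of_le_one h0 ?_ (by norm_num)).trans (by linarith)
    linarith
  · refine (integral_norm_coarseFactor_sq_le μ hρ hρ2 hh hk ξ).trans ?_
    have h1 := mul_le_mul_of_nonneg_left (hfrac (4 * k * symbolD2 h ξ) (by linarith)) hc.le
    linarith

/-! ### Second moments of perturbed random recursions -/

section Step

variable {Ω : Type*} [MeasurableSpace Ω] {P : Measure Ω}

theorem MemLp.mul_of_indepFun {a s : Ω → ℂ} (h : IndepFun a s P) (ha : MemLp a 2 P)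
    (hs : MemLp s 2 P) : MemLp (fun ω => a ω * s ω) 2 P ∧
      ∫ ω, ‖a ω * s ω‖ ^ 2 ∂P = (∫ ω, ‖a ω‖ ^ 2 ∂P) * ∫ ω, ‖s ω‖ ^ 2 ∂P := by
  have h1 : IndepFun (fun ω => ‖a ω‖ ^ 2) (fun ω => ‖s ω‖ ^ 2) P :=
    h.comp (φ := fun x : ℂ => ‖x‖ ^ 2) (ψ := fun x : ℂ => ‖x‖ ^ 2) (by fun_prop) (by fun_prop)
  have ia := (memLp_two_iff_integrable_sq_norm ha.1).mp ha
  have is := (memLp_two_iff_integrable_sq_norm hs.1).mp hs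
  constructor
  · have hm : AEStronglyMeasurable (fun ω => a ω * s ω) P := ha.1.mul hs.1
    rw [memLp_two_iff_integrable_sq_norm hm]
    have := h1.integrable_mul ia is
    refine this.congr (Filter.Eventually.of_forall fun ω => ?_)
    simp [mul_pow]
  · simp only [norm_mul, mul_pow]
    exact h1.integral_fun_mul_eq_mul_integral ia.1 is.1

theorem norm_integral_conj_mul_le {s t : Ω → ℂ} (hs : MemLp s 2 P) (ht : MemLp t 2 P) {β : ℝ}
    (hβ : 0 ≤ β) : 2 * β * ‖∫ ω, star (s ω) * t ω ∂P‖ ≤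
      ∫ ω, ‖s ω‖ ^ 2 ∂P + β ^ 2 * ∫ ω, ‖t ω‖ ^ 2 ∂P := by
  have is := (memLp_two_iff_integrable_sq_norm hs.1).mp hs
  have it := (memLp_two_iff_integrable_sq_norm ht.1).mp ht
  rw [← integral_const_mul, ← integral_add is (it.const_mul _)]
  refine (mul_le_mul_of_nonneg_left (norm_integral_le_integral_norm _) (by positivity)).trans ?_
  rw [← integral_const_mul]
  refine integral_mono_of_nonneg (Filter.Eventually.of_forall fun ω => by positivity)
    (is.add (it.const_mul _)) (Filter.Eventually.of_forall fun ω => ?_)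
  simp only [norm_mul, norm_star]
  nlinarith [sq_nonneg (‖s ω‖ - β * ‖t ω‖)]

theorem norm_add_sq_eq (x y : ℂ) : ‖x + y‖ ^ 2 = ‖x‖ ^ 2 + 2 * (star x * y).re + ‖y‖ ^ 2 := by
  have := norm_add_sq_real x y
  rw [this, Complex.inner, mul_comm y]
  rfl

variable {ι : Type*} [Fintype ι]

/-- Independence splits each cross term into E[ā b]·E[s̄ t]. The first factor is at most kβ, and
Young's inequality 2β|E[s̄ t]| ≤ E|s|² + β²E|t|² leaves one power of k in front of everything. Cross
terms and sources thus both cost O(k) per step, which is summable over T/k steps. -/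
theorem second_moment_step {a s : Ω → ℂ} {b t : ι → Ω → ℂ} {k r : ℝ} {β : ι → ℝ}
    (hi : IndepFun (fun ω => (a ω, fun i => b i ω)) (fun ω => (s ω, fun i => t i ω)) P)
    (ha : MemLp a 2 P) (hb : ∀ i, MemLp (b i) 2 P) (hs : MemLp s 2 P) (ht : ∀ i, MemLp (t i) 2 P)
    (hk : 0 ≤ k) (hβ : ∀ i, 0 ≤ β i) (har : ∫ ω, ‖a ω‖ ^ 2 ∂P ≤ r)
    (hab : ∀ i, ‖∫ ω, star (a ω) * b i ω ∂P‖ ≤ k * β i)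
    (hbb : ∀ i, ∫ ω, ‖b i ω‖ ^ 2 ∂P ≤ k * β i ^ 2) :
    MemLp (fun ω => a ω * s ω + ∑ i, b i ω * t i ω) 2 P ∧
    ∫ ω, ‖a ω * s ω + ∑ i, b i ω * t i ω‖ ^ 2 ∂P ≤
      (r + Fintype.card ι * k) * ∫ ω, ‖s ω‖ ^ 2 ∂P +
        (1 + Fintype.card ι) * k * ∑ i, β i ^ 2 * ∫ ω, ‖t i ω‖ ^ 2 ∂P := by
  have i1 : IndepFun a s P := hi.comp measurable_fst measurable_fst
  have i2 : ∀ i, IndepFun (b i) (t i) P := fun i =>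
    hi.comp ((measurable_pi_apply i).comp measurable_snd)
      ((measurable_pi_apply i).comp measurable_snd)
  have i3 : ∀ i, IndepFun (fun ω => star (a ω) * b i ω) (fun ω => star (s ω) * t i ω) P := fun i =>
    hi.comp (φ := fun x : ℂ × (ι → ℂ) => star x.1 * x.2 i)
      (ψ := fun x : ℂ × (ι → ℂ) => star x.1 * x.2 i)
      ((continuous_star.measurable.comp measurable_fst).mul ((measurable_pi_apply i).comp
        measurable_snd))
      ((continuous_star.measurable.comp measurable_fst).mul ((measurable_pi_apply i).comp
        measurable_snd))
  obtain ⟨m1, e1⟩ := MemLp.mul_of_indepFun i1 ha hs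
  have m2 : ∀ i, MemLp (fun ω => b i ω * t i ω) 2 P := fun i =>
    (MemLp.mul_of_indepFun (i2 i) (hb i) (ht i)).1
  have e2 : ∀ i, ∫ ω, ‖b i ω * t i ω‖ ^ 2 ∂P = (∫ ω, ‖b i ω‖ ^ 2 ∂P) * ∫ ω, ‖t i ω‖ ^ 2 ∂P :=
    fun i => (MemLp.mul_of_indepFun (i2 i) (hb i) (ht i)).2
  have mR : MemLp (fun ω => ∑ i, b i ω * t i ω) 2 P := memLp_finsetSum _ fun i _ => m2 i
  have mT := m1.add mR
  refine ⟨mT, ?_⟩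
  have q1 := (memLp_two_iff_integrable_sq_norm m1.1).mp m1
  have qR := (memLp_two_iff_integrable_sq_norm mR.1).mp mR
  have q2 : ∀ i, Integrable (fun ω => ‖b i ω * t i ω‖ ^ 2) P := fun i =>
    (memLp_two_iff_integrable_sq_norm (m2 i).1).mp (m2 i)
  have c1 : ∀ i, Integrable (fun ω => star (a ω) * b i ω) P := fun i =>
    ha.star.integrable_mul (hb i)
  have c2 : ∀ i, Integrable (fun ω => star (s ω) * t i ω) P := fun i =>
    hs.star.integrable_mul (ht i)
  have c3 : ∀ i, Integrable (fun ω => (star (a ω) * b i ω) * (star (s ω) * t i ω)) P := fun i =>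
    (i3 i).integrable_mul (c1 i) (c2 i)
  have eC : ∀ ω, star (a ω * s ω) * ∑ i, b i ω * t i ω =
      ∑ i, (star (a ω) * b i ω) * (star (s ω) * t i ω) := fun ω => by
    rw [Finset.mul_sum]
    refine Finset.sum_congr rfl fun i _ => ?_
    rw [star_mul']
    ring
  have iC : Integrable (fun ω => star (a ω * s ω) * ∑ i, b i ω * t i ω) P := by
    simp only [eC]
    exact integrable_finsetSum _ fun i _ => c3 i
  have hC : (∫ ω, star (a ω * s ω) * ∑ i, b i ω * t i ω ∂P) =
      ∑ i, (∫ ω, star (a ω) * b i ω ∂P) * ∫ ω, star (s ω) * t i ω ∂P := by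
    simp only [eC]
    rw [integral_finsetSum _ fun i _ => c3 i]
    exact Finset.sum_congr rfl fun i _ =>
      (i3 i).integral_fun_mul_eq_mul_integral (c1 i).1 (c2 i).1
  have hRe : ∫ ω, (star (a ω * s ω) * ∑ i, b i ω * t i ω).re ∂P =
      (∫ ω, star (a ω * s ω) * ∑ i, b i ω * t i ω ∂P).re := integral_re iC
  have hsplit : ∫ ω, ‖a ω * s ω + ∑ i, b i ω * t i ω‖ ^ 2 ∂P =
      (∫ ω, ‖a ω‖ ^ 2 ∂P) * (∫ ω, ‖s ω‖ ^ 2 ∂P) +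
        2 * (∑ i, (∫ ω, star (a ω) * b i ω ∂P) * ∫ ω, star (s ω) * t i ω ∂P).re +
        ∫ ω, ‖∑ i, b i ω * t i ω‖ ^ 2 ∂P := by
    simp only [norm_add_sq_eq]
    have j1 : Integrable (fun ω => 2 * (star (a ω * s ω) * ∑ i, b i ω * t i ω).re) P :=
      (iC.re).const_mul 2
    have j2 : Integrable (fun ω => ‖a ω * s ω‖ ^ 2 +
        2 * (star (a ω * s ω) * ∑ i, b i ω * t i ω).re) P := q1.add j1
    rw [integral_add j2 qR, integral_add q1 j1, integral_const_mul, hRe, hC, e1]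
  have hcross : 2 * (∑ i, (∫ ω, star (a ω) * b i ω ∂P) * ∫ ω, star (s ω) * t i ω ∂P).re ≤
      Fintype.card ι * k * ∫ ω, ‖s ω‖ ^ 2 ∂P + k * ∑ i, β i ^ 2 * ∫ ω, ‖t i ω‖ ^ 2 ∂P := by
    calc 2 * (∑ i, (∫ ω, star (a ω) * b i ω ∂P) * ∫ ω, star (s ω) * t i ω ∂P).re
        ≤ 2 * ∑ i, k * β i * ‖∫ ω, star (s ω) * t i ω ∂P‖ := by
          gcongr
          refine (Complex.re_le_norm _).trans ((norm_sum_le _ _).trans ?_)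
          refine Finset.sum_le_sum fun i _ => ?_
          rw [norm_mul]
          exact mul_le_mul_of_nonneg_right (hab i) (norm_nonneg _)
      _ = ∑ i, k * (2 * β i * ‖∫ ω, star (s ω) * t i ω ∂P‖) := by
          rw [Finset.mul_sum]
          exact Finset.sum_congr rfl fun i _ => by ring
      _ ≤ ∑ i, k * (∫ ω, ‖s ω‖ ^ 2 ∂P + β i ^ 2 * ∫ ω, ‖t i ω‖ ^ 2 ∂P) := by
          refine Finset.sum_le_sum fun i _ => ?_
          exact mul_le_mul_of_nonneg_left (norm_integral_conj_mul_le hs (ht i) (hβ i)) hk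
      _ = _ := by
          simp only [mul_add, Finset.sum_add_distrib, Finset.sum_const, Finset.card_univ,
            nsmul_eq_mul, Finset.mul_sum]
          ring
  have hR : ∫ ω, ‖∑ i, b i ω * t i ω‖ ^ 2 ∂P ≤
      Fintype.card ι * (k * ∑ i, β i ^ 2 * ∫ ω, ‖t i ω‖ ^ 2 ∂P) := by
    calc ∫ ω, ‖∑ i, b i ω * t i ω‖ ^ 2 ∂P
        ≤ ∫ ω, Fintype.card ι * ∑ i, ‖b i ω * t i ω‖ ^ 2 ∂P := by
          refine integral_mono qR
            ((integrable_finsetSum _ fun i _ => q2 i).const_mul _) fun ω => ?_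
          have h1 : ‖∑ i, b i ω * t i ω‖ ^ 2 ≤ (∑ i, ‖b i ω * t i ω‖) ^ 2 := by
            gcongr
            exact norm_sum_le _ _
          refine h1.trans ?_
          simpa using sq_sum_le_card_mul_sum_sq (s := Finset.univ)
            (f := fun i => ‖b i ω * t i ω‖)
      _ = Fintype.card ι * ∑ i, (∫ ω, ‖b i ω‖ ^ 2 ∂P) * ∫ ω, ‖t i ω‖ ^ 2 ∂P := by
          rw [integral_const_mul, integral_finsetSum _ fun i _ => q2 i]
          simp only [e2]
      _ ≤ Fintype.card ι * ∑ i, (k * β i ^ 2) * ∫ ω, ‖t i ω‖ ^ 2 ∂P := by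
          gcongr with i
          exact hbb i
      _ = _ := by
          rw [Finset.mul_sum (a := k)]
          simp only [mul_assoc]
  have hA : (∫ ω, ‖a ω‖ ^ 2 ∂P) * (∫ ω, ‖s ω‖ ^ 2 ∂P) ≤ r * ∫ ω, ‖s ω‖ ^ 2 ∂P := by
    gcongr
  rw [hsplit]
  calc _ ≤ r * (∫ ω, ‖s ω‖ ^ 2 ∂P) + (Fintype.card ι * k * ∫ ω, ‖s ω‖ ^ 2 ∂P +
        k * ∑ i, β i ^ 2 * ∫ ω, ‖t i ω‖ ^ 2 ∂P) +
        Fintype.card ι * (k * ∑ i, β i ^ 2 * ∫ ω, ‖t i ω‖ ^ 2 ∂P) :=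
      add_le_add (add_le_add hA hcross) hR
    _ = _ := by ring

end Step

/-! ### Blocks of independent increments -/

/-- The law of a sequence of independent standard normal variables. -/
noncomputable def noiseLaw : Measure (ℕ → ℝ) := Measure.infinitePi fun _ => gaussianReal 0 1

instance : IsProbabilityMeasure noiseLaw := by unfold noiseLaw; infer_instance

/-- The `m`-th block of four increments. -/
def block (m : ℕ) (z : ℕ → ℝ) : Fin 4 → ℝ := fun j => z (4 * m + j)

theorem measurable_block (m : ℕ) : Measurable (block m) := by
  unfold block
  fun_prop

/-- `Φ` is a measurable function of the first `m` blocks. -/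
def IsBlockAdapted {σ : Type*} [MeasurableSpace σ] (m : ℕ) (Φ : (ℕ → ℝ) → σ) : Prop :=
  Measurable Φ ∧ ∀ z z' : ℕ → ℝ, (∀ n < 4 * m, z n = z' n) → Φ z = Φ z'

theorem iIndepFun_noise : iIndepFun (fun (n : ℕ) (z : ℕ → ℝ) => z n) noiseLaw :=
  iIndepFun_infinitePi (P := fun _ : ℕ => gaussianReal 0 1) (X := fun _ x => x)
    fun _ => measurable_id

theorem map_block (m : ℕ) : noiseLaw.map (block m) = blockLaw := by
  have h := (iIndepFun_noise.precomp (g := fun j : Fin 4 => 4 * m + (j : ℕ))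
    fun i j hij => by ext; simpa using hij).map_fun_eq_pi_map
    fun j => (measurable_pi_apply _).aemeasurable
  refine h.trans ?_
  rw [blockLaw]
  congr 1
  funext j
  exact Measure.infinitePi_map_eval (fun _ : ℕ => gaussianReal 0 1) _

/-- Adaptedness allows Φ to be evaluated on the first 4m coordinates extended by zero. It is then a
function of a finite family disjoint from the m-th block. -/
theorem IsBlockAdapted.indepFun {σ : Type*} [MeasurableSpace σ] {m : ℕ} {Φ : (ℕ → ℝ) → σ}
    (h : IsBlockAdapted m Φ) : IndepFun (block m) Φ noiseLaw := by
  classical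
  have h1 := iIndepFun_noise.indepFun_finset (Finset.Ico (4 * m) (4 * m + 4))
    (Finset.range (4 * m)) (by
      rw [Finset.disjoint_left]
      intro a ha hb
      simp only [Finset.mem_Ico, Finset.mem_range] at ha hb
      omega) fun n => measurable_pi_apply n
  have e1 : block m = (fun (w : Finset.Ico (4 * m) (4 * m + 4) → ℝ) (j : Fin 4) =>
      w ⟨4 * m + j, by simp⟩) ∘
      (fun (z : ℕ → ℝ) (i : Finset.Ico (4 * m) (4 * m + 4)) => z i) := rfl
  have e2 : Φ = (fun w : Finset.range (4 * m) → ℝ =>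
      Φ fun n => if hn : n ∈ Finset.range (4 * m) then w ⟨n, hn⟩ else 0) ∘
      (fun (z : ℕ → ℝ) (i : Finset.range (4 * m)) => z i) := by
    funext z
    refine h.2 _ _ fun n hn => ?_
    simp [hn]
  rw [e1, e2]
  refine h1.comp (by fun_prop) (h.1.comp ?_)
  refine measurable_pi_lambda _ fun n => ?_
  by_cases hn : n ∈ Finset.range (4 * m)
  · simp only [hn, dif_pos]
    exact measurable_pi_apply _
  · simp only [hn, dif_neg, not_false_eq_true]
    exact measurable_const

theorem memLp_comp_block {A : (Fin 4 → ℝ) → ℂ} (hA : MemLp A 2 blockLaw) (m : ℕ) :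
    MemLp (fun z => A (block m z)) 2 noiseLaw := by
  rw [← map_block m] at hA
  exact (memLp_map_measure_iff hA.1 (measurable_block m).aemeasurable).mp hA

theorem integral_comp_block {E : Type*} [NormedAddCommGroup E] [NormedSpace ℝ E]
    {A : (Fin 4 → ℝ) → E} (hA : AEStronglyMeasurable A blockLaw) (m : ℕ) :
    ∫ z, A (block m z) ∂noiseLaw = ∫ b, A b ∂blockLaw := by
  rw [← map_block m] at hA ⊢
  rw [integral_map (measurable_block m).aemeasurable hA]

theorem block_second_moment_step {ι : Type*} [Fintype ι] {A : (Fin 4 → ℝ) → ℂ}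
    {B : ι → (Fin 4 → ℝ) → ℂ} {m : ℕ} {s : (ℕ → ℝ) → ℂ} {t : ι → (ℕ → ℝ) → ℂ} {k r : ℝ} {β : ι → ℝ}
    (hA : Measurable A) (hB : ∀ i, Measurable (B i)) (hA2 : MemLp A 2 blockLaw)
    (hB2 : ∀ i, MemLp (B i) 2 blockLaw) (hs : IsBlockAdapted m s)
    (ht : ∀ i, IsBlockAdapted m (t i)) (hs2 : MemLp s 2 noiseLaw)
    (ht2 : ∀ i, MemLp (t i) 2 noiseLaw) (hk : 0 ≤ k) (hβ : ∀ i, 0 ≤ β i)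
    (har : ∫ b, ‖A b‖ ^ 2 ∂blockLaw ≤ r) (hab : ∀ i, ‖∫ b, star (A b) * B i b ∂blockLaw‖ ≤ k * β i)
    (hbb : ∀ i, ∫ b, ‖B i b‖ ^ 2 ∂blockLaw ≤ k * β i ^ 2) :
    MemLp (fun z => A (block m z) * s z + ∑ i, B i (block m z) * t i z) 2 noiseLaw ∧
    ∫ z, ‖A (block m z) * s z + ∑ i, B i (block m z) * t i z‖ ^ 2 ∂noiseLaw ≤
      (r + Fintype.card ι * k) * ∫ z, ‖s z‖ ^ 2 ∂noiseLaw +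
        (1 + Fintype.card ι) * k * ∑ i, β i ^ 2 * ∫ z, ‖t i z‖ ^ 2 ∂noiseLaw := by
  have had : IsBlockAdapted m (fun z => (s z, fun i => t i z)) :=
    ⟨hs.1.prodMk (measurable_pi_lambda _ fun i => (ht i).1), fun z z' h =>
      Prod.ext (hs.2 z z' h) (funext fun i => (ht i).2 z z' h)⟩
  have hind := had.indepFun.comp (φ := fun b => (A b, fun i => B i b)) (ψ := id)
    (hA.prodMk (measurable_pi_lambda _ hB)) measurable_id
  refine second_moment_step (a := fun z => A (block m z)) (b := fun i z => B i (block m z)) hind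
    (memLp_comp_block hA2 m) (fun i => memLp_comp_block (hB2 i) m) hs2 ht2 hk hβ ?_ ?_ ?_
  · rwa [integral_comp_block (A := fun b => ‖A b‖ ^ 2)
      (hA.norm.pow_const 2).aestronglyMeasurable m]
  · intro i
    rw [integral_comp_block (A := fun b => star (A b) * B i b)
      ((continuous_star.measurable.comp hA).mul (hB i)).aestronglyMeasurable m]
    exact hab i
  · intro i
    rw [integral_comp_block (A := fun b => ‖B i b‖ ^ 2)
      ((hB i).norm.pow_const 2).aestronglyMeasurable m]
    exact hbb i

/-- Growth of a recursion started at zero and driven by sources of size `G qᵐ`. -/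
theorem block_recursion_bound {ι : Type*} [Fintype ι] {A : (Fin 4 → ℝ) → ℂ}
    {B : ι → (Fin 4 → ℝ) → ℂ} {S : ℕ → (ℕ → ℝ) → ℂ} {t : ι → ℕ → (ℕ → ℝ) → ℂ} {k r q G : ℝ}
    {β : ι → ℝ} (hA : Measurable A) (hB : ∀ i, Measurable (B i)) (hA2 : MemLp A 2 blockLaw)
    (hB2 : ∀ i, MemLp (B i) 2 blockLaw) (hs : ∀ m, IsBlockAdapted m (S m))
    (ht : ∀ i m, IsBlockAdapted m (t i m)) (ht2 : ∀ i m, MemLp (t i m) 2 noiseLaw) (hk : 0 ≤ k)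
    (hβ : ∀ i, 0 ≤ β i) (har : ∫ b, ‖A b‖ ^ 2 ∂blockLaw ≤ r)
    (hab : ∀ i, ‖∫ b, star (A b) * B i b ∂blockLaw‖ ≤ k * β i)
    (hbb : ∀ i, ∫ b, ‖B i b‖ ^ 2 ∂blockLaw ≤ k * β i ^ 2) (h0 : ∀ z, S 0 z = 0)
    (hstep : ∀ m z, S (m + 1) z = A (block m z) * S m z + ∑ i, B i (block m z) * t i m z)
    (hrq : r + Fintype.card ι * k ≤ q) (hq : 1 ≤ 3 * q) (hG : 0 ≤ G)
    {N : ℕ} (htG : ∀ m < N, ∑ i, β i ^ 2 * ∫ z, ‖t i m z‖ ^ 2 ∂noiseLaw ≤ G * q ^ m) {m : ℕ}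
    (hm : m ≤ N) :
    MemLp (S m) 2 noiseLaw ∧
      ∫ z, ‖S m z‖ ^ 2 ∂noiseLaw ≤ m * k * (3 * (1 + Fintype.card ι) * G) * q ^ m := by
  have hq0 : 0 < q := by linarith
  induction m with
  | zero =>
    have e : S 0 = fun _ => 0 := funext h0
    rw [e]
    exact ⟨MemLp.zero', by simp⟩
  | succ m ih =>
    obtain ⟨ih1, ih2⟩ := ih (by omega)
    have h := block_second_moment_step (k := k) (r := r) (β := β) hA hB hA2 hB2 (hs m)
      (fun i => ht i m) ih1 (fun i => ht2 i m) hk hβ har hab hbb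
    have e : S (m + 1) = fun z => A (block m z) * S m z + ∑ i, B i (block m z) * t i m z :=
      funext (hstep m)
    rw [e]
    refine ⟨h.1, h.2.trans ?_⟩
    have hqm : 0 ≤ q ^ m := by positivity
    calc (r + Fintype.card ι * k) * ∫ z, ‖S m z‖ ^ 2 ∂noiseLaw +
          (1 + Fintype.card ι) * k * ∑ i, β i ^ 2 * ∫ z, ‖t i m z‖ ^ 2 ∂noiseLaw
        ≤ q * (m * k * (3 * (1 + Fintype.card ι) * G) * q ^ m) +
          (1 + Fintype.card ι) * k * (G * q ^ m) := by
          gcongr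
          exact htG m (by omega)
      -- The source term lacks one factor q. It is supplied by 1 ≤ 3q, whence the 3 in the constant.
      _ ≤ q * (m * k * (3 * (1 + Fintype.card ι) * G) * q ^ m) +
          (1 + Fintype.card ι) * k * (G * q ^ m) * (3 * q) := by
          exact add_le_add le_rfl (le_mul_of_one_le_right (by positivity) hq)
      _ = _ := by
          push_cast
          ring

/-! ### Second moments of block products and of their differences -/

/-- The product of the first `m` block factors. -/
noncomputable def blockProd (A : (Fin 4 → ℝ) → ℂ) (m : ℕ) (z : ℕ → ℝ) : ℂ :=
  ∏ i ∈ Finset.range m, A (block i z)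

theorem blockProd_zero (A : (Fin 4 → ℝ) → ℂ) (z : ℕ → ℝ) : blockProd A 0 z = 1 := by
  simp [blockProd]

theorem blockProd_succ (A : (Fin 4 → ℝ) → ℂ) (m : ℕ) (z : ℕ → ℝ) :
    blockProd A (m + 1) z = A (block m z) * blockProd A m z := by
  rw [blockProd, Finset.prod_range_succ, mul_comm, ← blockProd]

theorem isBlockAdapted_blockProd {A : (Fin 4 → ℝ) → ℂ} (hA : Measurable A) (m : ℕ) :
    IsBlockAdapted m (blockProd A m) := by
  refine ⟨Finset.measurable_fun_prod _ fun i _ => hA.comp (measurable_block i), fun z z' h => ?_⟩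
  refine Finset.prod_congr rfl fun i hi => congrArg A (funext fun j => h _ ?_)
  have := Finset.mem_range.mp hi
  omega

theorem IsBlockAdapted.sub {m : ℕ} {Φ Ψ : (ℕ → ℝ) → ℂ} (hΦ : IsBlockAdapted m Φ)
    (hΨ : IsBlockAdapted m Ψ) : IsBlockAdapted m (fun z => Φ z - Ψ z) :=
  ⟨hΦ.1.sub hΨ.1, fun z z' h =>
    congrArg₂ (· - ·) (hΦ.2 z z' h) (hΨ.2 z z' h)⟩

theorem blockProd_second_moment {A : (Fin 4 → ℝ) → ℂ} (hA : Measurable A)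
    (hA2 : MemLp A 2 blockLaw) {r : ℝ} (har : ∫ b, ‖A b‖ ^ 2 ∂blockLaw ≤ r) (m : ℕ) :
    MemLp (blockProd A m) 2 noiseLaw ∧ ∫ z, ‖blockProd A m z‖ ^ 2 ∂noiseLaw ≤ r ^ m := by
  induction m with
  | zero =>
    have e : blockProd A 0 = fun _ => 1 := funext (blockProd_zero A)
    rw [e]
    exact ⟨memLp_const 1, by simp⟩
  | succ m ih =>
    have e : blockProd A (m + 1) = fun z => A (block m z) * blockProd A m z :=
      funext (blockProd_succ A m)
    have hi : IndepFun (fun z => A (block m z)) (blockProd A m) noiseLaw :=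
      (isBlockAdapted_blockProd hA m).indepFun.comp hA measurable_id
    obtain ⟨h1, h2⟩ := MemLp.mul_of_indepFun hi (memLp_comp_block hA2 m) ih.1
    rw [e]
    refine ⟨h1, ?_⟩
    rw [h2, integral_comp_block (A := fun b => ‖A b‖ ^ 2)
      (hA.norm.pow_const 2).aestronglyMeasurable m, pow_succ']
    have h0 : 0 ≤ ∫ b, ‖A b‖ ^ 2 ∂blockLaw := integral_nonneg fun b => by positivity
    exact mul_le_mul har ih.2 (integral_nonneg fun b => by positivity) (h0.trans har)

/-- The second moment of the block weight. -/
noncomputable def weightMoment : ℝ := ∫ b, blockWeight b ^ 2 ∂blockLaw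

theorem integrable_blockWeight_sq : Integrable (fun b => blockWeight b ^ 2) blockLaw :=
  memLp_blockWeight.integrable_sq

theorem one_le_weightMoment : 1 ≤ weightMoment := by
  calc (1 : ℝ) = ∫ _, (1 : ℝ) ∂blockLaw := by simp
    _ ≤ _ := integral_mono (integrable_const 1) integrable_blockWeight_sq fun b =>
        one_le_pow₀ (one_le_blockWeight b)

/-- A block factor close to one. -/
structure IsFactor (k K f r : ℝ) (A : (Fin 4 → ℝ) → ℂ) : Prop where
  measurable : Measurable A
  memLp : MemLp A 2 blockLaw
  norm_sub_one_le : ∀ b, ‖A b - 1‖ ≤ K * (√k * f) * blockWeight b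
  second_moment : ∫ b, ‖A b‖ ^ 2 ∂blockLaw ≤ r

/-- A coefficient of relative size `τ`, whose mean is smaller by a factor `√k`. -/
structure IsSource (k K f τ : ℝ) (B : (Fin 4 → ℝ) → ℂ) : Prop where
  measurable : Measurable B
  memLp : MemLp B 2 blockLaw
  norm_le : ∀ b, ‖B b‖ ≤ τ * (K * (√k * f) * blockWeight b)
  norm_integral_le : ‖∫ b, B b ∂blockLaw‖ ≤ τ * (K * (√k ^ 2 * f))

/-- The size of the sources in the second moment recursion. -/
noncomputable def sourceSize (K f : ℝ) : ℝ := K ^ 2 * weightMoment * (f * (1 + f))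

theorem sourceSize_nonneg {K f : ℝ} (hf : 0 ≤ f) : 0 ≤ sourceSize K f := by
  have := one_le_weightMoment
  unfold sourceSize
  positivity

section Source

variable {k K f r τ : ℝ} {A B : (Fin 4 → ℝ) → ℂ}

theorem IsSource.second_moment (hB : IsSource k K f τ B) (hk : 0 ≤ k) (hK : 1 ≤ K) (hf : 0 ≤ f) :
    ∫ b, ‖B b‖ ^ 2 ∂blockLaw ≤ k * (τ * sourceSize K f) ^ 2 := by
  have hw := one_le_weightMoment
  have h1 : ∫ b, ‖B b‖ ^ 2 ∂blockLaw ≤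
      ∫ b, (k * (τ * (K * f)) ^ 2) * blockWeight b ^ 2 ∂blockLaw := by
    refine integral_mono ((memLp_two_iff_integrable_sq_norm hB.memLp.1).mp hB.memLp)
      (integrable_blockWeight_sq.const_mul _) fun b => ?_
    calc ‖B b‖ ^ 2 ≤ (τ * (K * (√k * f) * blockWeight b)) ^ 2 := by
          gcongr
          exact hB.norm_le b
      _ = √k ^ 2 * (τ * (K * f)) ^ 2 * blockWeight b ^ 2 := by ring
      _ = _ := by rw [Real.sq_sqrt hk]
  rw [integral_const_mul, ← weightMoment] at h1
  refine h1.trans ?_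
  rw [mul_assoc]
  refine mul_le_mul_of_nonneg_left ?_ hk
  have h2 : K * f * weightMoment ≤ sourceSize K f := by
    have h3 : K * f * weightMoment * 1 ≤ K * f * weightMoment * (K * (1 + f)) := by
      gcongr
      nlinarith
    unfold sourceSize
    linarith
  calc (τ * (K * f)) ^ 2 * weightMoment ≤ (τ * (K * f)) ^ 2 * weightMoment ^ 2 := by
        gcongr
        nlinarith
    _ = τ ^ 2 * (K * f * weightMoment) ^ 2 := by ring
    _ ≤ τ ^ 2 * sourceSize K f ^ 2 := by gcongr
    _ = _ := by ring

/-- E[Ā B] = E[B] + E[(A - 1)‾ B]. The first term is O(k) by the bound on the mean, the second as a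
product of two pathwise bounds of order √k. The two contributions, of sizes f and f², explain the
shape f(1 + f) of `sourceSize`. -/
theorem IsFactor.norm_integral_star_mul_le (hA : IsFactor k K f r A) (hB : IsSource k K f τ B)
    (hk : 0 ≤ k) (hK : 1 ≤ K) (hf : 0 ≤ f) (hτ : 0 ≤ τ) :
    ‖∫ b, star (A b) * B b ∂blockLaw‖ ≤ k * (τ * sourceSize K f) := by
  have hw := one_le_weightMoment
  have iB : Integrable B blockLaw := hB.memLp.integrable one_le_two
  have iAB : Integrable (fun b => star (A b) * B b) blockLaw :=
    hA.memLp.star.integrable_mul hB.memLp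
  have e : ∫ b, star (A b) * B b ∂blockLaw =
      ∫ b, B b ∂blockLaw + ∫ b, (star (A b) * B b - B b) ∂blockLaw := by
    rw [integral_sub iAB iB]
    ring
  have h1 : ‖∫ b, (star (A b) * B b - B b) ∂blockLaw‖ ≤
      k * (τ * (K ^ 2 * f ^ 2)) * weightMoment := by
    rw [weightMoment, ← integral_const_mul]
    refine norm_integral_le_of_norm_le (integrable_blockWeight_sq.const_mul _)
      (Filter.Eventually.of_forall fun b => ?_)
    have e1 : star (A b) * B b - B b = star (A b - 1) * B b := by
      rw [star_sub, star_one]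
      ring
    rw [e1, norm_mul, norm_star]
    calc ‖A b - 1‖ * ‖B b‖
        ≤ (K * (√k * f) * blockWeight b) * (τ * (K * (√k * f) * blockWeight b)) :=
          mul_le_mul (hA.norm_sub_one_le b) (hB.norm_le b) (norm_nonneg _)
            ((norm_nonneg _).trans (hA.norm_sub_one_le b))
      _ = √k ^ 2 * (τ * (K ^ 2 * f ^ 2)) * blockWeight b ^ 2 := by ring
      _ = _ := by rw [Real.sq_sqrt hk]
  rw [e]
  refine (norm_add_le _ _).trans ((add_le_add hB.norm_integral_le h1).trans ?_)
  rw [Real.sq_sqrt hk]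
  have h2 : K * f ≤ K ^ 2 * weightMoment * f := by
    have : K * f * 1 ≤ K * f * (K * weightMoment) := by
      gcongr
      nlinarith
    linarith
  calc τ * (K * (k * f)) + k * (τ * (K ^ 2 * f ^ 2)) * weightMoment
      = k * τ * (K * f) + k * τ * (K ^ 2 * weightMoment * f ^ 2) := by ring
    _ ≤ k * τ * (K ^ 2 * weightMoment * f) + k * τ * (K ^ 2 * weightMoment * f ^ 2) := by gcongr
    _ = _ := by
      unfold sourceSize
      ring

end Source

section Differences

variable {k K f r q τ η T : ℝ} {A A' P P' Q Q' : (Fin 4 → ℝ) → ℂ}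

/-- The difference of the products satisfies D_{m+1} = A D_m + (A - A')∏A', with a single source.
The condition on q allows 3k instead of k so that the same q serves the mixed difference. -/
theorem blockProd_sub_bound (hA : IsFactor k K f r A) (hA' : IsFactor k K f r A')
    (hB : IsSource k K f τ (fun b => A b - A' b)) (hk : 0 ≤ k) (hK : 1 ≤ K) (hf : 0 ≤ f)
    (hτ : 0 ≤ τ) (hrq : r + 3 * k ≤ q) (hq : 1 ≤ 3 * q) {m : ℕ} (hm : m * k ≤ T) :
    MemLp (fun z => blockProd A m z - blockProd A' m z) 2 noiseLaw ∧
      ∫ z, ‖blockProd A m z - blockProd A' m z‖ ^ 2 ∂noiseLaw ≤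
        6 * T * (τ * sourceSize K f) ^ 2 * q ^ m := by
  have hr : 0 ≤ r := (integral_nonneg fun b => by positivity).trans hA.second_moment
  have h := block_recursion_bound (ι := Unit) (A := A) (B := fun _ b => A b - A' b)
    (S := fun m z => blockProd A m z - blockProd A' m z) (t := fun _ m => blockProd A' m)
    (k := k) (r := r) (q := q) (G := (τ * sourceSize K f) ^ 2) (β := fun _ => τ * sourceSize K f)
    (N := m) (m := m)
    hA.measurable (fun _ => hB.measurable) hA.memLp (fun _ => hB.memLp)
    (fun m => (isBlockAdapted_blockProd hA.measurable m).sub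
      (isBlockAdapted_blockProd hA'.measurable m))
    (fun _ m => isBlockAdapted_blockProd hA'.measurable m)
    (fun _ m => (blockProd_second_moment hA'.measurable hA'.memLp hA'.second_moment m).1)
    hk (fun _ => mul_nonneg hτ (sourceSize_nonneg hf)) hA.second_moment
    (fun _ => hA.norm_integral_star_mul_le hB hk hK hf hτ)
    (fun _ => hB.second_moment hk hK hf) (fun z => by simp [blockProd_zero])
    (fun m z => by
      simp only [blockProd_succ, Finset.univ_unique, Finset.sum_singleton]
      ring)
    (by simp; linarith) hq (by positivity)
    (fun n _ => by
      simp only [Finset.univ_unique, Finset.sum_singleton]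
      gcongr
      refine (blockProd_second_moment hA'.measurable hA'.memLp hA'.second_moment n).2.trans ?_
      gcongr
      linarith) le_rfl
  refine ⟨h.1, h.2.trans ?_⟩
  simp only [Fintype.card_unit, Nat.cast_one]
  have : 0 ≤ q := by linarith
  calc m * k * (3 * (1 + 1) * (τ * sourceSize K f) ^ 2) * q ^ m
      ≤ T * (3 * (1 + 1) * (τ * sourceSize K f) ^ 2) * q ^ m := by gcongr
    _ = _ := by ring

/-- With p, q, p', q' the products and S = (p - q) - (p' - q'), one step gives P·S + (P - P')(p' -
q') + (P - Q)(q - q') + ((P - Q) - (P' - Q'))q'. Each of the three sources has order ηk, the first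
two as a product of an η-difference and a k-difference. -/
theorem blockProd_mixed_bound (hP : IsFactor k K f r P) (hP' : IsFactor k K f r P')
    (hQ : IsFactor k K f r Q) (hQ' : IsFactor k K f r Q')
    (hPP : IsSource k K f η (fun b => P b - P' b)) (hQQ : IsSource k K f η (fun b => Q b - Q' b))
    (hPQ : IsSource k K f k (fun b => P b - Q b)) (hPQ' : IsSource k K f k (fun b => P' b - Q' b))
    (hm4 : IsSource k K f (η * k) (fun b => (P b - Q b) - (P' b - Q' b)))
    (hk : 0 ≤ k) (hK : 1 ≤ K) (hf : 0 ≤ f)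
    (hη : 0 ≤ η) (hrq : r + 3 * k ≤ q) (hq : 1 ≤ 3 * q) {m : ℕ} (hm : m * k ≤ T) :
    MemLp (fun z => (blockProd P m z - blockProd Q m z) -
        (blockProd P' m z - blockProd Q' m z)) 2 noiseLaw ∧
      ∫ z, ‖(blockProd P m z - blockProd Q m z) - (blockProd P' m z - blockProd Q' m z)‖ ^ 2
        ∂noiseLaw ≤ 12 * T * ((η * k * sourceSize K f) ^ 2 *
          (1 + 12 * T * sourceSize K f ^ 2)) * q ^ m := by
  have hr : 0 ≤ r := (integral_nonneg fun b => by positivity).trans hP.second_moment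
  have hs := sourceSize_nonneg (K := K) hf
  have hT : 0 ≤ T := (by positivity : 0 ≤ m * k).trans hm
  have hq0 : 0 ≤ q := by linarith
  have hmk : ∀ n < m, (n : ℝ) * k ≤ T := fun n hn => by
    refine le_trans ?_ hm
    gcongr
  let e' : ℕ → (ℕ → ℝ) → ℂ := fun m z => blockProd P' m z - blockProd Q' m z
  let d : ℕ → (ℕ → ℝ) → ℂ := fun m z => blockProd Q m z - blockProd Q' m z
  have had : ∀ {A A' : (Fin 4 → ℝ) → ℂ} (hA : IsFactor k K f r A) (hA' : IsFactor k K f r A')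
      (m : ℕ), IsBlockAdapted m (fun z => blockProd A m z - blockProd A' m z) :=
    fun hA hA' m => (isBlockAdapted_blockProd hA.measurable m).sub
      (isBlockAdapted_blockProd hA'.measurable m)
  have h := block_recursion_bound (ι := Fin 3) (A := P)
    (B := ![fun b => P b - P' b, fun b => P b - Q b, fun b => (P b - Q b) - (P' b - Q' b)])
    (S := fun m z => (blockProd P m z - blockProd Q m z) -
        (blockProd P' m z - blockProd Q' m z))
    (t := ![e', d, blockProd Q'])
    (k := k) (r := r) (q := q)
    (G := (η * k * sourceSize K f) ^ 2 * (1 + 12 * T * sourceSize K f ^ 2))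
    (β := ![η * sourceSize K f, k * sourceSize K f, η * k * sourceSize K f])
    (N := m) (m := m)
    hP.measurable
    (fun i => by
      fin_cases i
      exacts [hPP.measurable, hPQ.measurable, hm4.measurable])
    hP.memLp
    (fun i => by
      fin_cases i
      exacts [hPP.memLp, hPQ.memLp, hm4.memLp])
    (fun m => (had hP hQ m).sub (had hP' hQ' m))
    (fun i m => by
      fin_cases i
      exacts [had hP' hQ' m, had hQ hQ' m, isBlockAdapted_blockProd hQ'.measurable m])
    (fun i m => by
      fin_cases i
      exacts [(blockProd_sub_bound hP' hQ' hPQ' hk hK hf hk hrq hq le_rfl).1,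
        (blockProd_sub_bound hQ hQ' hQQ hk hK hf hη hrq hq le_rfl).1,
        (blockProd_second_moment hQ'.measurable hQ'.memLp hQ'.second_moment m).1])
    hk
    (fun i => by
      fin_cases i
      exacts [mul_nonneg hη hs, mul_nonneg hk hs, mul_nonneg (mul_nonneg hη hk) hs])
    hP.second_moment
    (fun i => by
      fin_cases i
      exacts [hP.norm_integral_star_mul_le hPP hk hK hf hη,
        hP.norm_integral_star_mul_le hPQ hk hK hf hk,
        hP.norm_integral_star_mul_le hm4 hk hK hf (mul_nonneg hη hk)])
    (fun i => by
      fin_cases i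
      exacts [hPP.second_moment hk hK hf, hPQ.second_moment hk hK hf,
        hm4.second_moment hk hK hf])
    (fun z => by simp [blockProd_zero])
    (fun m z => by
      simp only [blockProd_succ, Fin.sum_univ_three, Matrix.cons_val_zero, Matrix.cons_val_one,
        Matrix.cons_val, e', d]
      ring)
    (by simpa using hrq) hq (by positivity)
    (fun n hn => by
      simp only [Fin.sum_univ_three, Matrix.cons_val_zero, Matrix.cons_val_one,
        Matrix.cons_val, e', d]
      have h1 := (blockProd_sub_bound hP' hQ' hPQ' hk hK hf hk hrq hq (hmk n hn)).2
      have h2 := (blockProd_sub_bound hQ hQ' hQQ hk hK hf hη hrq hq (hmk n hn)).2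
      have h3 := (blockProd_second_moment hQ'.measurable hQ'.memLp hQ'.second_moment n).2
      have h4 : r ^ n ≤ q ^ n := by
        gcongr
        linarith
      -- The first two sources contribute 6T each through the simple difference bound, the third
      -- carries the factor ηk itself.
      calc _ ≤ (η * sourceSize K f) ^ 2 * (6 * T * (k * sourceSize K f) ^ 2 * q ^ n) +
            (k * sourceSize K f) ^ 2 * (6 * T * (η * sourceSize K f) ^ 2 * q ^ n) +
            (η * k * sourceSize K f) ^ 2 * q ^ n := by
            gcongr
            exact h3.trans h4
        _ = _ := by ring) le_rfl
  refine ⟨h.1, h.2.trans ?_⟩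
  simp only [Fintype.card_fin, Nat.cast_ofNat]
  calc _ ≤ T * (3 * (1 + 3) * ((η * k * sourceSize K f) ^ 2 *
          (1 + 12 * T * sourceSize K f ^ 2))) * q ^ m := by gcongr
    _ = _ := by ring

end Differences

/-! ### Moments of the time discretisation error at a fixed frequency -/

/-- The difference of the symbols of `4m` steps of size `k` and of `m` steps of size `4k`. -/
noncomputable def stepError (μ ρ h k : ℝ) (m : ℕ) (ξ : ℝ) (z : ℕ → ℝ) : ℂ :=
  blockProd (fineFactor μ ρ h k ξ) m z - blockProd (coarseFactor μ ρ h k ξ) m z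

theorem memLp_blockProd_fineFactor (μ ρ h k ξ : ℝ) (m : ℕ) :
    MemLp (blockProd (fineFactor μ ρ h k ξ) m) 2 noiseLaw :=
  (blockProd_second_moment (measurable_fineFactor ..) (memLp_fineFactor ..) le_rfl m).1

theorem memLp_blockProd_coarseFactor (μ ρ h k ξ : ℝ) (m : ℕ) :
    MemLp (blockProd (coarseFactor μ ρ h k ξ) m) 2 noiseLaw :=
  (blockProd_second_moment (measurable_coarseFactor ..) (memLp_coarseFactor ..) le_rfl m).1

theorem memLp_stepError (μ ρ h k : ℝ) (m : ℕ) (ξ : ℝ) :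
    MemLp (stepError μ ρ h k m ξ) 2 noiseLaw :=
  (memLp_blockProd_fineFactor ..).sub (memLp_blockProd_coarseFactor ..)

theorem norm_add_sq_le (x y : ℂ) : ‖x + y‖ ^ 2 ≤ 2 * ‖x‖ ^ 2 + 2 * ‖y‖ ^ 2 := by
  have h := norm_add_le x y
  have : ‖x + y‖ ^ 2 ≤ (‖x‖ + ‖y‖) ^ 2 := by gcongr
  nlinarith [sq_nonneg (‖x‖ - ‖y‖)]

theorem integral_norm_add_sq_le {Ω : Type*} [MeasurableSpace Ω] {P : Measure Ω} {f g : Ω → ℂ}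
    (hf : MemLp f 2 P) (hg : MemLp g 2 P) : ∫ ω, ‖f ω + g ω‖ ^ 2 ∂P ≤
      2 * ∫ ω, ‖f ω‖ ^ 2 ∂P + 2 * ∫ ω, ‖g ω‖ ^ 2 ∂P := by
  have h1 := (memLp_two_iff_integrable_sq_norm hf.1).mp hf
  have h2 := (memLp_two_iff_integrable_sq_norm hg.1).mp hg
  have h3 := (memLp_two_iff_integrable_sq_norm (hf.add hg).1).mp (hf.add hg)
  rw [← integral_const_mul, ← integral_const_mul, ← integral_add (h1.const_mul 2) (h2.const_mul 2)]
  exact integral_mono h3 ((h1.const_mul 2).add (h2.const_mul 2)) fun ω => norm_add_sq_le _ _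

/-- No cancellation is used: the fine and the coarse products are small separately. -/
theorem stepError_high (μ : ℝ) {ρ h k ξ : ℝ} (hρ : 0 < ρ) (hρ2 : ρ ^ 2 < 1 / 2) (hh : 0 < h)
    (hk : 0 < k) (hξ : |h * ξ| ≤ Real.pi) (hkξ : 1 ≤ k * ξ ^ 2) (m : ℕ) :
    ∫ z, ‖stepError μ ρ h k m ξ z‖ ^ 2 ∂noiseLaw ≤
      4 * (1 - contractionRate ρ * (1 / 5)) ^ m := by
  obtain ⟨h1, h2⟩ := integral_norm_factor_sq_le_const μ hρ hρ2 hh hk hξ hkξ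
  obtain ⟨a1, a2⟩ := blockProd_second_moment (measurable_fineFactor μ ρ h k ξ)
    (memLp_fineFactor ..) h1 m
  obtain ⟨b1, b2⟩ := blockProd_second_moment (measurable_coarseFactor μ ρ h k ξ)
    (memLp_coarseFactor ..) h2 m
  have h3 := integral_norm_add_sq_le a1 b1.neg
  simp only [Pi.neg_apply, norm_neg, ← sub_eq_add_neg] at h3
  unfold stepError
  linarith

theorem one_add_pow_mul_exp_le {c : ℝ} (hc : 0 < c) (n : ℕ) {x : ℝ} (hx : 0 ≤ x) :
    (1 + x) ^ n * Real.exp (-(c * x)) ≤ n.factorial / c ^ n * Real.exp c := by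
  have h1 := Real.pow_div_factorial_le_exp (c * (1 + x)) (by positivity) n
  have hf : (0 : ℝ) < n.factorial := by positivity
  rw [div_le_iff₀ hf, mul_pow] at h1
  rw [Real.exp_neg, ← div_eq_mul_inv, div_le_iff₀ (Real.exp_pos _), mul_assoc, ← Real.exp_add,
    div_mul_eq_mul_div, le_div_iff₀ (by positivity)]
  have e : c + c * x = c * (1 + x) := by ring
  rw [e]
  linarith

/-- A Gaussian beats any polynomial. The factor ξ² is retained to cancel the ξ⁻² of the squared loss
kernel, and four powers of 1 + ξ² leave room for η² and for integration over ξ. -/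
theorem exists_sourceSize_decay {c : ℝ} (hc : 0 < c) {T : ℝ} (hT : 0 ≤ T) (K : ℝ) :
    ∃ C : ℝ, 0 < C ∧ ∀ ξ : ℝ, sourceSize K (freqWeight ξ) ^ 2 *
      (1 + 12 * T * sourceSize K (freqWeight ξ) ^ 2) * Real.exp (-(c * ξ ^ 2)) ≤
        C * (ξ ^ 2 / (1 + ξ ^ 2) ^ 4) := by
  set L := K ^ 2 * weightMoment with hL
  have hL0 : 0 ≤ L := by
    have := one_le_weightMoment
    positivity
  set c1 := 4 * L ^ 2 * (1 + 48 * T * L ^ 2) * 2 ^ 23 with hc1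
  -- The powers y²² and y²⁴ amount to (1 + ξ²)²³, and the claimed decay needs four more.
  set c2 := (27 : ℕ).factorial / c ^ 27 * Real.exp c with hc2
  refine ⟨c1 * c2 + 1, by positivity, fun ξ => ?_⟩
  set y := 1 + |ξ| with hy
  have hξ := abs_nonneg ξ
  have hy1 : 1 ≤ y := by linarith
  have hξy : |ξ| ≤ y := by linarith
  have hyx : y ^ 2 ≤ 2 * (1 + ξ ^ 2) := by
    rw [hy, ← sq_abs ξ]
    nlinarith [sq_nonneg (1 - |ξ|)]
  have f1 : freqWeight ξ ≤ |ξ| * y ^ 5 := by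
    have h1 : 1 + |ξ| * (1 + |ξ|) ≤ y ^ 2 := by rw [hy]; nlinarith
    calc freqWeight ξ ≤ |ξ| * y * (y ^ 2) ^ 2 := by
          unfold freqWeight
          gcongr
      _ = _ := by ring
  have f0 := freqWeight_nonneg ξ
  have f2 : 1 + freqWeight ξ ≤ 2 * y ^ 6 := by
    have h1 : |ξ| * y ^ 5 ≤ y * y ^ 5 := by gcongr
    have h2 : 1 ≤ y ^ 6 := one_le_pow₀ hy1
    nlinarith
  have s0 := sourceSize_nonneg (K := K) f0
  have s1 : sourceSize K (freqWeight ξ) ≤ 2 * L * (|ξ| * y ^ 11) := by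
    calc sourceSize K (freqWeight ξ) ≤ L * (|ξ| * y ^ 5 * (2 * y ^ 6)) := by
          unfold sourceSize
          gcongr
      _ = _ := by ring
  have s2 : sourceSize K (freqWeight ξ) ^ 2 ≤ 4 * L ^ 2 * (ξ ^ 2 * y ^ 22) := by
    calc sourceSize K (freqWeight ξ) ^ 2 ≤ (2 * L * (|ξ| * y ^ 11)) ^ 2 := by gcongr
      _ = 4 * L ^ 2 * (|ξ| ^ 2 * y ^ 22) := by ring
      _ = _ := by rw [sq_abs]
  have s3 : 1 + 12 * T * sourceSize K (freqWeight ξ) ^ 2 ≤ (1 + 48 * T * L ^ 2) * y ^ 24 := by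
    have h1 : ξ ^ 2 * y ^ 22 ≤ y ^ 2 * y ^ 22 := by
      rw [← sq_abs]
      gcongr
    have h2 : 1 ≤ y ^ 24 := one_le_pow₀ hy1
    calc 1 + 12 * T * sourceSize K (freqWeight ξ) ^ 2
        ≤ y ^ 24 + 12 * T * (4 * L ^ 2 * (y ^ 2 * y ^ 22)) := by
          gcongr
          exact s2.trans (by gcongr)
      _ = _ := by ring
  have hx : (0 : ℝ) < 1 + ξ ^ 2 := by positivity
  have hdec := one_add_pow_mul_exp_le hc 27 (sq_nonneg ξ)
  rw [← hc2] at hdec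
  rw [← mul_div_assoc, le_div_iff₀ (by positivity)]
  calc sourceSize K (freqWeight ξ) ^ 2 * (1 + 12 * T * sourceSize K (freqWeight ξ) ^ 2) *
        Real.exp (-(c * ξ ^ 2)) * (1 + ξ ^ 2) ^ 4
      ≤ 4 * L ^ 2 * (ξ ^ 2 * y ^ 22) * ((1 + 48 * T * L ^ 2) * y ^ 24) *
        Real.exp (-(c * ξ ^ 2)) * (1 + ξ ^ 2) ^ 4 := by gcongr
    _ = 4 * L ^ 2 * (1 + 48 * T * L ^ 2) * ξ ^ 2 * (y ^ 2) ^ 23 *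
        Real.exp (-(c * ξ ^ 2)) * (1 + ξ ^ 2) ^ 4 := by ring
    _ ≤ 4 * L ^ 2 * (1 + 48 * T * L ^ 2) * ξ ^ 2 * (2 * (1 + ξ ^ 2)) ^ 23 *
        Real.exp (-(c * ξ ^ 2)) * (1 + ξ ^ 2) ^ 4 := by gcongr
    _ = c1 * ξ ^ 2 * ((1 + ξ ^ 2) ^ 27 * Real.exp (-(c * ξ ^ 2))) := by
        rw [hc1]
        ring
    _ ≤ c1 * ξ ^ 2 * c2 := by gcongr
    _ ≤ (c1 * c2 + 1) * ξ ^ 2 := by nlinarith [sq_nonneg ξ]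

theorem exists_stepError_low (μ : ℝ) {ρ T : ℝ} (hρ : 0 < ρ) (hρ2 : ρ ^ 2 < 1 / 2) (hT : 0 < T) :
    ∃ C : ℝ, 0 < C ∧ ∀ (h k ξ : ℝ) (m : ℕ), 0 < h → 0 < k → 4 * m * k = T → k * ξ ^ 2 ≤ 1 →
      (|h * ξ| ≤ Real.pi → ∫ z, ‖stepError μ ρ h k m ξ z‖ ^ 2 ∂noiseLaw ≤
        C * (k ^ 2 * (ξ ^ 2 / (1 + ξ ^ 2) ^ 4))) ∧
      (|2 * h * ξ| ≤ Real.pi →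
        ∫ z, ‖stepError μ ρ h k m ξ z - stepError μ ρ (2 * h) k m ξ z‖ ^ 2 ∂noiseLaw ≤
          C * (h ^ 4 * k ^ 2 * (ξ ^ 2 / (1 + ξ ^ 2) ^ 2))) := by
  obtain ⟨K, hK, hbd⟩ := exists_block_bounds μ T
  have hcr := contractionRate_pos hρ hρ2
  have hρ1 : ρ ≤ 1 := by nlinarith
  set κ := contractionRate ρ * (16 / (5 * Real.pi ^ 2)) with hκ
  have hκ0 : 0 < κ := by positivity
  have hκ1 : κ ≤ 1 := by
    have h1 := contractionRate_le ρ
    have h2 : 16 / (5 * Real.pi ^ 2) ≤ 1 := by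
      rw [div_le_one (by positivity)]
      nlinarith [Real.pi_gt_three]
    nlinarith
  obtain ⟨C, hC, hdec⟩ := exists_sourceSize_decay (c := κ * T / 4) (by positivity) hT.le K
  refine ⟨12 * T * (C * Real.exp (9 * T / 4)), by positivity, ?_⟩
  intro h k ξ m hh hk hmk hkξ
  have hm1 : (1 : ℝ) ≤ m := by
    rcases Nat.eq_zero_or_pos m with rfl | h0
    · simp at hmk
      linarith
    · exact_mod_cast h0
  have hmkT : m * k ≤ T := by nlinarith
  have hkT : k ≤ T := by nlinarith
  set f := freqWeight ξ with hf
  have hf0 : 0 ≤ f := freqWeight_nonneg ξ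
  set r := Real.exp (-(κ * (k * ξ ^ 2))) with hr
  -- Since r ≥ 1/e ≥ 1/3, one has r + 3k ≤ r(1 + 9k) ≤ q. As mk = T/4, the power q^m costs only the
  -- constant e^{9T/4} and keeps a Gaussian in ξ.
  set q := r * Real.exp (9 * k) with hq
  have hr3 : 1 ≤ 3 * r := by
    have h1 : Real.exp (-1) ≤ r := Real.exp_le_exp.mpr (by nlinarith [mul_nonneg hk.le (sq_nonneg
      ξ)])
    have h2 : Real.exp 1 ≤ 3 := by linarith [Real.exp_one_lt_d9]
    rw [Real.exp_neg] at h1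
    have h3 : (3 : ℝ)⁻¹ ≤ (Real.exp 1)⁻¹ := by gcongr
    linarith
  have hrq : r + 3 * k ≤ q := by
    have h1 := Real.add_one_le_exp (9 * k)
    have h2 : r * (9 * k + 1) ≤ q := by
      rw [hq]
      gcongr
    nlinarith
  have hq3 : 1 ≤ 3 * q := by linarith
  have hq0 : 0 ≤ q := by linarith
  have hqm : q ^ m = Real.exp (9 * T / 4) * Real.exp (-(κ * T / 4 * ξ ^ 2)) := by
    rw [hq, hr, ← Real.exp_add, ← Real.exp_add, ← Real.exp_nat_mul, ← hmk]
    congr 1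
    ring
  have hk2 : √k ^ 2 = k := Real.sq_sqrt hk.le
  have hk3 : √k ^ 3 = k * √k := by rw [pow_succ, hk2]
  have hk4 : √k ^ 4 = k * √k ^ 2 := by
    rw [hk2, show √k ^ 4 = (√k ^ 2) ^ 2 by ring, hk2]
    ring
  have hη : 0 < h ^ 2 * (1 + ξ ^ 2) := by positivity
  have main : ∀ g : ℝ, sourceSize K f ^ 2 * (1 + 12 * T * sourceSize K f ^ 2) * q ^ m * g ^ 2 ≤
      C * Real.exp (9 * T / 4) * (g ^ 2 * (ξ ^ 2 / (1 + ξ ^ 2) ^ 4)) := fun g => by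
    rw [hqm]
    calc _ = sourceSize K f ^ 2 * (1 + 12 * T * sourceSize K f ^ 2) *
          Real.exp (-(κ * T / 4 * ξ ^ 2)) * (Real.exp (9 * T / 4) * g ^ 2) := by ring
      _ ≤ C * (ξ ^ 2 / (1 + ξ ^ 2) ^ 4) * (Real.exp (9 * T / 4) * g ^ 2) := by
          exact mul_le_mul_of_nonneg_right (hdec ξ) (by positivity)
      _ = _ := by ring
  obtain ⟨c1, c2, c3, c4⟩ := hbd ρ h k ξ hρ hρ1 hh hk hkT hkξ hη
  have iF : ∀ h, Integrable (fineFactor μ ρ h k ξ) blockLaw := fun h =>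
    (memLp_fineFactor ..).integrable one_le_two
  have iC : ∀ h, Integrable (coarseFactor μ ρ h k ξ) blockLaw := fun h =>
    (memLp_coarseFactor ..).integrable one_le_two
  have eF : ∀ h, ∫ b, (fineFactor μ ρ h k ξ b - coarseFactor μ ρ h k ξ b) ∂blockLaw =
      fineMean μ h k ξ - coarseMean μ h k ξ := fun h => by
    rw [integral_sub (iF h) (iC h), integral_fineFactor, integral_coarseFactor]
  have e3 : K * (√k ^ 4 * f) = k * (K * (√k ^ 2 * f)) := by rw [hk4]; ring
  have e4 : ∀ b, K * (√k ^ 3 * f) * blockWeight b = k * (K * (√k * f) * blockWeight b) :=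
    fun b => by rw [hk3]; ring
  have fP : |h * ξ| ≤ Real.pi → IsFactor k K f r (fineFactor μ ρ h k ξ) := fun hξ =>
    ⟨measurable_fineFactor .., memLp_fineFactor ..,
      fun b => (norm_fst_le_pairSeminorm hη _).trans (c4 b).1,
      (integral_norm_factor_sq_le_exp μ hρ hρ2 hh hk hξ hkξ).1⟩
  have fQ : |h * ξ| ≤ Real.pi → IsFactor k K f r (coarseFactor μ ρ h k ξ) := fun hξ =>
    ⟨measurable_coarseFactor .., memLp_coarseFactor ..,
      fun b => (norm_fst_le_pairSeminorm hη _).trans (c4 b).2.1,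
      (integral_norm_factor_sq_le_exp μ hρ hρ2 hh hk hξ hkξ).2⟩
  have sPQ : IsSource k K f k (fun b => fineFactor μ ρ h k ξ b - coarseFactor μ ρ h k ξ b) :=
    ⟨(measurable_fineFactor ..).sub (measurable_coarseFactor ..),
      (memLp_fineFactor ..).sub (memLp_coarseFactor ..),
      fun b => ((norm_fst_le_pairSeminorm hη _).trans (c4 b).2.2).trans_eq (e4 b),
      by
        rw [eF]
        exact ((norm_fst_le_pairSeminorm hη _).trans c3).trans_eq e3⟩
  constructor
  · intro hξ
    have hb := (blockProd_sub_bound (fP hξ) (fQ hξ) sPQ hk.le hK hf0 hk.le hrq hq3 hmkT).2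
    refine hb.trans ?_
    have h1 : 0 ≤ sourceSize K f ^ 2 * (12 * T * sourceSize K f ^ 2) * q ^ m * k ^ 2 := by
      positivity
    have h2 : 0 ≤ sourceSize K f ^ 2 * q ^ m * k ^ 2 := by positivity
    calc 6 * T * (k * sourceSize K f) ^ 2 * q ^ m
        = 6 * T * (sourceSize K f ^ 2 * q ^ m * k ^ 2) := by ring
      _ ≤ 12 * T * (sourceSize K f ^ 2 * (1 + 12 * T * sourceSize K f ^ 2) * q ^ m * k ^ 2) := by
          nlinarith
      _ ≤ 12 * T * (C * Real.exp (9 * T / 4) * (k ^ 2 * (ξ ^ 2 / (1 + ξ ^ 2) ^ 4))) := by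
          gcongr 12 * T * ?_
          exact main k
      _ = _ := by ring
  · intro hξ
    have hξ1 : |h * ξ| ≤ Real.pi := by
      refine le_trans ?_ hξ
      rw [mul_assoc, abs_mul 2 (h * ξ), abs_two]
      linarith [abs_nonneg (h * ξ)]
    have hh2 : 0 < 2 * h := by linarith
    have fP' : IsFactor k K f r (fineFactor μ ρ (2 * h) k ξ) :=
      ⟨measurable_fineFactor .., memLp_fineFactor ..,
        fun b => (norm_snd_le_pairSeminorm hη _).trans (c4 b).1,
        (integral_norm_factor_sq_le_exp μ hρ hρ2 hh2 hk hξ hkξ).1⟩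
    have fQ' : IsFactor k K f r (coarseFactor μ ρ (2 * h) k ξ) :=
      ⟨measurable_coarseFactor .., memLp_coarseFactor ..,
        fun b => (norm_snd_le_pairSeminorm hη _).trans (c4 b).2.1,
        (integral_norm_factor_sq_le_exp μ hρ hρ2 hh2 hk hξ hkξ).2⟩
    have sPQ' : IsSource k K f k
        (fun b => fineFactor μ ρ (2 * h) k ξ b - coarseFactor μ ρ (2 * h) k ξ b) :=
      ⟨(measurable_fineFactor ..).sub (measurable_coarseFactor ..),
        (memLp_fineFactor ..).sub (memLp_coarseFactor ..),
        fun b => ((norm_snd_le_pairSeminorm hη _).trans (c4 b).2.2).trans_eq (e4 b),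
        by
          rw [eF]
          exact ((norm_snd_le_pairSeminorm hη _).trans c3).trans_eq e3⟩
    have sPP : IsSource k K f (h ^ 2 * (1 + ξ ^ 2))
        (fun b => fineFactor μ ρ h k ξ b - fineFactor μ ρ (2 * h) k ξ b) :=
      ⟨(measurable_fineFactor ..).sub (measurable_fineFactor ..),
        (memLp_fineFactor ..).sub (memLp_fineFactor ..),
        fun b => by
          have h1 := (norm_sub_le_pairSeminorm hη _).trans
            (mul_le_mul_of_nonneg_left (c4 b).1 hη.le)
          rwa [sub_sub_sub_cancel_right] at h1,
        by
          rw [integral_sub (iF h) (iF _), integral_fineFactor, integral_fineFactor]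
          have h1 := (norm_sub_le_pairSeminorm hη _).trans (mul_le_mul_of_nonneg_left c1 hη.le)
          rwa [sub_sub_sub_cancel_right] at h1⟩
    have sQQ : IsSource k K f (h ^ 2 * (1 + ξ ^ 2))
        (fun b => coarseFactor μ ρ h k ξ b - coarseFactor μ ρ (2 * h) k ξ b) :=
      ⟨(measurable_coarseFactor ..).sub (measurable_coarseFactor ..),
        (memLp_coarseFactor ..).sub (memLp_coarseFactor ..),
        fun b => by
          have h1 := (norm_sub_le_pairSeminorm hη _).trans
            (mul_le_mul_of_nonneg_left (c4 b).2.1 hη.le)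
          rwa [sub_sub_sub_cancel_right] at h1,
        by
          rw [integral_sub (iC h) (iC _), integral_coarseFactor, integral_coarseFactor]
          have h1 := (norm_sub_le_pairSeminorm hη _).trans (mul_le_mul_of_nonneg_left c2 hη.le)
          rwa [sub_sub_sub_cancel_right] at h1⟩
    have s4 : IsSource k K f (h ^ 2 * (1 + ξ ^ 2) * k)
        (fun b => (fineFactor μ ρ h k ξ b - coarseFactor μ ρ h k ξ b) -
          (fineFactor μ ρ (2 * h) k ξ b - coarseFactor μ ρ (2 * h) k ξ b)) :=
      ⟨sPQ.measurable.sub sPQ'.measurable, sPQ.memLp.sub sPQ'.memLp,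
        fun b => by
          have h1 := (norm_sub_le_pairSeminorm hη _).trans
            (mul_le_mul_of_nonneg_left (c4 b).2.2 hη.le)
          rwa [e4, ← mul_assoc _ k] at h1,
        by
          rw [integral_sub (sPQ.memLp.integrable one_le_two) (sPQ'.memLp.integrable one_le_two),
            eF, eF]
          have h1 := (norm_sub_le_pairSeminorm hη _).trans (mul_le_mul_of_nonneg_left c3 hη.le)
          rwa [e3, ← mul_assoc _ k] at h1⟩
    have hb := (blockProd_mixed_bound (fP hξ1) fP' (fQ hξ1) fQ' sPP sQQ sPQ sPQ' s4 hk.le hK hf0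
      hη.le hrq hq3 hmkT).2
    refine hb.trans ?_
    -- η² = h⁴(1 + ξ²)² uses up two of the four available powers of 1 + ξ².
    calc _ = 12 * T * (sourceSize K f ^ 2 * (1 + 12 * T * sourceSize K f ^ 2) * q ^ m *
          (h ^ 2 * (1 + ξ ^ 2) * k) ^ 2) := by ring
      _ ≤ 12 * T * (C * Real.exp (9 * T / 4) *
          ((h ^ 2 * (1 + ξ ^ 2) * k) ^ 2 * (ξ ^ 2 / (1 + ξ ^ 2) ^ 4))) := by
          gcongr 12 * T * ?_
          exact main _
      _ = _ := by
          have : 1 + ξ ^ 2 ≠ 0 := by positivity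
          field_simp

/-! ### The frequency density of the mixed loss increment -/

/-- The Fourier multiplier of the trapezoidal loss functional. -/
noncomputable def lossKernel (x h ξ : ℝ) : ℂ :=
  Complex.exp (-(Complex.I * ((x * ξ : ℝ) : ℂ))) *
    (Complex.I * ((h * Real.cot (h * ξ / 2) : ℝ) : ℂ))

theorem norm_exp_neg_I_mul (y : ℝ) : ‖Complex.exp (-(Complex.I * (y : ℂ)))‖ = 1 := by
  rw [show -(Complex.I * (y : ℂ)) = ((-y : ℝ) : ℂ) * Complex.I by push_cast; ring,
    Complex.norm_exp_ofReal_mul_I]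

theorem norm_lossKernel (x h ξ : ℝ) : ‖lossKernel x h ξ‖ = |h * Real.cot (h * ξ / 2)| := by
  rw [lossKernel, norm_mul, norm_exp_neg_I_mul, one_mul, norm_mul, Complex.norm_I, one_mul,
    Complex.norm_real, Real.norm_eq_abs]

/-- Division by zero makes cot 0 = 0, so the single frequency 0 needs no estimate. -/
theorem lossKernel_zero_right (x h : ℝ) : lossKernel x h 0 = 0 := by
  simp [lossKernel, Real.cot_eq_cos_div_sin]

theorem norm_lossKernel_sq_le (x : ℝ) {h ξ : ℝ} (hh : 0 < h) (hξ0 : ξ ≠ 0)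
    (hξ : |h * ξ| ≤ Real.pi) : ‖lossKernel x h ξ‖ ^ 2 ≤ Real.pi ^ 2 / ξ ^ 2 := by
  have h1 := abs_cot_le (x := h * ξ / 2) (by positivity) (by
    rw [abs_div, abs_two]
    linarith)
  have h2 : 0 < |ξ| := abs_pos.mpr hξ0
  have h3 : ‖lossKernel x h ξ‖ ≤ Real.pi / |ξ| := by
    rw [norm_lossKernel, abs_mul, abs_of_pos hh]
    calc h * |Real.cot (h * ξ / 2)| ≤ h * (Real.pi / (2 * |h * ξ / 2|)) := by gcongr
      _ = Real.pi / |ξ| := by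
        rw [abs_div, abs_two, abs_mul, abs_of_pos hh]
        field_simp
  calc ‖lossKernel x h ξ‖ ^ 2 ≤ (Real.pi / |ξ|) ^ 2 := by gcongr
    _ = _ := by rw [div_pow, sq_abs]

theorem cot_sub_two_mul_cot_two_mul {y : ℝ} (hs : Real.sin y ≠ 0) (hc : Real.cos y ≠ 0) :
    Real.cot y - 2 * Real.cot (2 * y) = Real.tan y := by
  rw [Real.cot_eq_cos_div_sin, Real.cot_eq_cos_div_sin, Real.tan_eq_sin_div_cos,
    Real.sin_two_mul, Real.cos_two_mul']
  field_simp
  ring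

/-- The identity cot y - 2 cot 2y = tan y removes the pole and leaves h tan(hξ/2), which is O(h²|ξ|)
because |hξ/2| ≤ π/4. -/
theorem norm_lossKernel_sub_le (x : ℝ) {h ξ : ℝ} (hh : 0 < h) (hξ0 : ξ ≠ 0)
    (hξ : |2 * h * ξ| ≤ Real.pi) :
    ‖lossKernel x h ξ - lossKernel x (2 * h) ξ‖ ≤ h ^ 2 * |ξ| := by
  set y := h * ξ / 2 with hy
  have hy0 : y ≠ 0 := by positivity
  have hy4 : |y| ≤ Real.pi / 4 := by
    have : |2 * h * ξ| = 4 * |y| := by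
      rw [show 2 * h * ξ = 4 * y by rw [hy]; ring, abs_mul]
      norm_num
    linarith
  have hy1 : |y| ≤ 1 := by linarith [Real.pi_lt_d2]
  have hcos : 1 / 2 ≤ Real.cos y := by
    have h1 := Real.one_sub_sq_div_two_le_cos (x := y)
    have h2 : y ^ 2 ≤ 1 := by
      rw [← sq_abs]
      exact pow_le_one₀ (abs_nonneg y) hy1
    linarith
  have hsin : Real.sin y ≠ 0 := by
    have h1 := Real.mul_abs_le_abs_sin (x := y) (by linarith [Real.pi_pos])
    have h2 : 0 < 2 / Real.pi * |y| := mul_pos (by positivity) (abs_pos.mpr hy0)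
    exact abs_pos.mp (h2.trans_le h1)
  have e : lossKernel x h ξ - lossKernel x (2 * h) ξ =
      Complex.exp (-(Complex.I * ((x * ξ : ℝ) : ℂ))) *
        (Complex.I * ((h * Real.tan y : ℝ) : ℂ)) := by
    rw [← cot_sub_two_mul_cot_two_mul hsin (by linarith), lossKernel, lossKernel,
      show 2 * h * ξ / 2 = 2 * y by rw [hy]; ring, ← hy]
    push_cast
    ring
  have htan : |Real.tan y| ≤ 2 * |y| := by
    rw [Real.tan_eq_sin_div_cos, abs_div, abs_of_pos (by linarith : 0 < Real.cos y),
      div_le_iff₀ (by linarith)]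
    have := Real.abs_sin_le_abs (x := y)
    nlinarith [abs_nonneg y]
  rw [e, norm_mul, norm_exp_neg_I_mul, one_mul, norm_mul, Complex.norm_I, one_mul,
    Complex.norm_real, Real.norm_eq_abs, abs_mul, abs_of_pos hh]
  calc h * |Real.tan y| ≤ h * (2 * |y|) := by gcongr
    _ = h ^ 2 * |ξ| := by
      rw [hy, abs_div, abs_two, abs_mul, abs_of_pos hh]
      ring

/-- The frequencies resolved by a grid of mesh size `h`. -/
noncomputable def frequencyBand (h : ℝ) : Set ℝ := Set.Ioc (-(Real.pi / h)) (Real.pi / h)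

theorem abs_mul_le_of_mem_frequencyBand {h ξ : ℝ} (hh : 0 < h) (hξ : ξ ∈ frequencyBand h) :
    |h * ξ| ≤ Real.pi := by
  have h1 : |ξ| ≤ Real.pi / h := abs_le.mpr ⟨hξ.1.le, hξ.2⟩
  rw [abs_mul, abs_of_pos hh]
  calc h * |ξ| ≤ h * (Real.pi / h) := by gcongr
    _ = Real.pi := by field_simp

theorem le_abs_mul_of_notMem_frequencyBand {h ξ : ℝ} (hh : 0 < h) (hξ : ξ ∉ frequencyBand h) :
    Real.pi ≤ |h * ξ| := by
  by_contra hlt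
  rw [not_le, abs_mul, abs_of_pos hh, mul_comm, ← lt_div_iff₀ hh] at hlt
  exact hξ ⟨(abs_lt.mp hlt).1, (abs_lt.mp hlt).2.le⟩

/-- The density over frequencies of a loss difference in time. -/
noncomputable def errorDensity (μ ρ x h k : ℝ) (m : ℕ) (ξ : ℝ) (z : ℕ → ℝ) : ℂ :=
  (frequencyBand h).indicator (fun ξ => stepError μ ρ h k m ξ z * lossKernel x h ξ) ξ

/-- The density over frequencies of the mixed loss difference. -/
noncomputable def mixedDensity (μ ρ x h k : ℝ) (m : ℕ) (ξ : ℝ) (z : ℕ → ℝ) : ℂ :=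
  errorDensity μ ρ x h k m ξ z - errorDensity μ ρ x (2 * h) k m ξ z

theorem memLp_errorDensity (μ ρ x h k : ℝ) (m : ℕ) (ξ : ℝ) :
    MemLp (errorDensity μ ρ x h k m ξ) 2 noiseLaw := by
  by_cases hξ : ξ ∈ frequencyBand h
  · have e : errorDensity μ ρ x h k m ξ = fun z => stepError μ ρ h k m ξ z * lossKernel x h ξ :=
      funext fun z => Set.indicator_of_mem hξ _
    rw [e]
    exact (memLp_stepError μ ρ h k m ξ).mul_const _
  · have e : errorDensity μ ρ x h k m ξ = fun z => 0 :=
      funext fun z => Set.indicator_of_notMem hξ _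
    rw [e]
    exact MemLp.zero'

theorem memLp_mixedDensity (μ ρ x h k : ℝ) (m : ℕ) (ξ : ℝ) :
    MemLp (mixedDensity μ ρ x h k m ξ) 2 noiseLaw :=
  (memLp_errorDensity ..).sub (memLp_errorDensity ..)

theorem integral_norm_mul_const_sq (f : (ℕ → ℝ) → ℂ) (c : ℂ) :
    ∫ z, ‖f z * c‖ ^ 2 ∂noiseLaw = (∫ z, ‖f z‖ ^ 2 ∂noiseLaw) * ‖c‖ ^ 2 := by
  simp only [norm_mul, mul_pow]
  exact integral_mul_const _ _

/-- On the common band a product rule separates the mesh difference of the time error from that of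
the kernel. Where only the fine mesh resolves ξ there is no mesh difference to use, but then |hξ| ≥
π/2, so 1 ≤ h⁴ξ⁴ and the spare decay in ξ pays for h⁴. -/
theorem exists_mixedDensity_low (μ : ℝ) {ρ T : ℝ} (hρ : 0 < ρ) (hρ2 : ρ ^ 2 < 1 / 2)
    (hT : 0 < T) : ∃ C : ℝ, 0 < C ∧ ∀ (x h k ξ : ℝ) (m : ℕ), 0 < h → 0 < k → 4 * m * k = T →
      k * ξ ^ 2 ≤ 1 → ∫ z, ‖mixedDensity μ ρ x h k m ξ z‖ ^ 2 ∂noiseLaw ≤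
        C * (h ^ 4 * k ^ 2 / (1 + ξ ^ 2) ^ 2) := by
  obtain ⟨C, hC, hlow⟩ := exists_stepError_low μ hρ hρ2 hT
  have hpi := Real.pi_pos
  refine ⟨2 * C * (Real.pi ^ 2 + 1), by positivity, ?_⟩
  intro x h k ξ m hh hk hmk hkξ
  rcases eq_or_ne ξ 0 with rfl | hξ0
  · have e : ∀ z, mixedDensity μ ρ x h k m 0 z = 0 := fun z => by
      classical
      simp only [mixedDensity, errorDensity, Set.indicator_apply, lossKernel_zero_right, mul_zero,
        ite_self, sub_zero]
    simp only [e, norm_zero]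
    rw [show (0 : ℝ) ^ 2 = 0 by norm_num, integral_zero]
    positivity
  have hh2 : 0 < 2 * h := by linarith
  have hξ2 : 0 < ξ ^ 2 := by positivity
  have hx1 : 1 ≤ (1 + ξ ^ 2) := by linarith
  obtain ⟨hs, hm⟩ := hlow h k ξ m hh hk hmk hkξ
  by_cases h1 : ξ ∈ frequencyBand h
  · have b1 := abs_mul_le_of_mem_frequencyBand hh h1
    have kb := norm_lossKernel_sq_le x hh hξ0 b1
    by_cases h2 : ξ ∈ frequencyBand (2 * h)
    · have b2 := abs_mul_le_of_mem_frequencyBand hh2 h2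
      have hs' := (hlow (2 * h) k ξ m hh2 hk hmk hkξ).1 b2
      have ks : ‖lossKernel x h ξ - lossKernel x (2 * h) ξ‖ ^ 2 ≤ h ^ 4 * ξ ^ 2 := by
        calc _ ≤ (h ^ 2 * |ξ|) ^ 2 := by
              gcongr
              exact norm_lossKernel_sub_le x hh hξ0 b2
          _ = h ^ 4 * |ξ| ^ 2 := by ring
          _ = _ := by rw [sq_abs]
      have e : ∀ z, mixedDensity μ ρ x h k m ξ z =
          (stepError μ ρ h k m ξ z - stepError μ ρ (2 * h) k m ξ z) * lossKernel x h ξ +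
          stepError μ ρ (2 * h) k m ξ z * (lossKernel x h ξ - lossKernel x (2 * h) ξ) :=
        fun z => by
          rw [mixedDensity, errorDensity, errorDensity, Set.indicator_of_mem h1,
            Set.indicator_of_mem h2]
          ring
      simp only [e]
      refine (integral_norm_add_sq_le (((memLp_stepError ..).sub (memLp_stepError ..)).mul_const _)
        ((memLp_stepError ..).mul_const _)).trans ?_
      simp only [Pi.sub_apply]
      rw [integral_norm_mul_const_sq, integral_norm_mul_const_sq]
      calc _ ≤ 2 * (C * (h ^ 4 * k ^ 2 * (ξ ^ 2 / (1 + ξ ^ 2) ^ 2)) * (Real.pi ^ 2 / ξ ^ 2)) +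
            2 * (C * (k ^ 2 * (ξ ^ 2 / (1 + ξ ^ 2) ^ 4)) * (h ^ 4 * ξ ^ 2)) := by
            gcongr
            exact hm b2
        _ = 2 * C * (h ^ 4 * k ^ 2 / (1 + ξ ^ 2) ^ 2) * Real.pi ^ 2 +
            2 * C * (h ^ 4 * k ^ 2 / (1 + ξ ^ 2) ^ 2) * ((ξ ^ 2) ^ 2 / (1 + ξ ^ 2) ^ 2) := by
            field_simp
        _ ≤ 2 * C * (h ^ 4 * k ^ 2 / (1 + ξ ^ 2) ^ 2) * Real.pi ^ 2 +
            2 * C * (h ^ 4 * k ^ 2 / (1 + ξ ^ 2) ^ 2) * 1 := by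
            gcongr
            rw [div_le_one (by positivity)]
            gcongr
            linarith
        _ = _ := by ring
    · have b2 := le_abs_mul_of_notMem_frequencyBand hh2 h2
      have e : ∀ z, mixedDensity μ ρ x h k m ξ z = stepError μ ρ h k m ξ z * lossKernel x h ξ :=
        fun z => by
          rw [mixedDensity, errorDensity, errorDensity, Set.indicator_of_mem h1,
            Set.indicator_of_notMem h2, sub_zero]
      simp only [e]
      rw [integral_norm_mul_const_sq]
      have h4 : 1 ≤ h ^ 4 * (ξ ^ 2) ^ 2 := by
        have h5 : 1 ≤ |h * ξ| := by
          rw [mul_assoc, abs_mul 2 (h * ξ), abs_two] at b2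
          linarith [Real.pi_gt_three]
        have h6 : 1 ≤ |h * ξ| ^ 4 := one_le_pow₀ h5
        calc (1 : ℝ) ≤ (|h * ξ| ^ 2) ^ 2 := by rw [← pow_mul]; exact h6
          _ = _ := by
            rw [sq_abs]
            ring
      calc _ ≤ C * (k ^ 2 * (ξ ^ 2 / (1 + ξ ^ 2) ^ 4)) * (Real.pi ^ 2 / ξ ^ 2) := by
            gcongr
            exact hs b1
        _ = C * Real.pi ^ 2 * (k ^ 2 / (1 + ξ ^ 2) ^ 4) * 1 := by field_simp
        _ ≤ C * Real.pi ^ 2 * (k ^ 2 / (1 + ξ ^ 2) ^ 4) * (h ^ 4 * (1 + ξ ^ 2) ^ 2) := by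
            gcongr
            refine h4.trans ?_
            gcongr
            linarith
        _ = C * Real.pi ^ 2 * (h ^ 4 * k ^ 2 / (1 + ξ ^ 2) ^ 2) := by field_simp
        _ ≤ _ := by
            gcongr <;> linarith
  · have h2 : ξ ∉ frequencyBand (2 * h) := fun h2 => by
      have b1 := le_abs_mul_of_notMem_frequencyBand hh h1
      have b2 := abs_mul_le_of_mem_frequencyBand hh2 h2
      rw [mul_assoc, abs_mul 2 (h * ξ), abs_two] at b2
      linarith
    have e : ∀ z, mixedDensity μ ρ x h k m ξ z = 0 := fun z => by
      rw [mixedDensity, errorDensity, errorDensity, Set.indicator_of_notMem h1,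
        Set.indicator_of_notMem h2, sub_zero]
    simp only [e, norm_zero]
    rw [show (0 : ℝ) ^ 2 = 0 by norm_num, integral_zero]
    positivity

theorem integral_norm_errorDensity_sq_high (μ x : ℝ) {ρ h k ξ : ℝ} (hρ : 0 < ρ)
    (hρ2 : ρ ^ 2 < 1 / 2) (hh : 0 < h) (hk : 0 < k) (hkξ : 1 ≤ k * ξ ^ 2) (m : ℕ) :
    ∫ z, ‖errorDensity μ ρ x h k m ξ z‖ ^ 2 ∂noiseLaw ≤
      4 * (1 - contractionRate ρ * (1 / 5)) ^ m * (Real.pi ^ 2 * k) := by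
  have hξ0 : ξ ≠ 0 := by
    rintro rfl
    simp at hkξ
    linarith
  have hθ : 0 ≤ 1 - contractionRate ρ * (1 / 5) := by linarith [contractionRate_le ρ]
  by_cases h1 : ξ ∈ frequencyBand h
  · have b1 := abs_mul_le_of_mem_frequencyBand hh h1
    have e : ∀ z, errorDensity μ ρ x h k m ξ z = stepError μ ρ h k m ξ z * lossKernel x h ξ :=
      fun z => Set.indicator_of_mem h1 _
    simp only [e]
    rw [integral_norm_mul_const_sq]
    refine mul_le_mul (stepError_high μ hρ hρ2 hh hk b1 hkξ m)
      ((norm_lossKernel_sq_le x hh hξ0 b1).trans ?_) (by positivity) (by positivity)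
    rw [div_le_iff₀ (by positivity)]
    nlinarith [sq_nonneg Real.pi]
  · have e : ∀ z, errorDensity μ ρ x h k m ξ z = 0 := fun z => Set.indicator_of_notMem h1 _
    simp only [e, norm_zero]
    rw [show (0 : ℝ) ^ 2 = 0 by norm_num, integral_zero]
    positivity

/-- A resolved frequency with kξ² ≥ 1 forces h² ≤ π²T, so the decay hypothesis is needed only for
such h. On the band h²(1 + ξ²) is bounded, and four of the eight powers of h are traded for (1 +
ξ²)⁻². -/
theorem exists_mixedDensity_high (μ : ℝ) {ρ T : ℝ} (hρ : 0 < ρ) (hρ2 : ρ ^ 2 < 1 / 2)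
    (hT : 0 < T) : ∃ C : ℝ, 0 < C ∧ ∀ (x h k ξ G : ℝ) (m : ℕ), 0 < h → 0 < k → k ≤ T → 0 ≤ G →
      (h ≤ Real.pi * √T → (1 - contractionRate ρ * (1 / 5)) ^ m ≤ G * (h ^ 8 * k ^ 2)) →
      1 ≤ k * ξ ^ 2 → ∫ z, ‖mixedDensity μ ρ x h k m ξ z‖ ^ 2 ∂noiseLaw ≤
        C * G * (h ^ 4 * k ^ 2 / (1 + ξ ^ 2) ^ 2) := by
  have hpi := Real.pi_pos
  refine ⟨16 * (Real.pi ^ 2 * T) * ((Real.pi ^ 2 * T) + Real.pi ^ 2) ^ 2, by positivity, ?_⟩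
  intro x h k ξ G m hh hk hkT hG hexp hkξ
  have hh2 : 0 < 2 * h := by linarith
  by_cases h1 : ξ ∈ frequencyBand h
  · have b1 := abs_mul_le_of_mem_frequencyBand hh h1
    have hhξ : h ^ 2 * ξ ^ 2 ≤ Real.pi ^ 2 := by
      rw [← mul_pow, ← sq_abs]
      gcongr
    have hhT : h ^ 2 ≤ Real.pi ^ 2 * T := by
      calc h ^ 2 ≤ h ^ 2 * (k * ξ ^ 2) := le_mul_of_one_le_right (by positivity) hkξ
        _ = k * (h ^ 2 * ξ ^ 2) := by ring
        _ ≤ T * Real.pi ^ 2 := by gcongr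
        _ = _ := by ring
    have hhle : h ≤ Real.pi * √T := by
      rw [← Real.sqrt_sq hpi.le, ← Real.sqrt_mul (by positivity)]
      exact Real.le_sqrt_of_sq_le hhT
    have e1 := integral_norm_errorDensity_sq_high μ x hρ hρ2 hh hk hkξ m
    have e2 := integral_norm_errorDensity_sq_high μ x hρ hρ2 hh2 hk hkξ m
    have h3 := integral_norm_add_sq_le (memLp_errorDensity μ ρ x h k m ξ)
      (memLp_errorDensity μ ρ x (2 * h) k m ξ).neg
    simp only [Pi.neg_apply, norm_neg, ← sub_eq_add_neg] at h3
    have hb : h ^ 2 * (1 + ξ ^ 2) ≤ Real.pi ^ 2 * T + Real.pi ^ 2 := by linarith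
    unfold mixedDensity
    -- Two densities, each bounded by 4, and a factor 2 from splitting the square.
    calc _ ≤ 16 * ((1 - contractionRate ρ * (1 / 5)) ^ m * (Real.pi ^ 2 * k)) := by linarith
      _ ≤ 16 * (G * (h ^ 8 * k ^ 2) * (Real.pi ^ 2 * T)) := by
          gcongr
          exact hexp hhle
      _ = 16 * (Real.pi ^ 2 * T) * G * (h ^ 4 * k ^ 2 / (1 + ξ ^ 2) ^ 2) *
          (h ^ 2 * (1 + ξ ^ 2)) ^ 2 := by
          field_simp
      _ ≤ 16 * (Real.pi ^ 2 * T) * G * (h ^ 4 * k ^ 2 / (1 + ξ ^ 2) ^ 2) *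
          (Real.pi ^ 2 * T + Real.pi ^ 2) ^ 2 := by gcongr
      _ = _ := by ring
  · have h2 : ξ ∉ frequencyBand (2 * h) := fun h2 => by
      have b1 := le_abs_mul_of_notMem_frequencyBand hh h1
      have b2 := abs_mul_le_of_mem_frequencyBand hh2 h2
      rw [mul_assoc, abs_mul 2 (h * ξ), abs_two] at b2
      linarith
    have e : ∀ z, mixedDensity μ ρ x h k m ξ z = 0 := fun z => by
      rw [mixedDensity, errorDensity, errorDensity, Set.indicator_of_notMem h1,
        Set.indicator_of_notMem h2, sub_zero]
    simp only [e, norm_zero]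
    rw [show (0 : ℝ) ^ 2 = 0 by norm_num, integral_zero]
    positivity

/-! ### Integration over frequencies -/

theorem memLp_two_of_lintegral_le {Ω : Type*} [MeasurableSpace Ω] {P : Measure Ω} {f : Ω → ℂ}
    (hf : AEStronglyMeasurable f P) {b : ℝ} (hb : 0 ≤ b)
    (h : ∫⁻ ω, ‖f ω‖ₑ ^ 2 ∂P ≤ ENNReal.ofReal b) : MemLp f 2 P ∧ ∫ ω, ‖f ω‖ ^ 2 ∂P ≤ b := by
  have e : ∀ ω, ENNReal.ofReal (‖f ω‖ ^ 2) = ‖f ω‖ₑ ^ 2 := fun ω => by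
    rw [ENNReal.ofReal_pow (norm_nonneg _), ofReal_norm]
  have hm : AEStronglyMeasurable (fun ω => ‖f ω‖ ^ 2) P := hf.norm.pow 2
  constructor
  · rw [memLp_two_iff_integrable_sq_norm hf]
    refine ⟨hm, ?_⟩
    rw [hasFiniteIntegral_iff_ofReal (Filter.Eventually.of_forall fun ω => by positivity)]
    simp only [e]
    exact h.trans_lt ENNReal.ofReal_lt_top
  · rw [integral_eq_lintegral_of_nonneg_ae (Filter.Eventually.of_forall fun ω => by positivity)
      hm]
    simp only [e]
    exact ENNReal.toReal_le_of_le_ofReal hb h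

theorem lintegral_inv_one_add_sq :
    ∫⁻ ξ : ℝ, ENNReal.ofReal (1 + ξ ^ 2)⁻¹ = ENNReal.ofReal Real.pi := by
  rw [← ofReal_integral_eq_lintegral_ofReal integrable_inv_one_add_sq
    (Filter.Eventually.of_forall fun ξ => by positivity), integral_univ_inv_one_add_sq]

/-- Cauchy–Schwarz against the weight (1 + ξ²)⁻¹, whose integral is π. -/
theorem lintegral_sq_le_weighted {f : ℝ → ℝ≥0∞} (hf : AEMeasurable f) :
    (∫⁻ ξ, f ξ) ^ 2 ≤ ENNReal.ofReal Real.pi * ∫⁻ ξ, ENNReal.ofReal (1 + ξ ^ 2) * f ξ ^ 2 := by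
  have hm1 : Measurable fun ξ : ℝ => ENNReal.ofReal (√(1 + ξ ^ 2))⁻¹ := by fun_prop
  have hm2 : Measurable fun ξ : ℝ => ENNReal.ofReal √(1 + ξ ^ 2) := by fun_prop
  have h := ENNReal.lintegral_mul_le_Lp_mul_Lq volume Real.HolderConjugate.two_two
    hm1.aemeasurable (hm2.aemeasurable.mul hf)
  have hpos : ∀ ξ : ℝ, 0 < √(1 + ξ ^ 2) := fun ξ => by positivity
  have e0 : ∀ ξ : ℝ, ENNReal.ofReal (√(1 + ξ ^ 2))⁻¹ * (ENNReal.ofReal √(1 + ξ ^ 2) * f ξ) = f ξ :=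
    fun ξ => by
      rw [← mul_assoc, ← ENNReal.ofReal_mul (by positivity), inv_mul_cancel₀ (hpos ξ).ne',
        ENNReal.ofReal_one, one_mul]
  have e1 : ∀ ξ : ℝ, ENNReal.ofReal (√(1 + ξ ^ 2))⁻¹ ^ (2 : ℝ) = ENNReal.ofReal (1 + ξ ^ 2)⁻¹ :=
    fun ξ => by
      rw [ENNReal.rpow_two, ← ENNReal.ofReal_pow (by positivity), inv_pow,
        Real.sq_sqrt (by positivity)]
  have e2 : ∀ ξ : ℝ, (ENNReal.ofReal √(1 + ξ ^ 2) * f ξ) ^ (2 : ℝ) =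
      ENNReal.ofReal (1 + ξ ^ 2) * f ξ ^ 2 := fun ξ => by
    rw [ENNReal.rpow_two, mul_pow, ← ENNReal.ofReal_pow (by positivity),
      Real.sq_sqrt (by positivity)]
  simp only [Pi.mul_apply, e0, e1, e2, lintegral_inv_one_add_sq] at h
  have h2 : ∀ a : ℝ≥0∞, (a ^ (1 / (2 : ℝ))) ^ 2 = a := fun a => by
    rw [← ENNReal.rpow_two, ← ENNReal.rpow_mul]
    norm_num
  calc (∫⁻ ξ, f ξ) ^ 2 ≤ _ := pow_le_pow_left' h 2
    _ = _ := by rw [mul_pow, h2, h2]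

/-- Of the two powers of 1 + ξ² one compensates the Cauchy–Schwarz weight and the other makes the
frequency integral converge, each step giving a factor π. Lower integrals make Tonelli sufficient,
without prior integrability. -/
theorem integral_second_moment_le {Ω : Type*} [MeasurableSpace Ω] {P : Measure Ω} [SFinite P]
    {F : ℝ → Ω → ℂ} (hF : Measurable (Function.uncurry F)) (hF2 : ∀ ξ, MemLp (F ξ) 2 P) {B : ℝ}
    (hB : 0 ≤ B) (hFB : ∀ ξ, ∫ ω, ‖F ξ ω‖ ^ 2 ∂P ≤ B / (1 + ξ ^ 2) ^ 2) :
    MemLp (fun ω => ∫ ξ, F ξ ω) 2 P ∧ ∫ ω, ‖∫ ξ, F ξ ω‖ ^ 2 ∂P ≤ Real.pi ^ 2 * B := by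
  have hsm : AEStronglyMeasurable (fun ω => ∫ ξ, F ξ ω) P := by
    have h1 : StronglyMeasurable (fun p : Ω × ℝ => F p.2 p.1) :=
      (hF.comp measurable_swap).stronglyMeasurable
    exact (h1.integral_prod_right' (ν := (volume : Measure ℝ))).aestronglyMeasurable
  refine memLp_two_of_lintegral_le hsm (by positivity) ?_
  have hme : Measurable fun p : ℝ × Ω => ENNReal.ofReal (1 + p.1 ^ 2) * ‖F p.1 p.2‖ₑ ^ 2 := by
    have : Measurable fun p : ℝ × Ω => ‖F p.1 p.2‖ₑ := hF.enorm
    fun_prop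
  have hsec : ∀ ω, Measurable fun ξ => ‖F ξ ω‖ₑ := fun ω =>
    (hF.comp (measurable_id.prodMk measurable_const)).enorm
  have hin : ∀ ξ, ∫⁻ ω, ‖F ξ ω‖ₑ ^ 2 ∂P ≤ ENNReal.ofReal (B / (1 + ξ ^ 2) ^ 2) := fun ξ => by
    have e : ∀ ω, ‖F ξ ω‖ₑ ^ 2 = ENNReal.ofReal (‖F ξ ω‖ ^ 2) := fun ω => by
      rw [ENNReal.ofReal_pow (norm_nonneg _), ofReal_norm]
    simp only [e]
    rw [← ofReal_integral_eq_lintegral_ofReal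
      ((memLp_two_iff_integrable_sq_norm (hF2 ξ).1).mp (hF2 ξ))
      (Filter.Eventually.of_forall fun ω => by positivity)]
    exact ENNReal.ofReal_le_ofReal (hFB ξ)
  calc ∫⁻ ω, ‖∫ ξ, F ξ ω‖ₑ ^ 2 ∂P
      ≤ ∫⁻ ω, (ENNReal.ofReal Real.pi *
          ∫⁻ ξ, ENNReal.ofReal (1 + ξ ^ 2) * ‖F ξ ω‖ₑ ^ 2) ∂P := by
        refine lintegral_mono fun ω => ?_
        exact (pow_le_pow_left' (enorm_integral_le_lintegral_enorm _) 2).trans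
          (lintegral_sq_le_weighted (hsec ω).aemeasurable)
    _ = ENNReal.ofReal Real.pi *
          ∫⁻ ξ, ENNReal.ofReal (1 + ξ ^ 2) * ∫⁻ ω, ‖F ξ ω‖ₑ ^ 2 ∂P := by
        rw [lintegral_const_mul' _ _ ENNReal.ofReal_ne_top, lintegral_lintegral_swap
          (f := fun ω ξ => ENNReal.ofReal (1 + ξ ^ 2) * ‖F ξ ω‖ₑ ^ 2) (hme.comp
            measurable_swap).aemeasurable]
        congr 1
        refine lintegral_congr fun ξ => ?_
        rw [lintegral_const_mul' _ _ ENNReal.ofReal_ne_top]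
    _ ≤ ENNReal.ofReal Real.pi * ∫⁻ ξ, ENNReal.ofReal B * ENNReal.ofReal (1 + ξ ^ 2)⁻¹ := by
        refine mul_le_mul' le_rfl (lintegral_mono fun ξ => ?_)
        refine (mul_le_mul' le_rfl (hin ξ)).trans (le_of_eq ?_)
        rw [← ENNReal.ofReal_mul (by positivity), ← ENNReal.ofReal_mul hB]
        congr 1
        field_simp
    _ = _ := by
        rw [lintegral_const_mul' _ _ ENNReal.ofReal_ne_top, lintegral_inv_one_add_sq,
          ← ENNReal.ofReal_mul hB, ← ENNReal.ofReal_mul Real.pi_pos.le]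
        congr 1
        ring

theorem measurable_mixedDensity (μ ρ x h k : ℝ) (m : ℕ) :
    Measurable (Function.uncurry (mixedDensity μ ρ x h k m)) := by
  have h1 : ∀ h, Measurable fun p : ℝ × (ℕ → ℝ) => stepError μ ρ h k m p.1 p.2 := fun h => by
    unfold stepError blockProd
    refine Measurable.sub (Finset.measurable_fun_prod _ fun i _ => ?_)
      (Finset.measurable_fun_prod _ fun i _ => ?_)
    · unfold fineFactor fineMean stepDen stepNum symbolD1 symbolD2 block
      fun_prop
    · unfold coarseFactor coarseMean stepDen stepNum symbolD1 symbolD2 block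
      fun_prop
  have h2 : ∀ h, Measurable fun ξ : ℝ => lossKernel x h ξ := fun h => by
    have := measurable_cot
    unfold lossKernel
    fun_prop
  have h3 : ∀ h, Measurable fun p : ℝ × (ℕ → ℝ) => errorDensity μ ρ x h k m p.1 p.2 := fun h => by
    have e : (fun p : ℝ × (ℕ → ℝ) => errorDensity μ ρ x h k m p.1 p.2) =
        (Prod.fst ⁻¹' frequencyBand h).indicator
          (fun p => stepError μ ρ h k m p.1 p.2 * lossKernel x h p.1) := by
      classical
      funext p
      simp only [errorDensity, Set.indicator_apply, Set.mem_preimage]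
    rw [e]
    exact ((h1 h).mul ((h2 h).comp measurable_fst)).indicator
      (measurable_fst measurableSet_Ioc)
  exact (h3 h).sub (h3 (2 * h))

/-! ### The increments of Brownian motion -/

theorem toNNReal_mul_sub {k : ℝ} (hk : 0 < k) (n : ℕ) :
    nndist (Real.toNNReal ((n + 1) * k)).1 (Real.toNNReal (n * k)).1 = k.toNNReal := by
  ext
  have e1 : (Real.toNNReal ((n + 1) * k)).1 = (n + 1) * k := Real.coe_toNNReal _ (by positivity)
  have e2 : (Real.toNNReal (n * k)).1 = n * k := Real.coe_toNNReal _ (by positivity)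
  rw [coe_nndist, Real.coe_toNNReal _ hk.le, e1, e2, Real.dist_eq,
    show (n + 1) * k - n * k = k by ring, abs_of_pos hk]

theorem hasLaw_normalIncrement {Ω : Type*} [MeasurableSpace Ω] {P : Measure Ω}
    {M : ℝ≥0 → Ω → ℝ} (hM : IsPreBrownianReal M P) {k : ℝ} (hk : 0 < k) :
    HasLaw (fun ω => normalIncrement M k ω) noiseLaw P := by
  have hlaw : ∀ n : ℕ, HasLaw (fun ω => normalIncrement M k ω n) (gaussianReal 0 1) P := fun n => by
    have h1 := hM.hasLaw_sub (Real.toNNReal ((n + 1) * k)) (Real.toNNReal (n * k))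
    rw [toNNReal_mul_sub hk] at h1
    have h2 := gaussianReal_div_const h1 (√k)
    have e1 : k.toNNReal / NNReal.mk (√k ^ 2) (sq_nonneg _) = 1 := by
      ext
      simp only [NNReal.coe_div, NNReal.coe_mk, NNReal.coe_one]
      rw [Real.coe_toNNReal _ hk.le, Real.sq_sqrt hk.le, div_self hk.ne']
    rw [zero_div, e1] at h2
    exact h2
  have hind : iIndepFun (fun (n : ℕ) ω => normalIncrement M k ω n) P := by
    have hmono : Monotone fun n : ℕ => Real.toNNReal (n * k) := fun a b hab => by
      apply Real.toNNReal_le_toNNReal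
      gcongr
    have h1 := (hM.hasIndepIncrements.nat hmono).comp (fun _ x => x / √k) fun _ => by fun_prop
    convert h1 using 3 with n ω
    simp [normalIncrement]
  exact hind.hasLaw_infinitePi hlaw (aemeasurable_pi_lambda _ fun n => (hlaw n).aemeasurable)

/-- The coupling of the time levels: a coarse increment is the sum of four fine ones, and √(4k) =
2√k. -/
theorem normalIncrement_four_mul {Ω : Type*} (M : ℝ≥0 → Ω → ℝ) (k : ℝ) (ω : Ω) :
    normalIncrement M (4 * k) ω = fun n => (∑ j, block n (normalIncrement M k ω) j) / 2 := by
  funext n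
  have hs : √(4 * k) = 2 * √k := by
    rw [Real.sqrt_mul (by norm_num), show (4 : ℝ) = 2 ^ 2 by norm_num, Real.sqrt_sq (by norm_num)]
  simp only [block, normalIncrement, Fin.sum_univ_four, hs]
  rw [← add_div, ← add_div, ← add_div, div_div, mul_comm (√k) 2]
  congr 1
  push_cast
  norm_num
  rw [show ((n : ℝ) + 1) * (4 * k) = (4 * n + 3 + 1) * k by ring,
    show (n : ℝ) * (4 * k) = 4 * n * k by ring, show (4 * (n : ℝ) + 1 + 1) = 4 * n + 2 by ring,
    show (4 * (n : ℝ) + 2 + 1) = 4 * n + 3 by ring]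
  ring

/-! ### The mixed loss increment as an integral over frequencies -/

theorem schemeSymbol_four_mul (μ ρ h k : ℝ) (z : ℕ → ℝ) (m : ℕ) (ξ : ℝ) :
    schemeSymbol μ ρ h k z (4 * m) ξ = blockProd (fineFactor μ ρ h k ξ) m z := by
  induction m with
  | zero => simp [schemeSymbol, ampProd, blockProd]
  | succ m ih =>
    rw [blockProd_succ, ← ih, schemeSymbol, ampProd, show 4 * (m + 1) = 4 * m + 1 + 1 + 1 + 1 by
      ring]
    simp only [Finset.prod_range_succ]
    rw [schemeSymbol, ampProd]
    simp only [fineFactor, fineMean, block, Fin.prod_univ_four]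
    simp only [Fin.val_zero, Fin.val_one, Fin.val_two, add_zero, div_eq_mul_inv]
    rw [show ((3 : Fin 4) : ℕ) = 3 from rfl, show 4 * m + 1 + 1 = 4 * m + 2 by ring,
      show 4 * m + 2 + 1 = 4 * m + 3 by ring]
    ring

theorem schemeSymbol_coarse (μ ρ h k : ℝ) (z : ℕ → ℝ) (m : ℕ) (ξ : ℝ) :
    schemeSymbol μ ρ h (4 * k) (fun n => (∑ j, block n z j) / 2) m ξ =
      blockProd (coarseFactor μ ρ h k ξ) m z := by
  have hs : √(ρ * (4 * k)) = 2 * √(ρ * k) := by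
    rw [show ρ * (4 * k) = 2 ^ 2 * (ρ * k) by ring, Real.sqrt_mul (by norm_num),
      Real.sqrt_sq (by norm_num)]
  rw [schemeSymbol, ampProd, blockProd]
  refine Finset.prod_congr rfl fun n _ => ?_
  rw [coarseFactor, coarseMean, hs, mul_assoc, div_eq_mul_inv, mul_comm]

theorem intervalIntegrable_symbol_sub_mul_lossKernel (μ ρ x : ℝ) {h k k' : ℝ} (hh : 0 < h)
    (hk : 0 ≤ k) (hk' : 0 ≤ k') (z z' : ℕ → ℝ) (n n' : ℕ) :
    IntervalIntegrable (fun ξ => (schemeSymbol μ ρ h k z n ξ - schemeSymbol μ ρ h k' z' n' ξ) *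
      lossKernel x h ξ) volume (-(Real.pi / h)) (Real.pi / h) := by
  set G : ℝ → ℂ := fun φ => (h : ℂ) * ((schemeSymbol μ ρ h k z n (φ / h) -
    schemeSymbol μ ρ h k' z' n' (φ / h)) *
      Complex.exp (-(Complex.I * ((x * (φ / h) : ℝ) : ℂ)))) with hG
  have hGd : ContDiff ℝ 1 G := by
    have h1 : ContDiff ℝ 1 fun φ : ℝ => schemeSymbol μ ρ h k z n (φ / h) :=
      (contDiff_schemeSymbol (r := 1) μ ρ h hk z n).comp (by fun_prop)
    have h2 : ContDiff ℝ 1 fun φ : ℝ => schemeSymbol μ ρ h k' z' n' (φ / h) :=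
      (contDiff_schemeSymbol (r := 1) μ ρ h hk' z' n').comp (by fun_prop)
    have h3 : ContDiff ℝ 1 fun φ : ℝ => ((x * (φ / h) : ℝ) : ℂ) :=
      Complex.ofRealCLM.contDiff.comp (f := fun φ : ℝ => x * (φ / h)) (by fun_prop)
    have h4 : ContDiff ℝ 1 fun φ : ℝ => Complex.exp (-(Complex.I * ((x * (φ / h) : ℝ) : ℂ))) :=
      (contDiff_const.mul h3).neg.cexp
    exact contDiff_const.mul ((h1.sub h2).mul h4)
  have hG0 : G 0 = 0 := by simp [hG, schemeSymbol_zero]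
  have h1 := (intervalIntegrable_mul_cot hGd hG0).comp_mul_left (c := h)
  rw [neg_div] at h1
  convert h1 using 2 with ξ
  have e : h * ξ / h = ξ := by field_simp
  simp only [hG, e, lossKernel]
  push_cast
  ring

theorem integrable_errorDensity (μ ρ x : ℝ) {h k : ℝ} (hh : 0 < h) (hk : 0 < k) (m : ℕ)
    (z : ℕ → ℝ) : Integrable fun ξ => errorDensity μ ρ x h k m ξ z := by
  have h1 := intervalIntegrable_symbol_sub_mul_lossKernel μ ρ x hh hk.le
    (by positivity : 0 ≤ 4 * k) z (fun n => (∑ j, block n z j) / 2) (4 * m) m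
  have hle : -(Real.pi / h) ≤ Real.pi / h := by
    have : 0 < Real.pi / h := div_pos Real.pi_pos hh
    linarith
  simp only [schemeSymbol_four_mul, schemeSymbol_coarse] at h1
  rw [intervalIntegrable_iff_integrableOn_Ioc_of_le hle, ← integrable_indicator_iff
    measurableSet_Ioc] at h1
  exact h1

theorem trapezoidalLoss_sub_eq_integral (μ x₀ : ℝ) {ρ h k : ℝ} (hρ : 0 ≤ ρ) (hh : 0 < h)
    (hk : 0 < k) (z : ℕ → ℝ) (m : ℕ) :
    trapezoidalLoss h (scheme μ ρ x₀ h k z (4 * m)) -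
      trapezoidalLoss h (scheme μ ρ x₀ h (4 * k) (fun n => (∑ j, block n z j) / 2) m) =
    -(1 / (4 * Real.pi)) *
      (∫ ξ, errorDensity μ ρ (round (x₀ / h) * h) h k m ξ z).re := by
  have hle : -(Real.pi / h) ≤ Real.pi / h := by
    have : 0 < Real.pi / h := div_pos Real.pi_pos hh
    linarith
  rw [trapezoidalLoss_sub μ x₀ hρ hh hk (by positivity), intervalIntegral.integral_of_le hle]
  simp only [schemeSymbol_four_mul, schemeSymbol_coarse]
  unfold errorDensity
  rw [integral_indicator (f := fun ξ => stepError μ ρ h k m ξ z *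
    lossKernel (round (x₀ / h) * h) h ξ) (s := frequencyBand h) measurableSet_Ioc]
  rfl

/-- The mixed loss increment as a function of the normalised increments. -/
noncomputable def mixedLoss (μ ρ x h k : ℝ) (m : ℕ) (z : ℕ → ℝ) : ℝ :=
  -(1 / (4 * Real.pi)) * (∫ ξ, mixedDensity μ ρ x h k m ξ z).re

theorem meshSize_pos {h₀ : ℝ} (hh : 0 < h₀) (l : ℕ) : 0 < meshSize h₀ l := by
  unfold meshSize
  positivity

theorem timeStep_pos {k₀ : ℝ} (hk : 0 < k₀) (l : ℕ) : 0 < timeStep k₀ l := by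
  unfold timeStep
  positivity

theorem meshSize_eq_div (h₀ : ℝ) (l : ℕ) : meshSize h₀ l = h₀ / 2 ^ l := by
  rw [meshSize, zpow_neg, zpow_natCast, div_eq_mul_inv]

theorem timeStep_eq_div (k₀ : ℝ) (l : ℕ) : timeStep k₀ l = k₀ / 2 ^ (2 * l) := by
  rw [timeStep, zpow_neg, div_eq_mul_inv]
  norm_cast

/-- As x₀ lies on every grid, all meshes carry the same phase e^{-ix₀ξ}, and the kernels differ only
in their cotangents. -/
theorem round_div_meshSize_mul {x₀ h₀ : ℝ} (hh : 0 < h₀) {j : ℤ} (hj : x₀ = j * h₀) (l : ℕ) :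
    round (x₀ / meshSize h₀ l) * meshSize h₀ l = x₀ := by
  have e : x₀ / meshSize h₀ l = ((j * 2 ^ l : ℤ) : ℝ) := by
    rw [hj, meshSize_eq_div]
    push_cast
    field_simp
  rw [e, round_intCast, ← e, div_mul_cancel₀ _ (meshSize_pos hh l).ne']

theorem lossIncrement_eq_mixedLoss {Ω : Type u} (μ : ℝ) {ρ x₀ h₀ k₀ : ℝ} (hρ : 0 ≤ ρ)
    (hh : 0 < h₀) (hk : 0 < k₀) (N₀ : ℕ) (hx : ∃ j : ℤ, x₀ = j * h₀) (M : ℝ≥0 → Ω → ℝ)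
    (l₁ l₂ : ℕ) (ω : Ω) : lossIncrement μ ρ x₀ h₀ k₀ N₀ M (l₁ + 1) (l₂ + 1) ω =
      mixedLoss μ ρ x₀ (meshSize h₀ (l₁ + 1)) (timeStep k₀ (l₂ + 1)) (N₀ * 2 ^ (2 * l₂))
        (normalIncrement M (timeStep k₀ (l₂ + 1)) ω) := by
  obtain ⟨j, hj⟩ := hx
  set k := timeStep k₀ (l₂ + 1) with hkdef
  set h := meshSize h₀ (l₁ + 1) with hhdef
  have hk0 : 0 < k := timeStep_pos hk _
  have hh0 : 0 < h := meshSize_pos hh _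
  have ek : timeStep k₀ l₂ = 4 * k := by
    rw [hkdef, timeStep_eq_div, timeStep_eq_div, mul_add, pow_add]
    field_simp
    norm_num
  have eh : meshSize h₀ l₁ = 2 * h := by
    rw [hhdef, meshSize_eq_div, meshSize_eq_div, pow_succ]
    field_simp
  have en : N₀ * 2 ^ (2 * (l₂ + 1)) = 4 * (N₀ * 2 ^ (2 * l₂)) := by ring
  have key : ∀ l, levelLoss μ ρ x₀ h₀ k₀ N₀ M l (l₂ + 1) ω - levelLoss μ ρ x₀ h₀ k₀ N₀ M l l₂ ω =
      -(1 / (4 * Real.pi)) * (∫ ξ, errorDensity μ ρ x₀ (meshSize h₀ l) k (N₀ * 2 ^ (2 * l₂)) ξ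
        (normalIncrement M k ω)).re := fun l => by
    have h1 := trapezoidalLoss_sub_eq_integral μ x₀ hρ (meshSize_pos hh l) hk0
      (normalIncrement M k ω) (N₀ * 2 ^ (2 * l₂))
    rw [round_div_meshSize_mul hh hj] at h1
    rw [← h1, levelLoss, levelLoss, levelSolution, levelSolution, ek, en, ← hkdef,
      normalIncrement_four_mul]
  have k1 := key (l₁ + 1)
  have k2 := key l₁
  rw [eh] at k2
  rw [← hhdef] at k1
  have hi : ∫ ξ, mixedDensity μ ρ x₀ h k (N₀ * 2 ^ (2 * l₂)) ξ (normalIncrement M k ω) =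
      (∫ ξ, errorDensity μ ρ x₀ h k (N₀ * 2 ^ (2 * l₂)) ξ (normalIncrement M k ω)) -
      ∫ ξ, errorDensity μ ρ x₀ (2 * h) k (N₀ * 2 ^ (2 * l₂)) ξ (normalIncrement M k ω) :=
    integral_sub (integrable_errorDensity μ ρ x₀ hh0 hk0 _ _)
      (integrable_errorDensity μ ρ x₀ (by positivity) hk0 _ _)
  rw [mixedLoss, hi, Complex.sub_re, mul_sub, ← k1, ← k2]
  simp [lossIncrement, mixedDiff, spaceDiff, timeDiff]

/-! ### The conditions on the coarsest levels -/

/-- The restriction on k₀ yields θ^{N₀} ≤ h^{3+β}. One half θ^{4m} of the decay is then at most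
h^{12+4β} ≤ D^{4+4β}h⁸ with D = π√T. The other half is exponentially small in m = T/(4k), hence at
most a multiple of k². -/
theorem exists_rate_bound {θ T β C₀ : ℝ} (hθ0 : 0 < θ) (hθ1 : θ < 1) (hT : 0 < T) (hβ : 0 < β)
    (hC₀ : 0 < C₀) : ∃ G : ℝ, 0 < G ∧ ∀ (l₁max : ℕ) (h₀ k₀ : ℝ) (N₀ : ℕ), 0 < h₀ → 0 < k₀ →
      (N₀ : ℝ) * k₀ = T →
      k₀ * (C₀ + (3 + β) * (l₁max + Real.logb 2 h₀⁻¹)) ≤ T * Real.logb 2 θ⁻¹ →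
      ∀ (l₁ m : ℕ) (k : ℝ), l₁ ≤ l₁max → N₀ ≤ m → 0 < k → 4 * m * k = T →
        meshSize h₀ l₁ ≤ Real.pi * √T → (θ ^ 8) ^ m ≤ G * (meshSize h₀ l₁ ^ 8 * k ^ 2) := by
  set c := Real.log θ⁻¹ with hc
  have hc0 : 0 < c := Real.log_pos ((one_lt_inv₀ hθ0).mpr hθ1)
  have hl2 : 0 < Real.log 2 := Real.log_pos (by norm_num)
  set D := Real.pi * √T with hD
  refine ⟨Real.exp ((4 + 4 * β) * Real.log D) * (2 / (c * T) ^ 2), by positivity, ?_⟩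
  intro l₁max h₀ k₀ N₀ hh hk hN hyp l₁ m k hl hm hk' hmk hhD
  set h := meshSize h₀ l₁ with hhdef
  have hh0 : 0 < h := meshSize_pos hh l₁
  have hlogh : Real.log h = Real.log h₀ - l₁ * Real.log 2 := by
    rw [hhdef, meshSize_eq_div, Real.log_div hh.ne' (by positivity), Real.log_pow]
  have hlD : Real.log h ≤ Real.log D := Real.log_le_log hh0 hhD
  have hl' : (l₁ : ℝ) ≤ l₁max := by exact_mod_cast hl
  have h1 : C₀ + (3 + β) * (l₁max + Real.logb 2 h₀⁻¹) ≤ N₀ * Real.logb 2 θ⁻¹ := by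
    refine le_of_mul_le_mul_left ?_ hk
    calc _ ≤ T * Real.logb 2 θ⁻¹ := hyp
      _ = _ := by
        rw [← hN]
        ring
  have h2 : -((3 + β) * Real.log h) ≤ N₀ * c := by
    have h3 := mul_le_mul_of_nonneg_right h1 hl2.le
    have e1 : Real.logb 2 h₀⁻¹ * Real.log 2 = -Real.log h₀ := by
      rw [Real.logb, div_mul_cancel₀ _ hl2.ne', Real.log_inv]
    have e2 : Real.logb 2 θ⁻¹ * Real.log 2 = c := by
      rw [Real.logb, div_mul_cancel₀ _ hl2.ne']
    have h4 : C₀ * Real.log 2 + (3 + β) * (l₁max * Real.log 2 - Real.log h₀) ≤ N₀ * c := by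
      calc _ = (C₀ + (3 + β) * (l₁max + Real.logb 2 h₀⁻¹)) * Real.log 2 := by
            linear_combination -(3 + β) * e1
        _ ≤ _ := h3
        _ = _ := by linear_combination (N₀ : ℝ) * e2
    have h5 : (3 + β) * (-Real.log h) ≤ (3 + β) * (l₁max * Real.log 2 - Real.log h₀) := by
      have : l₁ * Real.log 2 ≤ l₁max * Real.log 2 := by gcongr
      gcongr
      linarith
    have h6 : 0 < C₀ * Real.log 2 := by positivity
    linarith
  have hNm : (N₀ : ℝ) * c ≤ m * c := by
    have : (N₀ : ℝ) ≤ m := by exact_mod_cast hm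
    gcongr
  have eθ : θ = Real.exp (-c) := by rw [hc, Real.log_inv, neg_neg, Real.exp_log hθ0]
  have e8 : (θ ^ 8) ^ m = Real.exp (-(4 * m * c)) * Real.exp (-(4 * m * c)) := by
    rw [← pow_mul, eθ, ← Real.exp_nat_mul, ← Real.exp_add]
    congr 1
    push_cast
    ring
  have a1 : Real.exp (-(4 * m * c)) ≤ Real.exp ((4 + 4 * β) * Real.log D) * h ^ 8 := by
    have e9 : h ^ 8 = Real.exp (8 * Real.log h) := by
      rw [show (8 : ℝ) = ((8 : ℕ) : ℝ) by norm_num, Real.exp_nat_mul, Real.exp_log hh0]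
    rw [e9, ← Real.exp_add]
    apply Real.exp_le_exp.mpr
    have : (4 + 4 * β) * Real.log h ≤ (4 + 4 * β) * Real.log D := by gcongr
    linarith
  have hy : 0 < 4 * m * c := by
    have : 0 < 4 * (m : ℝ) := by
      by_contra hcon
      have : 4 * (m : ℝ) * k ≤ 0 := mul_nonpos_of_nonpos_of_nonneg (not_lt.mp hcon) hk'.le
      linarith
    positivity
  have a2 : Real.exp (-(4 * m * c)) ≤ 2 / (c * T) ^ 2 * k ^ 2 := by
    have h3 := Real.pow_div_factorial_le_exp (4 * m * c) hy.le 2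
    have e : 4 * m * c = c * T / k := by
      rw [← hmk]
      field_simp
    rw [Real.exp_neg]
    have h4 : 0 < (4 * m * c) ^ 2 / ((2 : ℕ).factorial : ℝ) := by positivity
    refine (inv_anti₀ h4 h3).trans (le_of_eq ?_)
    rw [e]
    simp only [Nat.factorial]
    field_simp
    norm_num
  rw [e8]
  calc _ ≤ (Real.exp ((4 + 4 * β) * Real.log D) * h ^ 8) * (2 / (c * T) ^ 2 * k ^ 2) := by gcongr
    _ = _ := by ring

/-! ### The second moment of the mixed loss increment -/

theorem mixedLoss_second_moment {μ ρ x h k B : ℝ} {m : ℕ} (hB : 0 ≤ B)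
    (hF : ∀ ξ, ∫ z, ‖mixedDensity μ ρ x h k m ξ z‖ ^ 2 ∂noiseLaw ≤ B / (1 + ξ ^ 2) ^ 2) :
    MemLp (mixedLoss μ ρ x h k m) 2 noiseLaw ∧
      ∫ z, mixedLoss μ ρ x h k m z ^ 2 ∂noiseLaw ≤ B := by
  obtain ⟨h1, h2⟩ := integral_second_moment_le (measurable_mixedDensity μ ρ x h k m)
    (memLp_mixedDensity μ ρ x h k m) hB hF
  have hm : MemLp (mixedLoss μ ρ x h k m) 2 noiseLaw := h1.re.const_mul _
  refine ⟨hm, ?_⟩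
  have hpi := Real.pi_pos
  calc ∫ z, mixedLoss μ ρ x h k m z ^ 2 ∂noiseLaw
      ≤ ∫ z, (1 / (4 * Real.pi)) ^ 2 * ‖∫ ξ, mixedDensity μ ρ x h k m ξ z‖ ^ 2 ∂noiseLaw := by
        refine integral_mono hm.integrable_sq
          (((memLp_two_iff_integrable_sq_norm h1.1).mp h1).const_mul _) fun z => ?_
        simp only [mixedLoss]
        rw [mul_pow, neg_sq]
        gcongr ?_ * ?_
        rw [← sq_abs]
        gcongr
        exact Complex.abs_re_le_norm _
    _ ≤ (1 / (4 * Real.pi)) ^ 2 * (Real.pi ^ 2 * B) := by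
        rw [integral_const_mul]
        gcongr
    _ = B / 16 := by
        field_simp
        ring
    _ ≤ B := by linarith

theorem exists_mixedLoss_bound (μ : ℝ) {ρ T : ℝ} (hρ : 0 < ρ) (hρ2 : ρ ^ 2 < 1 / 2) (hT : 0 < T)
    {G : ℝ} (hG : 0 ≤ G) : ∃ C : ℝ, 1 ≤ C ∧ ∀ (x h k : ℝ) (m : ℕ), 0 < h → 0 < k →
      4 * m * k = T →
      (h ≤ Real.pi * √T → (1 - contractionRate ρ * (1 / 5)) ^ m ≤ G * (h ^ 8 * k ^ 2)) →
      MemLp (mixedLoss μ ρ x h k m) 2 noiseLaw ∧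
        ∫ z, mixedLoss μ ρ x h k m z ^ 2 ∂noiseLaw ≤ C * (h ^ 4 * k ^ 2) := by
  obtain ⟨C₁, hC₁, hlow⟩ := exists_mixedDensity_low μ hρ hρ2 hT
  obtain ⟨C₂, hC₂, hhigh⟩ := exists_mixedDensity_high μ hρ hρ2 hT
  have hC₂G : 0 ≤ C₂ * G := by positivity
  -- The summand 1 ensures C ≤ C², which is used when passing to the mean.
  refine ⟨1 + C₁ + C₂ * G, by linarith, ?_⟩
  intro x h k m hh hk hmk hexp
  have hkT : k ≤ T := by
    rcases Nat.eq_zero_or_pos m with rfl | h0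
    · simp at hmk
      linarith
    · have : (1 : ℝ) ≤ m := by exact_mod_cast h0
      nlinarith
  refine mixedLoss_second_moment (by positivity) fun ξ => ?_
  have hA : 0 ≤ h ^ 4 * k ^ 2 / (1 + ξ ^ 2) ^ 2 := by positivity
  rw [mul_div_assoc]
  rcases le_total (k * ξ ^ 2) 1 with h1 | h1
  · refine (hlow x h k ξ m hh hk hmk h1).trans ?_
    gcongr
    linarith
  · refine (hhigh x h k ξ G m hh hk hkT hG hexp h1).trans ?_
    gcongr
    linarith

theorem sq_integral_le_integral_sq {Ω : Type*} [MeasurableSpace Ω] {P : Measure Ω}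
    [IsProbabilityMeasure P] {f : Ω → ℝ} (hf : MemLp f 2 P) :
    (∫ ω, f ω ∂P) ^ 2 ≤ ∫ ω, f ω ^ 2 ∂P := by
  have h1 := variance_nonneg f P
  rw [variance_eq_sub hf] at h1
  simpa using h1

end ImplicitMilstein

/-! ### Choice of θ and transfer to Brownian motion -/

theorem mainTheorem1 (ρ : ℝ) (hρ_pos : 0 < ρ) (hρ_lt : ρ < 1 / √2) :
    ∃ θ : ℝ, 0 < θ ∧ θ < 1 ∧
      ∀ (μ T x₀ : ℝ), 0 < T → ∀ (β C₀ : ℝ), 0 < β → 0 < C₀ →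
        ∃ C : ℝ, 0 < C ∧
          ∀ (Ω : Type u) [MeasurableSpace Ω] (P : Measure Ω) [IsProbabilityMeasure P]
            (M : ℝ≥0 → Ω → ℝ), IsBrownianReal M P →
          ∀ (l₁max : ℕ) (h₀ k₀ : ℝ) (N₀ : ℕ), 0 < h₀ → 0 < k₀ →
            (N₀ : ℝ) * k₀ = T →
            (∃ m : ℤ, x₀ = m * h₀) →
            k₀ * (C₀ + (3 + β) * (l₁max + Real.logb 2 h₀⁻¹)) ≤ T * Real.logb 2 θ⁻¹ →
          ∀ l₁ l₂ : ℕ, 1 ≤ l₁ → l₁ ≤ l₁max → 1 ≤ l₂ →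
            (∀ a ≤ l₁, ∀ b ≤ l₂, ∀ ω, Summable fun j : ℕ =>
              ImplicitMilstein.levelSolution μ ρ x₀ h₀ k₀ N₀ M a b ω ((j : ℤ) + 1)) ∧
            MemLp (ImplicitMilstein.lossIncrement μ ρ x₀ h₀ k₀ N₀ M l₁ l₂) 2 P ∧
            |∫ ω, ImplicitMilstein.lossIncrement μ ρ x₀ h₀ k₀ N₀ M l₁ l₂ ω ∂P| ≤
              C * ImplicitMilstein.meshSize h₀ l₁ ^ 2 * ImplicitMilstein.timeStep k₀ l₂ ∧
            ∫ ω, |ImplicitMilstein.lossIncrement μ ρ x₀ h₀ k₀ N₀ M l₁ l₂ ω| ^ 2 ∂P ≤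
              C * ImplicitMilstein.meshSize h₀ l₁ ^ 4 *
                ImplicitMilstein.timeStep k₀ l₂ ^ 2 := by
  have hρ2 : ρ ^ 2 < 1 / 2 := by
    calc ρ ^ 2 < (1 / √2) ^ 2 := by gcongr
      _ = 1 / 2 := by
        rw [div_pow, Real.sq_sqrt (by norm_num)]
        norm_num
  have hcr := ImplicitMilstein.contractionRate_pos hρ_pos hρ2
  have hcr4 := ImplicitMilstein.contractionRate_le ρ
  set θ₀ := 1 - ImplicitMilstein.contractionRate ρ * (1 / 5) with hθ₀
  have h0 : 0 < θ₀ := by linarith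
  have h1 : θ₀ < 1 := by linarith
  have hθ0 : 0 < θ₀ ^ (1 / 8 : ℝ) := by positivity
  have hθ1 : θ₀ ^ (1 / 8 : ℝ) < 1 := Real.rpow_lt_one h0.le h1 (by norm_num)
  have hθ8 : (θ₀ ^ (1 / 8 : ℝ)) ^ 8 = θ₀ := by
    rw [← Real.rpow_natCast, ← Real.rpow_mul h0.le]
    norm_num
  -- The eighth root makes θ⁸ the high-frequency contraction per block: four powers will pay for h⁸
  -- and four for k².
  refine ⟨θ₀ ^ (1 / 8 : ℝ), hθ0, hθ1, ?_⟩
  intro μ T x₀ hT β C₀ hβ hC₀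
  obtain ⟨G, hG, hrate⟩ := ImplicitMilstein.exists_rate_bound hθ0 hθ1 hT hβ hC₀
  obtain ⟨C, hC, hbound⟩ := ImplicitMilstein.exists_mixedLoss_bound μ hρ_pos hρ2 hT hG.le
  refine ⟨C, by linarith, ?_⟩
  intro Ω _ P _ M hM l₁max h₀ k₀ N₀ hh hk hN hx hyp l₁ l₂ hl₁ hl₁m hl₂
  refine ⟨fun a _ b _ ω => ImplicitMilstein.summable_scheme μ x₀ hρ_pos.le
    (ImplicitMilstein.meshSize_pos hh a).ne' (ImplicitMilstein.timeStep_pos hk b) _ _, ?_⟩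
  obtain ⟨a, rfl⟩ := Nat.exists_eq_add_of_le' hl₁
  obtain ⟨b, rfl⟩ := Nat.exists_eq_add_of_le' hl₂
  have hk' := ImplicitMilstein.timeStep_pos hk (b + 1)
  have hh' := ImplicitMilstein.meshSize_pos hh (a + 1)
  have hmk : 4 * ((N₀ * 2 ^ (2 * b) : ℕ) : ℝ) * ImplicitMilstein.timeStep k₀ (b + 1) = T := by
    rw [← hN, ImplicitMilstein.timeStep_eq_div, mul_add, pow_add]
    push_cast
    field_simp
    ring
  have hrate' := hrate l₁max h₀ k₀ N₀ hh hk hN hyp (a + 1) (N₀ * 2 ^ (2 * b)) _ hl₁m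
    (Nat.le_mul_of_pos_right _ (by positivity)) hk' hmk
  rw [hθ8] at hrate'
  obtain ⟨b1, b2⟩ := hbound x₀ _ _ _ hh' hk' hmk hrate'
  have hlaw := ImplicitMilstein.hasLaw_normalIncrement hM.toIsPreBrownianReal hk'
  have e : ImplicitMilstein.lossIncrement μ ρ x₀ h₀ k₀ N₀ M (a + 1) (b + 1) =
      ImplicitMilstein.mixedLoss μ ρ x₀ (ImplicitMilstein.meshSize h₀ (a + 1))
        (ImplicitMilstein.timeStep k₀ (b + 1)) (N₀ * 2 ^ (2 * b)) ∘
        fun ω => ImplicitMilstein.normalIncrement M (ImplicitMilstein.timeStep k₀ (b + 1)) ω :=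
    funext fun ω => ImplicitMilstein.lossIncrement_eq_mixedLoss μ hρ_pos.le hh hk N₀ hx M a b ω
  have hmem : MemLp (ImplicitMilstein.lossIncrement μ ρ x₀ h₀ k₀ N₀ M (a + 1) (b + 1)) 2 P := by
    rw [← hlaw.map_eq] at b1
    rw [e]
    exact (memLp_map_measure_iff b1.1 hlaw.aemeasurable).mp b1
  have hsq : ∫ ω, ImplicitMilstein.lossIncrement μ ρ x₀ h₀ k₀ N₀ M (a + 1) (b + 1) ω ^ 2 ∂P ≤
      C * (ImplicitMilstein.meshSize h₀ (a + 1) ^ 4 *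
        ImplicitMilstein.timeStep k₀ (b + 1) ^ 2) := by
    rw [e]
    refine le_trans (le_of_eq ?_) b2
    exact hlaw.integral_comp (b1.1.pow 2)
  refine ⟨hmem, ?_, ?_⟩
  -- The square of the mean is at most the second moment, and C ≤ C² turns C h⁴k² into the square of
  -- C h²k.
  · refine abs_le_of_sq_le_sq ?_ (by positivity)
    refine (ImplicitMilstein.sq_integral_le_integral_sq hmem).trans (hsq.trans ?_)
    calc _ ≤ C * C * (ImplicitMilstein.meshSize h₀ (a + 1) ^ 4 *
          ImplicitMilstein.timeStep k₀ (b + 1) ^ 2) := by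
          gcongr
          nlinarith
      _ = _ := by ring
  · simp only [sq_abs]
    rw [mul_assoc]
    exact hsq
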